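/- **Setting.** Let $X=(\mathcal V,\mathcal A)$ be the graph with vertices $\mathcal V=\mathbb Z^2$ and oriented edges $\mathcal A=\{(x,x\pm\delta_i):x\in\mathbb Z^2,\ i=1,2\}$, where $(\delta_1,\delta_2)$ is the canonical basis; for $\mathrm e=(x,y)$ put $\overline{\mathrm e}=(y,x)$. Let $l^2(X)$ be the Hilbert space of pairs of square summable functions $f:\mathcal V\to\mathbb C$, $f:\mathcal A\to\mathbb C$ with $f(\overline{\mathrm e})=-f(\mathrm e)$, with inner product $\langle f,g\rangle=\sum_{x\in\mathcal V}f(x)\overline{g(x)}+\frac12\sum_{\mathrm e\in\mathcal A}f(\mathrm e)\overline{g(\mathrm e)}$. For $m\ge 0$ let $$H_0=\begin{pmatrix} m& d^*\\ d&-m\end{pmatrix},\qquad df(x,y)=f(y)-f(x),\qquad d^*f(x)=-\sum_{\mathrm e=(x,y)\in\mathcal A}f(\mathrm e).$$ Let $V\ge 0$ be a summable potential on vertices and edges with $V(\mathrm e)=V(\overline{\mathrm e})$, put $v_1(\mu)=V(\mu)$, $v_2(\mu)=V((\mu,\mu+\delta_1))$, $v_3(\mu)=V((\mu,\mu+\delta_2))$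 for $\mu\in\mathbb Z^2$, and assume that for $j=1,2,3$ there is $0<\beta_j\le 1$ with $\sum_{\langle\mu\rangle>N}|v_j(\mu)|=O(N^{-2\beta_j})$ as $N\to\infty$, where $\langle\mu\rangle=(1+|\mu|^2)^{1/2}$. Let $\mathbb T^2=\mathbb R^2/\mathbb Z^2$, let $\hat f(\xi)=\sum_{\mu}e^{-2\pi i\xi\cdot\mu}f(\mu)$ for $f\in\ell^2(\mathbb Z^2)$, and let $\mathscr U:l^2(X)\to L^2(\mathbb T^2;\mathbb C^3)$ be the unitary operator that maps $f$ to the triple of Fourier transforms of $f(\mu)$, $f((\mu,\mu+\delta_1))$, $f((\mu,\mu+\delta_2))$. Put $g_j=v_j^{1/2}$, $$a(\xi)=-1+e^{-2\pi i\xi_1},\quad b(\xi)=-1+e^{-2\pi i\xi_2},\quad r_m(\xi)=m^2+|a(\xi)|^2+|b(\xi)|^2,\quad M_m=\sqrt{m^2+8}.$$ For $z\in\mathbb C$, $\xi\in\mathbb T^2$ let $T_{z,m}(\xi)=t^\dagger_{z,m}(\xi)\,A\,t_{z,m}(\xi)$, where $A$ is the $3\times3$ matrix with all entries $1$, $t_{z,m}(\xi):L^2(\mathbb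 T^2;\mathbb C^3)\to\mathbb C^3$ maps $f$ to the vector with components $$(m+z)\int_{\mathbb T^2}\hat g_1(\xi-\eta)f_1(\eta)\,d\eta,\quad a(\xi)\int_{\mathbb T^2}\hat g_2(\xi-\eta)f_2(\eta)\,d\eta,\quad b(\xi)\int_{\mathbb T^2}\hat g_3(\xi-\eta)f_3(\eta)\,d\eta,$$ and $t^\dagger_{z,m}(\xi):\mathbb C^3\to L^2(\mathbb T^2;\mathbb C^3)$ maps $\omega$ to $\big(\omega_1(m+z)\hat g_1(\cdot-\xi),\ \omega_2\overline{a(\xi)}\,\hat g_2(\cdot-\xi),\ \omega_3\overline{b(\xi)}\,\hat g_3(\cdot-\xi)\big)$. Let $d\gamma$ be the one-dimensional Hausdorff measure on level curves of $r_m$, and $$J_z(\rho)=\int_{r_m^{-1}(\rho)}\frac{T_{z,m}(\xi)}{|\nabla r_m(\xi)|}\,d\gamma .$$ Let $\mathcal T=\{\pm m,\pm\sqrt{m^2+4},\pm\sqrt{m^2+8}\}$ and $K(z)=V^{1/2}(H_0-z)^{-1}V^{1/2}$ for $\operatorname{Im}z>0$. **Proposition.** Let $\lambda\in\mathbb R\setminus\mathcal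 T$ and $z=\lambda+i\delta$, $\delta>0$. The integrals defining $J_z(\rho)$ for a.e. $\rho\in(m^2,M_m^2)$, $J_\lambda(u^2)$ for a.e. $u\in[m,M_m]$, $J_\lambda(\lambda^2)$, and $\int_{m^2}^{M_m^2}\frac{J_z(\rho)}{\rho-z^2}\,d\rho$ converge absolutely in the trace norm; the principal value $$P_\lambda=\mathrm{p.v.}\int_m^{M_m}\frac{2u}{u^2-\lambda^2}\,J_\lambda(u^2)\,du=\lim_{\varepsilon\downarrow0}\int_{\{u\in[m,M_m]:\,|u-|\lambda||>\varepsilon\}}\frac{2u}{u^2-\lambda^2}\,J_\lambda(u^2)\,du$$ exists in the trace norm (with the truncated integrals absolutely convergent) and is of trace class; and $$\int_{m^2}^{M_m^2}\frac{J_z(\rho)}{\rho-z^2}\,d\rho\ \longrightarrow\ P_\lambda+i\pi\,\operatorname{sgn}(\lambda)\,J_\lambda(\lambda^2)\qquad\text{in the trace norm as }\delta\downarrow0 .$$ Moreover the norm limit $K(\lambda+i0)=\lim_{\delta\downarrow0}K(\lambda+i\delta)$ exists, and $$\mathscr U\,[\operatorname{Im}K(\lambda+i0)]\,\mathscr U^*=\frac{\pi\operatorname{sgn}(\lambda)}{m+\lambda}\,J_\lambda(\lambda^2),\qquad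 \mathscr U\,[\operatorname{Re}K(\lambda+i0)]\,\mathscr U^*=\frac{\mathscr UV\mathscr U^*}{m+\lambda}\begin{pmatrix}0&0&0\\0&-1&0\\0&0&-1\end{pmatrix}+\frac1{m+\lambda}\,P_\lambda .$$ Here $J_\lambda(\lambda^2)=0$ when $\lambda^2\notin[m^2,M_m^2]$, the level curve being empty. -/

import Mathlib

open MeasureTheory Filter Topology Set
open scoped ENNReal InnerProductSpace ComplexConjugate

noncomputable section

namespace DiracZ2

/-! ### The graph `ℤ²`, cochains and the Hilbert space `l²(X)` -/

/-- The vertices of the graph: the points of `ℤ²`. -/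
abbrev Vertex : Type := Fin 2 → ℤ

/-- The oriented edges of the graph: the triple `(x, i, s)`, with `s = ±1`, stands for the oriented
edge from `x` to `x + s δ_i`. -/
abbrev Edge : Type := Vertex × Fin 2 × ℤˣ

/-- The origin `x` of the oriented edge `(x, y)`. -/
def Edge.source (e : Edge) : Vertex := e.1

/-- The end point `y` of the oriented edge `(x, y)`. -/
def Edge.target (e : Edge) : Vertex := e.1 + Pi.single e.2.1 (e.2.2 : ℤ)

/-- The transpose `(y, x)` of the oriented edge `(x, y)`. -/
def Edge.rev (e : Edge) : Edge := (e.target, e.2.1, -e.2.2)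

/-- `ℓ²` of a discrete set. -/
abbrev Ell2 (ι : Type) : Type := lp (fun _ : ι => ℂ) 2

/-- Pairs of a square summable function on the vertices and a square summable function on the
oriented edges, the latter satisfying `f(e) = - f(ē)`. -/
def cochains : Submodule ℂ (Ell2 Vertex × Ell2 Edge) where
  carrier := {f | ∀ e : Edge, f.2 e.rev = - f.2 e}
  add_mem' := by
    intro f g hf hg e
    have h1 := hf e
    have h2 := hg e
    simp only [Prod.snd_add, lp.coeFn_add, Pi.add_apply, h1, h2]
    ring
  zero_mem' := by intro e; simp
  smul_mem' := by
    intro c f hf e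
    have h1 := hf e
    simp only [Prod.smul_snd, lp.coeFn_smul, Pi.smul_apply, h1, smul_neg]

/-- The space `l²(X)` of square summable cochains. -/
def L2X : Type := cochains

instance : AddCommGroup L2X := inferInstanceAs (AddCommGroup cochains)
instance : Module ℂ L2X := inferInstanceAs (Module ℂ cochains)

/-- The `0`-cochain part (values on the vertices). -/
def L2X.vert (f : L2X) : Ell2 Vertex := f.1.1

/-- The `1`-cochain part (values on the oriented edges). -/
def L2X.edge (f : L2X) : Ell2 Edge := f.1.2

theorem L2X.edge_rev (f : L2X) (e : Edge) : f.edge e.rev = - f.edge e := f.2 e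

@[simp] theorem L2X.vert_add (f g : L2X) : (f + g).vert = f.vert + g.vert := rfl
@[simp] theorem L2X.edge_add (f g : L2X) : (f + g).edge = f.edge + g.edge := rfl
@[simp] theorem L2X.vert_smul (c : ℂ) (f : L2X) : (c • f).vert = c • f.vert := rfl
@[simp] theorem L2X.edge_smul (c : ℂ) (f : L2X) : (c • f).edge = c • f.edge := rfl

theorem L2X.ext' {f g : L2X} (h1 : ∀ x, f.vert x = g.vert x) (h2 : ∀ e, f.edge e = g.edge e) :
    f = g := by
  apply Subtype.ext
  apply Prod.ext
  · exact lp.ext (funext h1)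
  · exact lp.ext (funext h2)

theorem L2X.core_aux (f : L2X) :
    (⟪f.vert, f.vert⟫_ℂ + (1 / 2 : ℂ) * ⟪f.edge, f.edge⟫_ℂ).re =
      ‖f.vert‖ ^ 2 + (1 / 2 : ℝ) * ‖f.edge‖ ^ 2 := by
  have h3 : (1 / 2 : ℂ) = ((1 / 2 : ℝ) : ℂ) := by push_cast; ring
  rw [h3, Complex.add_re, Complex.re_ofReal_mul]
  simpa using congrArg₂ (fun a b : ℝ => a + 1 / 2 * b)
    (inner_self_eq_norm_sq (𝕜 := ℂ) f.vert) (inner_self_eq_norm_sq (𝕜 := ℂ) f.edge)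

/-- The inner product
`⟨f, g⟩ = ∑_{x} f(x) \overline{g(x)} + ½ ∑_{e} f(e) \overline{g(e)}`
(written with Mathlib's convention, conjugate-linear in the first variable). -/
instance L2X.core : InnerProductSpace.Core ℂ L2X where
  inner f g := ⟪f.vert, g.vert⟫_ℂ + (1 / 2 : ℂ) * ⟪f.edge, g.edge⟫_ℂ
  conj_inner_symm f g := by
    simp only [map_add, map_mul, inner_conj_symm, map_div₀, map_one, map_ofNat]
  re_inner_nonneg f := by
    have h := L2X.core_aux f
    rw [RCLike.re_to_complex, h]; positivity
  add_left f g h := by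
    simp only [L2X.vert_add, L2X.edge_add, inner_add_left]; ring
  smul_left f g c := by
    simp only [L2X.vert_smul, L2X.edge_smul, inner_smul_left]; ring
  definite f hf := by
    have h := L2X.core_aux f
    rw [hf, Complex.zero_re] at h
    have hv : ‖f.vert‖ = 0 := by nlinarith [sq_nonneg ‖f.vert‖, sq_nonneg ‖f.edge‖]
    have he : ‖f.edge‖ = 0 := by nlinarith [sq_nonneg ‖f.vert‖, sq_nonneg ‖f.edge‖]
    rw [norm_eq_zero] at hv he
    exact Subtype.ext (Prod.ext hv he)

instance : NormedAddCommGroup L2X := L2X.core.toNormedAddCommGroup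
instance : InnerProductSpace ℂ L2X := InnerProductSpace.ofCore L2X.core.toCore

theorem L2X.inner_def (f g : L2X) :
    ⟪f, g⟫_ℂ = ⟪f.vert, g.vert⟫_ℂ + (1 / 2 : ℂ) * ⟪f.edge, g.edge⟫_ℂ := rfl

/-! ### Building square summable functions -/

theorem memℓp_two_iff {ι : Type} {f : ι → ℂ} : Memℓp f 2 ↔ Summable fun i => ‖f i‖ ^ 2 := by
  rw [memℓp_gen_iff (by norm_num)]
  simp

theorem memℓp_add {ι : Type} {f g : ι → ℂ} (hf : Memℓp f 2) (hg : Memℓp g 2) :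
    Memℓp (fun i => f i + g i) 2 := Memℓp.add (E := fun _ : ι => ℂ) hf hg

theorem memℓp_neg {ι : Type} {f : ι → ℂ} (hf : Memℓp f 2) :
    Memℓp (fun i => - f i) 2 := Memℓp.neg (E := fun _ : ι => ℂ) hf

theorem memℓp_sub {ι : Type} {f g : ι → ℂ} (hf : Memℓp f 2) (hg : Memℓp g 2) :
    Memℓp (fun i => f i - g i) 2 := Memℓp.sub (E := fun _ : ι => ℂ) hf hg

theorem memℓp_const_mul {ι : Type} {f : ι → ℂ} (c : ℂ) (hf : Memℓp f 2) :
    Memℓp (fun i => c * f i) 2 := Memℓp.const_mul hf c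

theorem memℓp_comp {ι κ : Type} {f : κ → ℂ} (hf : Memℓp f 2) (e : ι → κ)
    (he : Function.Injective e) : Memℓp (fun i => f (e i)) 2 := by
  rw [memℓp_two_iff] at *
  exact hf.comp_injective he

theorem memℓp_edge {f : Edge → ℂ} (hf : ∀ i s, Memℓp (fun x => f (x, i, s)) 2) : Memℓp f 2 := by
  rw [memℓp_two_iff]
  rw [← (Equiv.prodComm (Fin 2 × ℤˣ) Vertex).summable_iff]
  change Summable fun p : (Fin 2 × ℤˣ) × Vertex => ‖f (p.2, p.1)‖ ^ 2
  rw [summable_prod_of_nonneg (fun _ => sq_nonneg _)]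
  exact ⟨fun p => memℓp_two_iff.1 (hf p.1 p.2), (hasSum_fintype _).summable⟩

theorem memℓp_slice (f : Ell2 Edge) (i : Fin 2) (s : ℤˣ) : Memℓp (fun x => f (x, i, s)) 2 :=
  memℓp_comp (lp.memℓp f) (fun x => (x, i, s)) (fun x y h => by simpa using h)

/-- Assembling a square summable cochain from its values. -/
def L2X.mk (f : Vertex → ℂ) (g : Edge → ℂ) (hf : Memℓp f 2) (hg : Memℓp g 2)
    (hrev : ∀ e : Edge, g e.rev = - g e) : L2X :=
  ⟨(⟨f, hf⟩, ⟨g, hg⟩), hrev⟩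

@[simp] theorem L2X.mk_vert {f g hf hg h} (x : Vertex) : (L2X.mk f g hf hg h).vert x = f x := rfl
@[simp] theorem L2X.mk_edge {f g hf hg h} (e : Edge) : (L2X.mk f g hf hg h).edge e = g e := rfl

theorem Edge.rev_mk (x : Vertex) (i : Fin 2) (s : ℤˣ) :
    Edge.rev (x, i, s) = (x + Pi.single i (s : ℤ), i, -s) := rfl

/-! ### `l²(X)` and `ℓ²(ℤ²)³` -/

/-- The restriction of a cochain to the edges `(μ, μ + s δ_i)`, `μ ∈ ℤ²`. -/
def L2X.slice (f : L2X) (i : Fin 2) (s : ℤˣ) : Ell2 Vertex :=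
  ⟨fun μ => f.edge (μ, i, s), memℓp_slice f.edge i s⟩

/-- The values of a cochain on the cells `μ`, `μ e₁`, `μ e₂` for `μ ∈ ℤ²`, where `e_j` is the
oriented edge from `0` to `δ_j`. -/
def L2X.cells (f : L2X) : PiLp 2 (fun _ : Fin 3 => Ell2 Vertex) :=
  WithLp.toLp 2 (Fin.cons f.vert fun i => f.slice i 1)

theorem L2X.slice_neg (f : L2X) (i : Fin 2) (x : Vertex) :
    f.edge (x, i, -1) = - f.edge (x - Pi.single i 1, i, 1) := by
  have h := f.edge_rev (x - Pi.single i 1, i, 1)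
  rw [Edge.rev_mk] at h
  rw [← h]; simp

theorem L2X.inner_slice_neg (f g : L2X) (i : Fin 2) :
    ⟪f.slice i (-1), g.slice i (-1)⟫_ℂ = ⟪f.slice i 1, g.slice i 1⟫_ℂ := by
  rw [lp.inner_eq_tsum, lp.inner_eq_tsum,
    ← (Equiv.subRight (Pi.single i 1 : Vertex)).tsum_eq
      (fun x => ⟪f.slice i 1 x, g.slice i 1 x⟫_ℂ)]
  refine tsum_congr fun x => ?_
  simp only [L2X.slice, L2X.slice_neg, inner_neg_neg, Equiv.subRight_apply]

theorem L2X.inner_edge (f g : L2X) :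
    ⟪f.edge, g.edge⟫_ℂ = 2 * ∑ i, ⟪f.slice i 1, g.slice i 1⟫_ℂ := by
  have h := lp.hasSum_inner (𝕜 := ℂ) f.edge g.edge
  rw [← (Equiv.prodComm (Fin 2 × ℤˣ) Vertex).hasSum_iff] at h
  have h1 : ∀ p : Fin 2 × ℤˣ, HasSum
      (fun c => ((fun e => ⟪f.edge e, g.edge e⟫_ℂ) ∘ Equiv.prodComm (Fin 2 × ℤˣ) Vertex) (p, c))
      ⟪f.slice p.1 p.2, g.slice p.1 p.2⟫_ℂ :=
    fun p => lp.hasSum_inner (𝕜 := ℂ) (f.slice p.1 p.2) (g.slice p.1 p.2)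
  have h2 := h.prod_fiberwise h1
  rw [h2.unique (hasSum_fintype _), Fintype.sum_prod_type, Finset.mul_sum]
  refine Finset.sum_congr rfl fun i _ => ?_
  have hu : (Finset.univ : Finset ℤˣ) = {1, -1} := by decide
  rw [hu, Finset.sum_pair (by decide), L2X.inner_slice_neg]
  ring

theorem L2X.inner_cells (f g : L2X) : ⟪f.cells, g.cells⟫_ℂ = ⟪f, g⟫_ℂ := by
  rw [L2X.inner_def, L2X.inner_edge, PiLp.inner_apply, Fin.sum_univ_succ]
  simp [L2X.cells]

/-- The cochain with prescribed values on the cells `μ`, `μ e₁`, `μ e₂`. -/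
def L2X.ofCells (h : PiLp 2 (fun _ : Fin 3 => Ell2 Vertex)) : L2X :=
  L2X.mk (fun x => h 0 x)
    (fun e => if e.2.2 = 1 then h e.2.1.succ e.1 else - h e.2.1.succ (e.1 - Pi.single e.2.1 1))
    (lp.memℓp (h 0))
    (memℓp_edge fun i s => by
      by_cases hs : s = 1
      · simp only [hs, if_true]
        exact lp.memℓp (h i.succ)
      · simp only [hs, if_false]
        exact memℓp_neg (memℓp_comp (lp.memℓp (h i.succ))
          (fun x => x - Pi.single i 1) (fun x y hxy => by simpa using hxy)))
    (by
      rintro ⟨x, i, s⟩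
      rw [Edge.rev_mk]
      rcases Int.units_eq_one_or s with rfl | rfl
      · simp
      · simp [sub_eq_add_neg, Pi.single_neg])

/-- The unitary identification of `l²(X)` with `ℓ²(ℤ²)³` given by the values on the cells
`μ`, `μ e₁`, `μ e₂`. -/
def cellEquiv : L2X ≃ₗᵢ[ℂ] PiLp 2 (fun _ : Fin 3 => Ell2 Vertex) :=
  LinearEquiv.isometryOfInner
    { toFun := L2X.cells
      map_add' := fun f g => by
        ext j μ
        refine Fin.cases rfl (fun i => rfl) j
      map_smul' := fun c f => by
        ext j μ
        refine Fin.cases rfl (fun i => rfl) j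
      invFun := L2X.ofCells
      left_inv := fun f => by
        refine L2X.ext' (fun x => rfl) ?_
        rintro ⟨x, i, s⟩
        rcases Int.units_eq_one_or s with rfl | rfl
        · simp [L2X.ofCells, L2X.cells, L2X.slice]
        · simp [L2X.ofCells, L2X.cells, L2X.slice, L2X.slice_neg]
      right_inv := fun h => by
        ext j μ
        refine Fin.cases ?_ (fun i => ?_) j <;> simp [L2X.ofCells, L2X.cells, L2X.slice] }
    L2X.inner_cells

instance : CompleteSpace L2X :=
  (cellEquiv.toIsometryEquiv.completeSpace_iff).2 inferInstance

/-! ### Operators on `l²(X)` -/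

theorem L2X.continuous_vert (x : Vertex) : Continuous fun f : L2X => f.vert x := by
  have : (fun f : L2X => f.vert x) = fun f => cellEquiv f 0 x := rfl
  rw [this]
  have h1 : Continuous fun f : L2X => cellEquiv f 0 :=
    (PiLp.continuous_apply 2 _ 0).comp cellEquiv.continuous
  exact ((lp.evalCLM ℂ (fun _ : Vertex => ℂ) 2 x).continuous).comp h1

theorem L2X.continuous_edge (e : Edge) : Continuous fun f : L2X => f.edge e := by
  have key : ∀ (i : Fin 2) (x : Vertex), Continuous fun f : L2X => f.edge (x, i, 1) := by
    intro i x
    have : (fun f : L2X => f.edge (x, i, 1)) = fun f => cellEquiv f i.succ x := rfl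
    rw [this]
    have h1 : Continuous fun f : L2X => cellEquiv f i.succ :=
      (PiLp.continuous_apply 2 _ i.succ).comp cellEquiv.continuous
    exact ((lp.evalCLM ℂ (fun _ : Vertex => ℂ) 2 x).continuous).comp h1
  obtain ⟨x, i, s⟩ := e
  rcases Int.units_eq_one_or s with rfl | rfl
  · exact key i x
  · simp only [L2X.slice_neg]
    exact (key i _).neg

/-- A linear operator whose matrix rows are continuous is bounded (closed graph theorem). -/
theorem L2X.continuous_of_coord (T : L2X →ₗ[ℂ] L2X)
    (h1 : ∀ x, Continuous fun f => (T f).vert x) (h2 : ∀ e, Continuous fun f => (T f).edge e) :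
    Continuous T := by
  refine T.continuous_of_seq_closed_graph fun u f g hu hTu => ?_
  refine L2X.ext' (fun x => ?_) (fun e => ?_)
  · exact tendsto_nhds_unique (((L2X.continuous_vert x).tendsto g).comp hTu)
      (((h1 x).tendsto f).comp hu)
  · exact tendsto_nhds_unique (((L2X.continuous_edge e).tendsto g).comp hTu)
      (((h2 e).tendsto f).comp hu)

/-- The coboundary operator, `d f (e) = f(y) - f(x)` for `e = (x, y)`. -/
def coboundary (f : Vertex → ℂ) (e : Edge) : ℂ := f e.target - f e.source

/-- The formal adjoint of the coboundary operator, `d* f (x) = - ∑_{e ∈ A_x} f(e)`, where `A_x` is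
the set of the four oriented edges with origin `x`. -/
def coboundaryAdj (f : Edge → ℂ) (x : Vertex) : ℂ := - ∑ p : Fin 2 × ℤˣ, f (x, p)

theorem memℓp_coboundary {f : Vertex → ℂ} (hf : Memℓp f 2) : Memℓp (coboundary f) 2 := by
  refine memℓp_edge fun i s => ?_
  have hinj : Function.Injective fun x : Vertex => x + Pi.single i (s : ℤ) :=
    fun x y h => add_right_cancel h
  exact memℓp_sub (memℓp_comp hf _ hinj) hf

theorem memℓp_coboundaryAdj (f : Ell2 Edge) : Memℓp (coboundaryAdj f) 2 :=
  memℓp_neg (Memℓp.finsetSum (E := fun _ : Vertex => ℂ) Finset.univ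
    (f := fun (p : Fin 2 × ℤˣ) x => f (x, p)) fun p _ => memℓp_slice f p.1 p.2)

theorem coboundary_rev (f : Vertex → ℂ) (e : Edge) :
    coboundary f e.rev = - coboundary f e := by
  obtain ⟨x, i, s⟩ := e
  simp [coboundary, Edge.rev, Edge.target, Edge.source, Pi.single_neg]

/-- The Dirac-type operator `H₀ = [[m, d*], [d, -m]]` on `l²(X)`. -/
def H₀ (m : ℝ) : L2X →L[ℂ] L2X :=
  let T : L2X →ₗ[ℂ] L2X :=
    { toFun := fun f => L2X.mk
        (fun x => (m : ℂ) * f.vert x + coboundaryAdj f.edge x)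
        (fun e => coboundary f.vert e - (m : ℂ) * f.edge e)
        (memℓp_add (memℓp_const_mul (m : ℂ) (lp.memℓp f.vert)) (memℓp_coboundaryAdj f.edge))
        (memℓp_sub (memℓp_coboundary (lp.memℓp f.vert)) (memℓp_const_mul (m : ℂ) (lp.memℓp f.edge)))
        (fun e => by rw [coboundary_rev, L2X.edge_rev]; ring)
      map_add' := fun f g => by
        refine L2X.ext' (fun x => ?_) (fun e => ?_)
        · simp [coboundaryAdj, Finset.sum_add_distrib]; ring
        · simp [coboundary]; ring
      map_smul' := fun c f => by
        refine L2X.ext' (fun x => ?_) (fun e => ?_)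
        · simp [coboundaryAdj, ← Finset.mul_sum]; ring
        · simp [coboundary]; ring }
  ⟨T, L2X.continuous_of_coord T
    (fun x => by
      have := L2X.continuous_vert x
      have h : ∀ e, Continuous fun f : L2X => f.edge e := L2X.continuous_edge
      simp only [T, LinearMap.coe_mk, AddHom.coe_mk, L2X.mk_vert, coboundaryAdj]
      fun_prop)
    (fun e => by
      have h : ∀ x, Continuous fun f : L2X => f.vert x := L2X.continuous_vert
      have := L2X.continuous_edge e
      simp only [T, LinearMap.coe_mk, AddHom.coe_mk, L2X.mk_edge, coboundary]
      fun_prop)⟩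

theorem H₀_vert (m : ℝ) (f : L2X) (x : Vertex) :
    (H₀ m f).vert x = m * f.vert x + coboundaryAdj f.edge x := rfl

theorem H₀_edge (m : ℝ) (f : L2X) (e : Edge) :
    (H₀ m f).edge e = coboundary f.vert e - m * f.edge e := rfl

/-! ### The potential -/

/-- A nonnegative summable potential on vertices and edges, with `V(e) = V(ē)`. -/
structure Potential where
  vert : Vertex → ℝ
  edge : Edge → ℝ
  vert_nonneg : ∀ x, 0 ≤ vert x
  edge_nonneg : ∀ e, 0 ≤ edge e
  edge_rev : ∀ e : Edge, edge e.rev = edge e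
  summable_vert : Summable vert
  summable_edge : Summable edge

theorem exists_bound_of_summable {ι : Type} {f : ι → ℝ} (hf : Summable f) :
    ∃ C, ∀ i, ‖f i‖ ≤ C :=
  ⟨∑' i, ‖f i‖, fun i => hf.norm.le_tsum i fun _ _ => norm_nonneg _⟩

theorem memℓp_mul_of_bound {ι : Type} {w : ι → ℝ} {f : ι → ℂ} (hw : ∃ C, ∀ i, ‖w i‖ ≤ C)
    (hf : Memℓp f 2) : Memℓp (fun i => (w i : ℂ) * f i) 2 := by
  obtain ⟨C, hC⟩ := hw
  rw [memℓp_two_iff] at *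
  refine Summable.of_nonneg_of_le (fun _ => sq_nonneg _) (fun i => ?_) (hf.mul_left (C ^ 2))
  rw [norm_mul, mul_pow, Complex.norm_real]
  gcongr
  exact hC i

/-- Multiplication by a bounded real function on the vertices and edges, invariant under
transposition of edges. -/
def mulOp (w : Vertex → ℝ) (k : Edge → ℝ) (hw : ∃ C, ∀ x, ‖w x‖ ≤ C) (hk : ∃ C, ∀ e, ‖k e‖ ≤ C)
    (hrev : ∀ e : Edge, k e.rev = k e) : L2X →L[ℂ] L2X :=
  let T : L2X →ₗ[ℂ] L2X :=
    { toFun := fun f => L2X.mk (fun x => (w x : ℂ) * f.vert x) (fun e => (k e : ℂ) * f.edge e)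
        (memℓp_mul_of_bound hw (lp.memℓp f.vert)) (memℓp_mul_of_bound hk (lp.memℓp f.edge))
        (fun e => by rw [hrev, L2X.edge_rev]; ring)
      map_add' := fun f g => by
        refine L2X.ext' (fun x => ?_) (fun e => ?_) <;> simp <;> ring
      map_smul' := fun c f => by
        refine L2X.ext' (fun x => ?_) (fun e => ?_) <;> simp <;> ring }
  ⟨T, L2X.continuous_of_coord T
    (fun x => by
      have := L2X.continuous_vert x
      simp only [T, LinearMap.coe_mk, AddHom.coe_mk, L2X.mk_vert]
      fun_prop)
    (fun e => by
      have := L2X.continuous_edge e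
      simp only [T, LinearMap.coe_mk, AddHom.coe_mk, L2X.mk_edge]
      fun_prop)⟩

namespace Potential

variable (V : Potential)

/-- The multiplication operator `V` on `l²(X)`. -/
def op : L2X →L[ℂ] L2X :=
  mulOp V.vert V.edge (exists_bound_of_summable V.summable_vert)
    (exists_bound_of_summable V.summable_edge) V.edge_rev

theorem sqrt_bound {ι : Type} {f : ι → ℝ} (hf : Summable f) : ∃ C, ∀ i, ‖√(f i)‖ ≤ C := by
  obtain ⟨C, hC⟩ := exists_bound_of_summable hf
  refine ⟨√C, fun i => ?_⟩
  rw [Real.norm_of_nonneg (Real.sqrt_nonneg _)]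
  exact Real.sqrt_le_sqrt ((le_abs_self _).trans (hC i))

/-- The operator `V^{1/2}` on `l²(X)`: multiplication by the square root of the potential. -/
def sqrtOp : L2X →L[ℂ] L2X :=
  mulOp (fun x => √(V.vert x)) (fun e => √(V.edge e)) (sqrt_bound V.summable_vert)
    (sqrt_bound V.summable_edge) (fun e => by rw [V.edge_rev])

/-- The functions `v₁(μ) = V(μ)`, `v₂(μ) = V(μ e₁)`, `v₃(μ) = V(μ e₂)` on `ℤ²`
(indexed by `0, 1, 2`). -/
def v : Fin 3 → Vertex → ℝ := Fin.cons V.vert fun i μ => V.edge (μ, i, 1)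

theorem v_nonneg (j : Fin 3) (μ : Vertex) : 0 ≤ V.v j μ := by
  refine Fin.cases ?_ (fun i => ?_) j
  · exact V.vert_nonneg μ
  · exact V.edge_nonneg _

theorem v_summable (j : Fin 3) : Summable (V.v j) := by
  refine Fin.cases ?_ (fun i => ?_) j
  · exact V.summable_vert
  · exact V.summable_edge.comp_injective (i := fun μ : Vertex => ((μ, i, 1) : Edge))
      (fun x y h => by simpa using h)

theorem memℓp_sqrt_v (j : Fin 3) : Memℓp (fun μ => (√(V.v j μ) : ℂ)) 2 := by
  rw [memℓp_two_iff]
  refine (V.v_summable j).congr fun μ => ?_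
  rw [Complex.norm_real, Real.norm_of_nonneg (Real.sqrt_nonneg _), Real.sq_sqrt (V.v_nonneg j μ)]

/-- The functions `g_j = v_j^{1/2}`, as elements of `ℓ²(ℤ²)`. -/
def g (j : Fin 3) : Ell2 Vertex := ⟨fun μ => (√(V.v j μ) : ℂ), V.memℓp_sqrt_v j⟩

/-- The decay condition `∑_{⟨μ⟩ > N} |v_j(μ)| = O(N^{-2β})` as `N → ∞`, where
`⟨μ⟩ = (1 + |μ|²)^{1/2}`. -/
def Decay (j : Fin 3) (β : ℝ) : Prop :=
  (fun N : ℝ => ∑' μ : {μ : Vertex // N < √(1 + ((μ 0 : ℝ) ^ 2 + (μ 1 : ℝ) ^ 2))}, |V.v j μ|)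
    =O[atTop] fun N : ℝ => N ^ (-2 * β)

end Potential

/-! ### The torus and the Fourier transform -/

/-- The torus `𝕋² = ℝ² / ℤ²`. -/
abbrev Torus : Type := UnitAddTorus (Fin 2)

/-- The Lebesgue (normalized Haar) measure on the torus. -/
def torusVol : Measure Torus := Measure.pi fun _ => AddCircle.haarAddCircle

/-- The space `L²(𝕋²)`. -/
abbrev L2T : Type := Lp ℂ 2 torusVol

/-- The space `L²(𝕋²; ℂ³)`, as the Hilbert space direct sum of three copies of `L²(𝕋²)`. -/
abbrev L2T3 : Type := PiLp 2 fun _ : Fin 3 => L2T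

instance : torusVol.IsAddHaarMeasure :=
  inferInstanceAs (Measure.pi fun _ : Fin 2 => AddCircle.haarAddCircle (T := 1)).IsAddHaarMeasure

instance : IsProbabilityMeasure torusVol :=
  inferInstanceAs
    (IsProbabilityMeasure (Measure.pi fun _ : Fin 2 => AddCircle.haarAddCircle (T := 1)))

instance : torusVol.IsNegInvariant :=
  Measure.IsAddHaarMeasure.isNegInvariant_of_regular _

/-- The character `ξ ↦ e^{-2πi ξ·μ}` as an element of `L²(𝕋²)`. -/
def character (μ : Vertex) : L2T :=
  ContinuousMap.toLp (E := ℂ) 2 torusVol ℂ (UnitAddTorus.mFourier (-μ))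

theorem orthonormal_character : Orthonormal ℂ character :=
  UnitAddTorus.orthonormal_mFourier.comp (fun μ : Vertex => -μ) neg_injective

theorem span_character : (Submodule.span ℂ (range character)).topologicalClosure = ⊤ := by
  have h : (Submodule.span ℂ (range fun μ : Vertex => character (-μ))).topologicalClosure = ⊤ := by
    have h0 := UnitAddTorus.span_mFourierLp_closure_eq_top (d := Fin 2) (p := 2) (by simp)
    have h1 : (fun μ : Vertex => character (-μ)) =
        fun μ => ContinuousMap.toLp (E := ℂ) 2 torusVol ℂ (UnitAddTorus.mFourier μ) := by
      funext μ; simp [character]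
    rw [h1]
    exact h0
  have h2 : range (fun μ : Vertex => character (-μ)) = range character :=
    (Equiv.neg Vertex).surjective.range_comp character
  rwa [h2] at h

/-- The characters `ξ ↦ e^{-2πi ξ·μ}`, `μ ∈ ℤ²`, form a Hilbert basis of `L²(𝕋²)`. -/
def charBasis : HilbertBasis Vertex ℂ L2T :=
  HilbertBasis.mk orthonormal_character span_character.ge

/-- The Fourier transform `f ↦ f̂`, `f̂(ξ) = ∑_μ e^{-2πi ξ·μ} f(μ)`, from `ℓ²(ℤ²)` onto `L²(𝕋²)`. -/
def fourierT : Ell2 Vertex ≃ₗᵢ[ℂ] L2T := charBasis.repr.symm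

/-- The unitary operator `𝒰 : l²(X) → L²(𝕋²; ℂ³)`,
`(𝒰 f)(ξ) = (∑_μ e^{-2πi ξ·μ} f(μ), ∑_μ e^{-2πi ξ·μ} f(μ e₁), ∑_μ e^{-2πi ξ·μ} f(μ e₂))`. -/
def 𝒰 : L2X ≃ₗᵢ[ℂ] L2T3 :=
  cellEquiv.trans (LinearIsometryEquiv.piLpCongrRight 2 fun _ => fourierT)

/-- The operator `𝒰 S 𝒰*` on `L²(𝕋²; ℂ³)`. -/
def conjU (S : L2X →L[ℂ] L2X) : L2T3 →L[ℂ] L2T3 :=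
  (𝒰 : L2X →L[ℂ] L2T3) ∘L S ∘L (𝒰.symm : L2T3 →L[ℂ] L2X)

/-! ### Band functions and the operators `T_{z,m}(ξ)`

Points of the torus are given by representatives `ξ ∈ ℝ²`. -/

/-- The Euclidean plane. -/
abbrev Plane : Type := EuclideanSpace ℝ (Fin 2)

/-- The point of the torus represented by `ξ`. -/
def toTorus (ξ : Plane) : Torus := fun i => (ξ i : UnitAddCircle)

/-- `a(ξ) = -1 + e^{-2πi ξ₁}`. -/
def a (ξ : Plane) : ℂ := -1 + Complex.exp (-2 * Real.pi * Complex.I * (ξ 0 : ℂ))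

/-- `b(ξ) = -1 + e^{-2πi ξ₂}`. -/
def b (ξ : Plane) : ℂ := -1 + Complex.exp (-2 * Real.pi * Complex.I * (ξ 1 : ℂ))

/-- `r_m(ξ) = m² + |a(ξ)|² + |b(ξ)|²`. -/
def r (m : ℝ) (ξ : Plane) : ℝ := m ^ 2 + ‖a ξ‖ ^ 2 + ‖b ξ‖ ^ 2

/-- The set of thresholds. -/
def thresholds (m : ℝ) : Set ℝ :=
  {m, -m, √(m ^ 2 + 4), -√(m ^ 2 + 4), √(m ^ 2 + 8), -√(m ^ 2 + 8)}

/-- Translation `h ↦ h(· - τ)` on `L²(𝕋²)`. -/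
def translate (τ : Torus) (h : L2T) : L2T :=
  Lp.compMeasurePreserving (fun η => η - τ) (measurePreserving_sub_right torusVol τ) h

/-- Reflection `h ↦ h(τ - ·)` on `L²(𝕋²)`. -/
def reflect (τ : Torus) (h : L2T) : L2T :=
  Lp.compMeasurePreserving (fun η => τ - η) (Measure.measurePreserving_sub_left torusVol τ) h

/-- Convolution at the point `τ`: `f ↦ ∫_{𝕋²} h(τ - η) f(η) dη`. -/
def convAt (h : L2T) (τ : Torus) : L2T →L[ℂ] ℂ := innerSL ℂ (star (reflect τ h))

theorem convAt_apply (h : L2T) (τ : Torus) (f : L2T) :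
    convAt h τ f = ∫ η, h (τ - η) * f η ∂torusVol := by
  rw [convAt, innerSL_apply_apply, L2.inner_def]
  refine integral_congr_ae ?_
  filter_upwards [Lp.coeFn_star (reflect τ h), Lp.coeFn_compMeasurePreserving h
    (Measure.measurePreserving_sub_left torusVol τ)] with η h1 h2
  rw [h1, Pi.star_apply, reflect, h2]
  simp [mul_comm]

/-- The Fourier transform `ĝ_j` of `g_j = v_j^{1/2}`. -/
def Potential.ghat (V : Potential) (j : Fin 3) : L2T := fourierT (V.g j)

/-- The coefficients `m + z`, `a(ξ)`, `b(ξ)`. -/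
def coef (m : ℝ) (z : ℂ) (ξ : Plane) : Fin 3 → ℂ := ![m + z, a ξ, b ξ]

/-- The coefficients `m + z`, `\overline{a(ξ)}`, `\overline{b(ξ)}`. -/
def coefDag (m : ℝ) (z : ℂ) (ξ : Plane) : Fin 3 → ℂ := ![m + z, conj (a ξ), conj (b ξ)]

/-- The operator `t_{z,m}(ξ) : L²(𝕋²; ℂ³) → ℂ³`,
`f ↦ ((m+z) ∫ ĝ₁(ξ-η) f₁(η) dη, a(ξ) ∫ ĝ₂(ξ-η) f₂(η) dη, b(ξ) ∫ ĝ₃(ξ-η) f₃(η) dη)`. -/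
def t (V : Potential) (m : ℝ) (z : ℂ) (ξ : Plane) : L2T3 →L[ℂ] EuclideanSpace ℂ (Fin 3) :=
  (PiLp.continuousLinearEquiv 2 ℂ fun _ : Fin 3 => ℂ).symm.toContinuousLinearMap ∘L
    ContinuousLinearMap.pi fun j =>
      coef m z ξ j • (convAt (V.ghat j) (toTorus ξ) ∘L PiLp.proj 2 (fun _ : Fin 3 => L2T) j)

theorem t_apply (V : Potential) (m : ℝ) (z : ℂ) (ξ : Plane) (f : L2T3) (j : Fin 3) :
    t V m z ξ f j =
      coef m z ξ j * ∫ η, V.ghat j (toTorus ξ - η) * f j η ∂torusVol := by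
  rw [← convAt_apply]; rfl

/-- The operator `t†_{z,m}(ξ) : ℂ³ → L²(𝕋²; ℂ³)`,
`ω ↦ (ω₁ (m+z) ĝ₁(· - ξ), ω₂ \overline{a(ξ)} ĝ₂(· - ξ), ω₃ \overline{b(ξ)} ĝ₃(· - ξ))`. -/
def tDag (V : Potential) (m : ℝ) (z : ℂ) (ξ : Plane) : EuclideanSpace ℂ (Fin 3) →L[ℂ] L2T3 :=
  (PiLp.continuousLinearEquiv 2 ℂ fun _ : Fin 3 => L2T).symm.toContinuousLinearMap ∘L
    ContinuousLinearMap.pi fun j =>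
      (PiLp.proj 2 (fun _ : Fin 3 => ℂ) j : EuclideanSpace ℂ (Fin 3) →L[ℂ] ℂ).smulRight
        (coefDag m z ξ j • translate (toTorus ξ) (V.ghat j))

theorem tDag_apply (V : Potential) (m : ℝ) (z : ℂ) (ξ : Plane) (ω : EuclideanSpace ℂ (Fin 3))
    (j : Fin 3) :
    tDag V m z ξ ω j = ω j • coefDag m z ξ j • translate (toTorus ξ) (V.ghat j) := rfl

/-- The operator `T_{z,m}(ξ) = t†_{z,m}(ξ) A t_{z,m}(ξ)`, where all entries of the `3 × 3` matrix
`A` are equal to `1`. -/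
def T (V : Potential) (m : ℝ) (z : ℂ) (ξ : Plane) : L2T3 →L[ℂ] L2T3 :=
  tDag V m z ξ ∘L
    Matrix.toEuclideanCLM (𝕜 := ℂ) (n := Fin 3) (Matrix.of fun _ _ => 1) ∘L t V m z ξ

/-! ### Trace norm, level-curve integrals, principal value -/

/-- The trace norm of a bounded operator on a Hilbert space, with value `∞` when the operator is not
of trace class: the supremum of `∑ᵢ |⟨fᵢ, S eᵢ⟩|` over all finite orthonormal systems
`(eᵢ)`, `(fᵢ)`. -/
def traceNorm {E : Type*} [NormedAddCommGroup E] [InnerProductSpace ℂ E] (S : E →L[ℂ] E) : ℝ≥0∞ :=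
  ⨆ (n : ℕ) (e : Fin n → E) (f : Fin n → E) (_ : Orthonormal ℂ e) (_ : Orthonormal ℂ f),
    ∑ i, ‖⟪f i, S (e i)⟫_ℂ‖ₑ

/-- The trace class. -/
def IsTraceClass {E : Type*} [NormedAddCommGroup E] [InnerProductSpace ℂ E] (S : E →L[ℂ] E) :
    Prop := traceNorm S < ⊤

/-- Absolute integrability, in the trace norm, of an operator-valued function. -/
def TraceIntegrable {α : Type*} [MeasurableSpace α] (F : α → L2T3 →L[ℂ] L2T3) (ν : Measure α) :
    Prop := Integrable F ν ∧ ∫⁻ x, traceNorm (F x) ∂ν < ⊤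

/-- The one-dimensional Hausdorff measure `dγ` on the level curve `r_m⁻¹(ρ)` of the torus, carried by
the representatives in the fundamental square `[0,1)²`. -/
def curveMeasure (m ρ : ℝ) : Measure Plane :=
  (Measure.hausdorffMeasure 1).restrict {ξ : Plane | (∀ i, ξ i ∈ Ico (0 : ℝ) 1) ∧ r m ξ = ρ}

/-- The function `T_{z,m} / |∇ r_m|`. -/
def curveIntegrand (V : Potential) (m : ℝ) (z : ℂ) (ξ : Plane) : L2T3 →L[ℂ] L2T3 :=
  ((‖gradient (r m) ξ‖⁻¹ : ℝ) : ℂ) • T V m z ξ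

/-- The level-curve integral `∫_{r_m⁻¹(ρ)} T_{z,m}(ξ) / |∇ r_m(ξ)| dγ`. -/
def levelIntegral (V : Potential) (m : ℝ) (z : ℂ) (ρ : ℝ) : L2T3 →L[ℂ] L2T3 :=
  ∫ ξ, curveIntegrand V m z ξ ∂curveMeasure m ρ

/-- The integrand `(ρ - z²)⁻¹ ∫_{r_m⁻¹(ρ)} T_{z,m} / |∇ r_m| dγ`. -/
def resolventIntegrand (V : Potential) (m : ℝ) (z : ℂ) (ρ : ℝ) : L2T3 →L[ℂ] L2T3 :=
  ((ρ : ℂ) - z ^ 2)⁻¹ • levelIntegral V m z ρ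

/-- The integral
`∫_{m²}^{M_m²} dρ / (ρ - z²) ∫_{r_m⁻¹(ρ)} T_{z,m} / |∇ r_m| dγ`, with `M_m² = m² + 8`. -/
def resolventIntegral (V : Potential) (m : ℝ) (z : ℂ) : L2T3 →L[ℂ] L2T3 :=
  ∫ ρ in Ioc (m ^ 2) (m ^ 2 + 8), resolventIntegrand V m z ρ

/-- The integrand `2u / (u² - lam²) ∫_{r_m⁻¹(u²)} T_{lam,m} / |∇ r_m| dγ`. -/
def pvIntegrand (V : Potential) (m lam u : ℝ) : L2T3 →L[ℂ] L2T3 :=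
  ((2 * u / (u ^ 2 - lam ^ 2) : ℝ) : ℂ) • levelIntegral V m lam (u ^ 2)

/-- The interval `[m, M_m]` with the `ε`-neighbourhood of the singular point `|lam|` removed. -/
def pvDomain (m lam ε : ℝ) : Set ℝ := 
  {u : ℝ | u ∈ Icc m (√(m ^ 2 + 8)) ∧ ε < abs (u - abs lam)}

/-- `P` is the principal value, in the trace norm,
`p.v. ∫_m^{M_m} 2u / (u² - lam²) ∫_{r_m⁻¹(u²)} T_{lam,m} / |∇ r_m| dγ du`. -/
def IsPrincipalValue (V : Potential) (m lam : ℝ) (P : L2T3 →L[ℂ] L2T3) : Prop :=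
  (∀ ε > 0, TraceIntegrable (pvIntegrand V m lam) (volume.restrict (pvDomain m lam ε))) ∧
  Tendsto (fun ε : ℝ => traceNorm ((∫ u in pvDomain m lam ε, pvIntegrand V m lam u) - P))
    (𝓝[>] 0) (𝓝 0)

/-! ### The sandwiched resolvent -/

/-- `K(z) = V^{1/2} (H₀ - z)⁻¹ V^{1/2}` on `l²(X)`. -/
def K (V : Potential) (m : ℝ) (z : ℂ) : L2X →L[ℂ] L2X :=
  V.sqrtOp ∘L Ring.inverse (H₀ m - z • ContinuousLinearMap.id ℂ L2X) ∘L V.sqrtOp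

/-- The constant matrix `diag(0, -1, -1)` acting on `L²(𝕋²; ℂ³)`. -/
def negEdgeProj : L2T3 →L[ℂ] L2T3 :=
  (PiLp.continuousLinearEquiv 2 ℂ fun _ : Fin 3 => L2T).symm.toContinuousLinearMap ∘L
    ContinuousLinearMap.pi fun j =>
      (![0, -1, -1] : Fin 3 → ℂ) j • PiLp.proj 2 (fun _ : Fin 3 => L2T) j

end DiracZ2

end

/-! The Fourier transform turns `H₀ - z` into a `3 × 3` matrix at each `ξ`. Eliminating the two edge
components leaves the scalar `r_m(ξ) - z²`, and `m + z` times the inverse matrix is `diag(0, -1,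
-1)` plus `(r_m(ξ) - z²)⁻¹` times a matrix of rank one. Sandwiched between the factors `V^{1/2}`,
the rank one part becomes `T_{z,m}(ξ)`, so `(m + z) 𝒰 K(z) 𝒰*` is `𝒰 V 𝒰* diag(0, -1, -1)` plus the
integral over the torus of `(r_m - z²)⁻¹ T_{z,m}` (`conjU_K`).

The coarea formula writes that integral as a Cauchy integral over levels `ρ` of the density `J_z(ρ)`
(`coarea`). It is proved by explicit coordinates. In terms of `x = sin²(πξ₁)` and `y = sin²(πξ₂)`
one has `r_m = m² + 4(x + y)`, so each level curve consists, up to finitely many points, of four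
arcs parametrized by `t = x / (x + y)`. Levels above the saddle value `m² + 4` are brought to the
same form by replacing `sin²` with `cos²`. Both the level integrals (`levelInt_levelValue`) and the
area integral then involve the same Jacobian `kern`.

The boundary value exists because the density is Hölder continuous in trace norm away from the
critical values. The decay of `V` gives moments `∑ v_j(μ)⟨μ⟩^{2α} < ∞` for `α < β_j`
(`summable_moment`). Hence `ξ ↦ ĝ_j(· - ξ)` is `α`-Hölder in `L²` (`bddHolder_shifted`), the rank
one operators are `α`-Hölder in trace norm, and their level integrals are `α/2`-Hölder at regular
levels (`levelInt_holder`). The thresholds are the `λ` for which `λ²` is critical. After the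
substitution `ρ = u²` the Plemelj formula (`plemelj_zero`, `plemelj_sq`) gives the principal value
and the point term, whose sign is that of the imaginary part of `z² = (λ + iδ)²`. Since `T_{z,m}` is
a polynomial in `m + z` with coefficients independent of `z`, the formula is applied to fixed
functions (`traceT_eq_sum`).

For real `λ` the operators `T_{λ,m}(ξ)` are self-adjoint, hence so are `P_λ` and `J_λ(λ²)`; the
limit of `K` is therefore already split into its real and imaginary parts. All limits are taken in
the Banach space `TraceClass` of trace class operators, whose norm dominates the operator norm. -/

noncomputable section

namespace DiracZ2

/-! ### The Banach space of trace class operators -/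

section TraceNorm

variable {H : Type*} [NormedAddCommGroup H] [InnerProductSpace ℂ H]

theorem sum_enorm_le_traceNorm (S : H →L[ℂ] H) {n : ℕ} {e f : Fin n → H}
    (he : Orthonormal ℂ e) (hf : Orthonormal ℂ f) :
    ∑ i, ‖⟪f i, S (e i)⟫_ℂ‖ₑ ≤ traceNorm S := by
  unfold traceNorm
  exact le_iSup_of_le n (le_iSup_of_le e (le_iSup_of_le f (le_iSup_of_le he
    (le_iSup_of_le hf le_rfl))))

theorem traceNorm_le {S : H →L[ℂ] H} {C : ℝ≥0∞}
    (h : ∀ (n : ℕ) (e f : Fin n → H), Orthonormal ℂ e → Orthonormal ℂ f →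
      ∑ i, ‖⟪f i, S (e i)⟫_ℂ‖ₑ ≤ C) : traceNorm S ≤ C := by
  unfold traceNorm
  exact iSup_le fun n => iSup_le fun e => iSup_le fun f => iSup_le fun he => iSup_le fun hf =>
    h n e f he hf

@[simp] theorem traceNorm_zero : traceNorm (0 : H →L[ℂ] H) = 0 :=
  le_antisymm (traceNorm_le fun n e f _ _ => by simp) bot_le

theorem traceNorm_add_le (S R : H →L[ℂ] H) : traceNorm (S + R) ≤ traceNorm S + traceNorm R := by
  refine traceNorm_le fun n e f he hf => ?_
  refine le_trans ?_ (add_le_add (sum_enorm_le_traceNorm S he hf) (sum_enorm_le_traceNorm R he hf))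
  rw [← Finset.sum_add_distrib]
  refine Finset.sum_le_sum fun i _ => ?_
  rw [add_apply, inner_add_right]
  exact enorm_add_le _ _

theorem traceNorm_smul_le (c : ℂ) (S : H →L[ℂ] H) : traceNorm (c • S) ≤ ‖c‖ₑ * traceNorm S := by
  refine traceNorm_le fun n e f he hf => ?_
  refine le_trans (le_of_eq ?_) (mul_le_mul_right (sum_enorm_le_traceNorm S he hf) _)
  rw [Finset.mul_sum]
  refine Finset.sum_congr rfl fun i _ => ?_
  rw [smul_apply, inner_smul_right, enorm_mul]

theorem traceNorm_neg (S : H →L[ℂ] H) : traceNorm (-S) = traceNorm S := by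
  simp [traceNorm]

theorem enorm_inner_le_traceNorm (S : H →L[ℂ] H) {e f : H} (he : ‖e‖ = 1) (hf : ‖f‖ = 1) :
    ‖⟪f, S e⟫_ℂ‖ₑ ≤ traceNorm S := by
  have h : ∀ {v : H}, ‖v‖ = 1 → Orthonormal ℂ (fun _ : Fin 1 => v) := fun hv =>
    ⟨fun _ => hv, fun i j hij => absurd (Subsingleton.elim i j) hij⟩
  simpa using sum_enorm_le_traceNorm S (h he) (h hf)

/-- Testing the supremum on the single pair `e`, `S e / ‖S e‖` already yields `‖S e‖`. This makes
the trace norm definite and the inclusion into the bounded operators continuous. -/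
theorem norm_le_traceNorm_toReal {S : H →L[ℂ] H} (hS : traceNorm S ≠ ⊤) :
    ‖S‖ ≤ (traceNorm S).toReal := by
  refine S.opNorm_le_of_unit_norm ENNReal.toReal_nonneg fun e he => ?_
  by_cases h0 : S e = 0
  · simp [h0]
  have hne : (‖S e‖ : ℝ) ≠ 0 := norm_ne_zero_iff.2 h0
  have h1 := enorm_inner_le_traceNorm S (f := ((‖S e‖⁻¹ : ℝ) : ℂ) • S e) he (by
    rw [norm_smul, Complex.norm_real, Real.norm_of_nonneg (by positivity)]
    exact inv_mul_cancel₀ hne)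
  have h2 := ENNReal.toReal_mono hS h1
  rw [inner_smul_left, inner_self_eq_norm_sq_to_K] at h2
  simp only [toReal_enorm, norm_mul, Complex.conj_ofReal, Complex.norm_real, norm_pow] at h2
  have h3 : ‖(‖S e‖⁻¹ : ℝ)‖ * ‖((‖S e‖ : ℝ) : ℂ)‖ ^ 2 = ‖S e‖ := by
    rw [Complex.norm_real, norm_inv, norm_norm]; field_simp
  exact h3.symm.le.trans h2

/-- The trace class operators, as a subspace of the bounded operators. -/
def traceClassSubmodule (H : Type*) [NormedAddCommGroup H] [InnerProductSpace ℂ H] :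
    Submodule ℂ (H →L[ℂ] H) where
  carrier := {S | traceNorm S ≠ ⊤}
  add_mem' {S R} hS hR := ne_top_of_le_ne_top (ENNReal.add_ne_top.2 ⟨hS, hR⟩) (traceNorm_add_le S R)
  zero_mem' := by simp
  smul_mem' c S hS :=
    ne_top_of_le_ne_top (ENNReal.mul_ne_top enorm_ne_top hS) (traceNorm_smul_le c S)

/-- The trace class operators, with the trace norm. -/
def TraceClass (H : Type*) [NormedAddCommGroup H] [InnerProductSpace ℂ H] : Type _ :=
  traceClassSubmodule H

namespace TraceClass

instance : AddCommGroup (TraceClass H) := inferInstanceAs (AddCommGroup (traceClassSubmodule H))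
instance : Module ℂ (TraceClass H) := inferInstanceAs (Module ℂ (traceClassSubmodule H))

/-- The bounded operator underlying a trace class operator. -/
def toOp : TraceClass H →ₗ[ℂ] H →L[ℂ] H := (traceClassSubmodule H).subtype

theorem toOp_injective : Function.Injective (toOp (H := H)) := Subtype.coe_injective

theorem traceNorm_ne_top (S : TraceClass H) : traceNorm (toOp S) ≠ ⊤ := S.2

instance : NormedAddCommGroup (TraceClass H) :=
  AddGroupNorm.toNormedAddCommGroup
    { toFun := fun S => (traceNorm (toOp S)).toReal
      map_zero' := by simp
      add_le' := fun S R => by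
        rw [map_add, ← ENNReal.toReal_add S.traceNorm_ne_top R.traceNorm_ne_top]
        exact ENNReal.toReal_mono (ENNReal.add_ne_top.2 ⟨S.traceNorm_ne_top, R.traceNorm_ne_top⟩)
          (traceNorm_add_le _ _)
      neg' := fun S => by rw [map_neg, traceNorm_neg]
      eq_zero_of_map_eq_zero' := fun S h => by
        apply toOp_injective
        rw [map_zero, ← norm_le_zero_iff]
        exact (norm_le_traceNorm_toReal S.traceNorm_ne_top).trans h.le }

theorem norm_def (S : TraceClass H) : ‖S‖ = (traceNorm (toOp S)).toReal := rfl

theorem enorm_eq (S : TraceClass H) : ‖S‖ₑ = traceNorm (toOp S) := by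
  rw [← ofReal_norm, norm_def, ENNReal.ofReal_toReal S.traceNorm_ne_top]

instance : NormedSpace ℂ (TraceClass H) where
  norm_smul_le c S := by
    have h := ENNReal.toReal_mono
      (ENNReal.mul_ne_top enorm_ne_top S.traceNorm_ne_top) (traceNorm_smul_le c (toOp S))
    rw [ENNReal.toReal_mul, toReal_enorm] at h
    rw [norm_def, map_smul]
    exact h

/-- The inclusion of the trace class operators into the bounded operators. -/
def incl : TraceClass H →L[ℂ] H →L[ℂ] H :=
  toOp.mkContinuous 1 fun S => by
    rw [one_mul]; exact norm_le_traceNorm_toReal S.traceNorm_ne_top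

theorem incl_injective : Function.Injective (incl (H := H)) := toOp_injective

theorem traceNorm_incl (S : TraceClass H) : traceNorm (incl S) = ‖S‖ₑ := S.enorm_eq.symm

/-- Lower semicontinuity of the trace norm. -/
theorem _root_.DiracZ2.traceNorm_le_of_tendsto {u : ℕ → H →L[ℂ] H} {S : H →L[ℂ] H} {C : ℝ≥0∞}
    (h : Tendsto u atTop (𝓝 S)) (hC : ∀ᶠ n in atTop, traceNorm (u n) ≤ C) : traceNorm S ≤ C := by
  refine traceNorm_le fun n e f he hf => ?_
  have h1 : Tendsto (fun k => ∑ i, ‖⟪f i, u k (e i)⟫_ℂ‖ₑ) atTop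
      (𝓝 (∑ i, ‖⟪f i, S (e i)⟫_ℂ‖ₑ)) := by
    refine tendsto_finsetSum _ fun i _ => ?_
    have h2 : Tendsto (fun k => u k (e i)) atTop (𝓝 (S (e i))) :=
      ((ContinuousLinearMap.apply ℂ H (e i)).continuous.tendsto S).comp h
    exact (continuous_enorm.tendsto _).comp (tendsto_const_nhds.inner h2)
  exact le_of_tendsto h1 (hC.mono fun k hk => (sum_enorm_le_traceNorm _ he hf).trans hk)

/-- A Cauchy sequence in trace norm converges in operator norm, and lower semicontinuity passes the
Cauchy estimates to that limit. Completeness is what allows Bochner integrals to be taken in trace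
norm. -/
instance [CompleteSpace H] : CompleteSpace (TraceClass H) := by
  refine Metric.complete_of_cauchySeq_tendsto fun u hu => ?_
  obtain ⟨S, hS⟩ := cauchySeq_tendsto_of_complete
    ((incl (H := H)).uniformContinuous.comp_cauchySeq hu)
  have key : ∀ ε > 0, ∃ N, ∀ n ≥ N, traceNorm (toOp (u n) - S) ≤ ENNReal.ofReal ε := by
    intro ε hε
    obtain ⟨N, hN⟩ := Metric.cauchySeq_iff.1 hu ε hε
    refine ⟨N, fun n hn => ?_⟩
    refine traceNorm_le_of_tendsto (u := fun k => toOp (u n) - toOp (u k))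
      (tendsto_const_nhds.sub hS) ?_
    filter_upwards [eventually_ge_atTop N] with k hk
    rw [← map_sub, ← enorm_eq, ← ofReal_norm, ← dist_eq_norm]
    exact ENNReal.ofReal_le_ofReal (hN n hn k hk).le
  have hmem : traceNorm S ≠ ⊤ := by
    obtain ⟨N, hN⟩ := key 1 one_pos
    have h1 := traceNorm_add_le (-(toOp (u N) - S)) (toOp (u N))
    rw [traceNorm_neg, neg_sub, sub_add_cancel] at h1
    exact ne_top_of_le_ne_top (ENNReal.add_ne_top.2
      ⟨ne_top_of_le_ne_top ENNReal.ofReal_ne_top (hN N le_rfl), (u N).traceNorm_ne_top⟩) h1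
  obtain ⟨S', rfl⟩ : ∃ S' : TraceClass H, toOp S' = S := ⟨⟨S, hmem⟩, rfl⟩
  refine ⟨S', Metric.tendsto_atTop.2 fun ε hε => ?_⟩
  obtain ⟨N, hN⟩ := key (ε / 2) (half_pos hε)
  refine ⟨N, fun n hn => ?_⟩
  rw [dist_eq_norm, norm_def, map_sub]
  refine lt_of_le_of_lt (ENNReal.toReal_le_of_le_ofReal (half_pos hε).le (hN n hn))
    (half_lt_self hε)

/-- Cauchy–Schwarz separates the two systems, and Bessel's inequality bounds each factor. -/
theorem _root_.DiracZ2.traceNorm_smulRight_le (y x : H) :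
    traceNorm ((innerSL ℂ x).smulRight y) ≤ ENNReal.ofReal (‖y‖ * ‖x‖) := by
  refine traceNorm_le fun n e f he hf => ?_
  simp only [← ofReal_norm]
  rw [← ENNReal.ofReal_sum_of_nonneg fun _ _ => norm_nonneg _]
  refine ENNReal.ofReal_le_ofReal ?_
  have h1 : ∀ i, ‖⟪f i, (innerSL ℂ x).smulRight y (e i)⟫_ℂ‖ = ‖⟪f i, y⟫_ℂ‖ * ‖⟪e i, x⟫_ℂ‖ := by
    intro i
    rw [ContinuousLinearMap.smulRight_apply, inner_smul_right, norm_mul, mul_comm,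
      innerSL_apply_apply, norm_inner_symm x]
  simp only [h1]
  refine (Real.sum_mul_le_sqrt_mul_sqrt _ _ _).trans ?_
  have h2 := hf.sum_inner_products_le (s := Finset.univ) y
  have h3 := he.sum_inner_products_le (s := Finset.univ) x
  exact mul_le_mul (Real.sqrt_le_iff.2 ⟨norm_nonneg _, h2⟩)
    (Real.sqrt_le_iff.2 ⟨norm_nonneg _, h3⟩) (Real.sqrt_nonneg _) (norm_nonneg _)

/-- The operator `v ↦ ⟪x, v⟫ y`, as a trace class operator. -/
def rankOne (y x : H) : TraceClass H :=
  ⟨(innerSL ℂ x).smulRight y,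
    ne_top_of_le_ne_top ENNReal.ofReal_ne_top (traceNorm_smulRight_le y x)⟩

theorem incl_rankOne_apply (y x v : H) : incl (rankOne y x) v = ⟪x, v⟫_ℂ • y := rfl

theorem norm_rankOne_le (y x : H) : ‖rankOne y x‖ ≤ ‖y‖ * ‖x‖ :=
  ENNReal.toReal_le_of_le_ofReal (by positivity) (traceNorm_smulRight_le y x)

theorem ext_apply {S R : TraceClass H} (h : ∀ v, incl S v = incl R v) : S = R :=
  incl_injective (ContinuousLinearMap.ext h)

theorem rankOne_sub_rankOne (y x y' x' : H) :
    rankOne y x - rankOne y' x' = rankOne (y - y') x + rankOne y' (x - x') := by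
  refine ext_apply fun v => ?_
  simp only [map_add, map_sub, add_apply, sub_apply,
    incl_rankOne_apply, inner_sub_left, smul_sub, sub_smul]
  abel

/-- A Bochner integral in trace norm has the same value as in operator norm. Every integral below is
therefore computed in `TraceClass` and transferred at the end. -/
theorem integral_incl [CompleteSpace H] {α : Type*} [MeasurableSpace α] {ν : Measure α}
    {F : α → TraceClass H} (hF : Integrable F ν) :
    ∫ x, incl (F x) ∂ν = incl (∫ x, F x ∂ν) :=
  (incl (H := H)).integral_comp_comm hF

theorem tendsto_traceNorm_sub {ι : Type*} {l : Filter ι} {u : ι → TraceClass H}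
    {S : TraceClass H} (h : Tendsto u l (𝓝 S)) :
    Tendsto (fun i => traceNorm (incl (u i) - incl S)) l (𝓝 0) := by
  simp only [← map_sub, traceNorm_incl]
  have h1 : Tendsto (fun i => u i - S) l (𝓝 0) := by simpa using h.sub_const S
  rw [← enorm_zero (E := TraceClass H)]
  exact (continuous_enorm.tendsto (0 : TraceClass H)).comp h1

theorem isTraceClass_incl (S : TraceClass H) : IsTraceClass (incl S) :=
  lt_top_iff_ne_top.2 S.traceNorm_ne_top

end TraceClass

end TraceNorm

/-- Trace class operators on `L²(𝕋²; ℂ³)`. -/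
abbrev TC : Type := TraceClass L2T3

theorem traceIntegrable_incl {α : Type*} [MeasurableSpace α] {ν : Measure α} {F : α → TC}
    (hF : Integrable F ν) : TraceIntegrable (fun x => TraceClass.incl (F x)) ν := by
  refine ⟨(TraceClass.incl (H := L2T3)).integrable_comp hF, ?_⟩
  simp only [TraceClass.traceNorm_incl]
  exact hF.2

/-! ### Principal values and the Plemelj formula -/

section Plemelj

theorem integral_eq_zero_of_odd {E : Type*} [NormedAddCommGroup E] [NormedSpace ℝ E] {f : ℝ → E}
    (hf : ∀ x, f (-x) = - f x) : ∫ x, f x = 0 := by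
  have h : ∫ x, f x = - ∫ x, f x := by
    conv_lhs => rw [← integral_neg_eq_self]
    simp only [hf, integral_neg]
  have h2 : (2 : ℝ) • ∫ x, f x = 0 := by rw [two_smul]; nth_rewrite 1 [h]; exact neg_add_cancel _
  exact (smul_eq_zero.1 h2).resolve_left two_ne_zero

theorem integrableOn_abs_rpow {s : ℝ} (hs : -1 < s) (η : ℝ) :
    IntegrableOn (fun x : ℝ => |x| ^ s) (Ioo (-η) η) := by
  rcases le_or_gt η 0 with h | h
  · rw [Ioo_eq_empty (by linarith)]; exact integrableOn_empty
  have h1 : IntervalIntegrable (fun x : ℝ => |x| ^ s) volume 0 η := by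
    refine (intervalIntegral.intervalIntegrable_rpow' hs).congr fun x hx => ?_
    rw [uIoc_of_le h.le] at hx
    simp only [abs_of_pos hx.1]
  have h2 : IntervalIntegrable (fun x : ℝ => |x| ^ s) volume (-η) 0 := by
    have := h1.comp_mul_left (c := -1)
    simp only [neg_mul, one_mul, abs_neg] at this
    simpa [div_neg] using this.symm
  have h3 := h2.trans h1
  rw [intervalIntegrable_iff_integrableOn_Ioo_of_le (by linarith)] at h3
  exact h3

theorem norm_sub_I_mul_ge (x δ s : ℝ) : |x| ≤ ‖(x : ℂ) - Complex.I * s * δ‖ := by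
  have h := Complex.abs_re_le_norm ((x : ℂ) - Complex.I * s * δ)
  simpa using h

/-- At `x = 0` the bound `|x|⁻¹` takes the value `0`, so that point, a null set, has to be excepted.
-/
theorem norm_inv_sub_I_mul_le (x δ s : ℝ) : ‖((x : ℂ) - Complex.I * s * δ)⁻¹‖ ≤ |x|⁻¹ ∨ x = 0 := by
  by_cases hx : x = 0
  · exact Or.inr hx
  · left
    rw [norm_inv]
    exact inv_anti₀ (abs_pos.2 hx) (norm_sub_I_mul_ge x δ s)

/-- The first term is odd in `x` and the second is a multiple of the Poisson kernel. Over a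
symmetric interval only the second survives, and it produces the arctangent whose limit is the point
term. -/
theorem inv_sub_I_mul {x δ s : ℝ} (hs : s ^ 2 = 1) (hδ : 0 < δ) :
    ((x : ℂ) - Complex.I * s * δ)⁻¹ =
      ((x / (δ ^ 2 + x ^ 2) : ℝ) : ℂ) + Complex.I * s * ((δ / (δ ^ 2 + x ^ 2) : ℝ) : ℂ) := by
  have h1 : ((δ : ℂ) ^ 2 + (x : ℂ) ^ 2) ≠ 0 := by
    have : δ ^ 2 + x ^ 2 ≠ 0 := by positivity
    exact_mod_cast this
  have hs' : (s : ℂ) ^ 2 = 1 := by exact_mod_cast hs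
  have hI : Complex.I ^ 2 = -1 := Complex.I_sq
  refine inv_eq_of_mul_eq_one_right ?_
  push_cast
  field_simp
  linear_combination (-(δ : ℂ) ^ 2 * s ^ 2) * hI + (δ : ℂ) ^ 2 * hs'

theorem integral_inv_sub_I_mul {s δ η : ℝ} (hs : s ^ 2 = 1) (hδ : 0 < δ) (hη : 0 < η) :
    ∫ x in Ioo (-η) η, ((x : ℂ) - Complex.I * s * δ)⁻¹ =
      Complex.I * s * ((2 * Real.arctan (η / δ) : ℝ) : ℂ) := by
  have hpos : ∀ x : ℝ, δ ^ 2 + x ^ 2 ≠ 0 := fun x => by positivity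
  have c1 : Continuous fun x : ℝ => x / (δ ^ 2 + x ^ 2) :=
    continuous_id.div (by fun_prop) hpos
  have c2 : Continuous fun x : ℝ => δ / (δ ^ 2 + x ^ 2) :=
    continuous_const.div (by fun_prop) hpos
  have i1 : IntegrableOn (fun x : ℝ => x / (δ ^ 2 + x ^ 2)) (Ioo (-η) η) :=
    (c1.integrableOn_Icc).mono_set Ioo_subset_Icc_self
  have i2 : IntegrableOn (fun x : ℝ => δ / (δ ^ 2 + x ^ 2)) (Ioo (-η) η) :=
    (c2.integrableOn_Icc).mono_set Ioo_subset_Icc_self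
  have e1 : ∫ x in Ioo (-η) η, x / (δ ^ 2 + x ^ 2) = 0 := by
    rw [← integral_indicator measurableSet_Ioo]
    refine integral_eq_zero_of_odd fun x => ?_
    have : -x ∈ Ioo (-η) η ↔ x ∈ Ioo (-η) η := by
      simp only [mem_Ioo, neg_lt_neg_iff, neg_lt (a := x)]; tauto
    by_cases hx : x ∈ Ioo (-η) η
    · rw [indicator_of_mem hx, indicator_of_mem (this.2 hx), neg_sq, neg_div]
    · rw [indicator_of_notMem hx, indicator_of_notMem (this.not.2 hx), neg_zero]
  have e2 : ∫ x in Ioo (-η) η, δ / (δ ^ 2 + x ^ 2) = 2 * Real.arctan (η / δ) := by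
    rw [← integral_Ioc_eq_integral_Ioo, ← intervalIntegral.integral_of_le (by linarith),
      integral_div_sq_add_sq, neg_div, Real.arctan_neg]
    ring
  simp only [inv_sub_I_mul hs hδ]
  rw [integral_add i1.ofReal (i2.ofReal.const_mul _), integral_const_mul, integral_complex_ofReal,
    integral_complex_ofReal, e1, e2]
  simp

variable {E : Type*} [NormedAddCommGroup E] [NormedSpace ℂ E]

/-- The Plemelj formula at the origin. -/
theorem plemelj_zero [CompleteSpace E] {f : ℝ → E} (hf : Integrable f) {α C η : ℝ} (hα : 0 < α)
    (hη : 0 < η) (hH : ∀ x, |x| < η → ‖f x - f 0‖ ≤ C * |x| ^ α) :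
    ∃ P : E,
      (∀ ε > 0, IntegrableOn (fun x : ℝ => ((x : ℂ))⁻¹ • f x) {x | ε < |x|}) ∧
      Tendsto (fun ε : ℝ => ∫ x in {x | ε < |x|}, ((x : ℂ))⁻¹ • f x) (𝓝[>] 0) (𝓝 P) ∧
      ∀ s : ℝ, s ^ 2 = 1 →
        Tendsto (fun δ : ℝ => ∫ x : ℝ, ((x : ℂ) - Complex.I * s * δ)⁻¹ • f x) (𝓝[>] 0)
          (𝓝 (P + (Complex.I * Real.pi * s) • f 0)) := by
  -- Split `f = h + χ`, where `χ` is the constant `f 0` on the window. The Hölder bound makes `h x /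
  -- x` integrable, because `α - 1 > -1`; `χ` drops out of the truncated integrals by oddness and
  -- contributes an explicit arctangent to the regularized ones.
  set χ : ℝ → E := indicator (Ioo (-η) η) (fun _ => f 0) with hχ
  set h : ℝ → E := fun x => f x - χ x with hh
  have mI : MeasurableSet (Ioo (-η) η) := measurableSet_Ioo
  have iχ : Integrable χ := by
    rw [hχ, integrable_indicator_iff mI]
    exact integrableOn_const (by simp)
  have ih : Integrable h := hf.sub iχ
  have mem_iff : ∀ x, x ∈ Ioo (-η) η ↔ |x| < η := fun x => by rw [mem_Ioo, abs_lt]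
  have mε : ∀ ε : ℝ, MeasurableSet {x : ℝ | ε < |x|} := fun ε =>
    measurableSet_lt measurable_const measurable_id.abs
  have ne0 : ∀ᵐ x : ℝ, x ≠ 0 := by simp [ae_iff]
  -- domination
  have hbd : ∀ x : ℝ, |x|⁻¹ * ‖h x‖ ≤
      (Ioo (-η) η).indicator (fun x => C * |x| ^ (α - 1)) x + η⁻¹ * ‖f x‖ ∨ x = 0 := by
    intro x
    by_cases hx0 : x = 0
    · exact Or.inr hx0
    left
    have hxpos : 0 < |x| := abs_pos.2 hx0
    by_cases hx : x ∈ Ioo (-η) η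
    · have hx' := (mem_iff x).1 hx
      rw [hh, hχ]
      simp only [indicator_of_mem hx]
      have h1 := hH x hx'
      have h2 : |x|⁻¹ * ‖f x - f 0‖ ≤ C * |x| ^ (α - 1) := by
        rw [Real.rpow_sub_one hxpos.ne', inv_mul_eq_div, mul_div_assoc']
        gcongr
      have h3 : 0 ≤ η⁻¹ * ‖f x‖ := by positivity
      linarith
    · have hx' : η ≤ |x| := not_lt.1 ((mem_iff x).not.1 hx)
      rw [hh, hχ]
      simp only [indicator_of_notMem hx, sub_zero, zero_add]
      gcongr
  have ibd : Integrable fun x =>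
      (Ioo (-η) η).indicator (fun x => C * |x| ^ (α - 1)) x + η⁻¹ * ‖f x‖ := by
    refine Integrable.add ?_ (hf.norm.const_mul _)
    rw [integrable_indicator_iff mI]
    exact (integrableOn_abs_rpow (by linarith) η).const_mul C
  have mker : ∀ w : ℂ, Measurable fun x : ℝ => ((x : ℂ) - w)⁻¹ := fun w => by fun_prop
  have mker0 : Measurable fun x : ℝ => ((x : ℂ))⁻¹ := by fun_prop
  have ik : Integrable fun x : ℝ => ((x : ℂ))⁻¹ • h x := by
    refine ibd.mono' (mker0.aestronglyMeasurable.smul ih.aestronglyMeasurable) ?_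
    filter_upwards [ne0] with x hx
    rw [norm_smul, norm_inv, Complex.norm_real]
    exact (hbd x).resolve_right hx
  have itr : ∀ {g : ℝ → E}, Integrable g → ∀ ε > 0,
      IntegrableOn (fun x : ℝ => ((x : ℂ))⁻¹ • g x) {x | ε < |x|} := by
    intro g hg ε hε
    refine ((hg.norm.const_mul ε⁻¹).integrableOn).mono'
      (mker0.aestronglyMeasurable.smul hg.aestronglyMeasurable).restrict ?_
    filter_upwards [ae_restrict_mem (mε ε)] with x hx
    rw [norm_smul, norm_inv, Complex.norm_real]
    gcongr
    exact le_of_lt hx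
  -- The principal value is the absolutely convergent integral of `h x / x`, as the even function
  -- `χ` integrates to zero against the odd kernel.
  refine ⟨∫ x : ℝ, ((x : ℂ))⁻¹ • h x, fun ε hε => itr hf ε hε, ?_, fun s hs => ?_⟩
  · have e1 : ∀ᶠ ε : ℝ in 𝓝[>] 0, ∫ x in {x | ε < |x|}, ((x : ℂ))⁻¹ • f x =
        ∫ x, indicator {x | ε < |x|} (fun x : ℝ => ((x : ℂ))⁻¹ • h x) x := by
      filter_upwards [self_mem_nhdsWithin] with ε hε
      rw [integral_indicator (mε ε)]
      have e2 : ∫ x in {x | ε < |x|}, ((x : ℂ))⁻¹ • χ x = 0 := by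
        rw [← integral_indicator (mε ε)]
        refine integral_eq_zero_of_odd fun x => ?_
        have hc : χ (-x) = χ x := by
          by_cases hx : x ∈ Ioo (-η) η
          · rw [hχ, indicator_of_mem hx, indicator_of_mem]
            rw [mem_iff] at *; rwa [abs_neg]
          · rw [hχ, indicator_of_notMem hx, indicator_of_notMem]
            rw [mem_iff] at *; rwa [abs_neg]
        by_cases hx : ε < |x|
        · rw [indicator_of_mem (by simpa using hx), indicator_of_mem (by simpa using hx), hc]
          push_cast
          rw [inv_neg, neg_smul]
        · rw [indicator_of_notMem (by simpa using hx), indicator_of_notMem (by simpa using hx),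
            neg_zero]
      rw [← add_zero (∫ x in {x | ε < |x|}, ((x : ℂ))⁻¹ • h x), ← e2,
        ← integral_add (ik.integrableOn) (itr iχ ε hε)]
      refine integral_congr_ae (Eventually.of_forall fun x => ?_)
      simp only [hh]
      rw [← smul_add, sub_add_cancel]
    rw [tendsto_congr' e1]
    refine tendsto_integral_filter_of_dominated_convergence (fun x : ℝ => ‖((x : ℂ))⁻¹ • h x‖)
      (Eventually.of_forall fun ε => ik.aestronglyMeasurable.indicator (mε ε))
      (Eventually.of_forall fun ε => Eventually.of_forall fun x => norm_indicator_le_norm_self _ _)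
      ik.norm ?_
    filter_upwards [ne0] with x hx
    refine tendsto_const_nhds.congr' ?_
    have : ∀ᶠ ε : ℝ in 𝓝[>] 0, ε < |x| :=
      nhdsWithin_le_nhds (Iio_mem_nhds (abs_pos.2 hx))
    filter_upwards [this] with ε hε
    rw [indicator_of_mem (by simpa using hε)]
  · have hdom : ∀ {g : ℝ → E} {B : ℝ → ℝ} (δ : ℝ),
        (∀ x : ℝ, |x|⁻¹ * ‖g x‖ ≤ B x ∨ x = 0) →
        ∀ᵐ x : ℝ, ‖((x : ℂ) - Complex.I * s * δ)⁻¹ • g x‖ ≤ B x := by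
      intro g B δ hB
      filter_upwards [ne0] with x hx
      rw [norm_smul]
      exact (mul_le_mul_of_nonneg_right ((norm_inv_sub_I_mul_le x δ s).resolve_right hx)
        (norm_nonneg _)).trans ((hB x).resolve_right hx)
    have ikδ : ∀ δ : ℝ, Integrable fun x : ℝ => ((x : ℂ) - Complex.I * s * δ)⁻¹ • h x := fun δ =>
      ibd.mono' ((mker _).aestronglyMeasurable.smul ih.aestronglyMeasurable)
        (hdom δ hbd)
    have t1 : Tendsto (fun δ : ℝ => ∫ x : ℝ, ((x : ℂ) - Complex.I * s * δ)⁻¹ • h x) (𝓝[>] 0)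
        (𝓝 (∫ x : ℝ, ((x : ℂ))⁻¹ • h x)) := by
      refine tendsto_integral_filter_of_dominated_convergence _
        (Eventually.of_forall fun δ => (ikδ δ).aestronglyMeasurable)
        (Eventually.of_forall fun δ => hdom δ hbd) ibd ?_
      filter_upwards [ne0] with x hx
      refine Tendsto.smul_const ?_ _
      have : Tendsto (fun δ : ℝ => ((x : ℂ) - Complex.I * s * δ)) (𝓝[>] 0)
          (𝓝 ((x : ℂ) - Complex.I * s * (0 : ℝ))) :=
        (Continuous.tendsto (by fun_prop) 0).mono_left nhdsWithin_le_nhds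
      rw [Complex.ofReal_zero, mul_zero, sub_zero] at this
      exact this.inv₀ (by exact_mod_cast hx)
    have iχδ : ∀ δ : ℝ, 0 < δ →
        Integrable fun x : ℝ => ((x : ℂ) - Complex.I * s * δ)⁻¹ • χ x := by
      intro δ hδ
      refine (iχ.norm.const_mul δ⁻¹).mono'
        ((mker _).aestronglyMeasurable.smul iχ.aestronglyMeasurable)
        (Eventually.of_forall fun x => ?_)
      rw [norm_smul, norm_inv]
      gcongr
      have h1 := Complex.abs_im_le_norm ((x : ℂ) - Complex.I * s * δ)
      have h2 : |s| = 1 := by rw [← sq_abs] at hs; nlinarith [abs_nonneg s]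
      simpa [abs_mul, h2, abs_of_pos hδ] using h1
    have e3 : ∀ᶠ δ : ℝ in 𝓝[>] 0, ∫ x : ℝ, ((x : ℂ) - Complex.I * s * δ)⁻¹ • f x =
        (∫ x : ℝ, ((x : ℂ) - Complex.I * s * δ)⁻¹ • h x) +
          (Complex.I * s * ((2 * Real.arctan (η / δ) : ℝ) : ℂ)) • f 0 := by
      filter_upwards [self_mem_nhdsWithin] with δ hδ
      have e4 : ∫ x : ℝ, ((x : ℂ) - Complex.I * s * δ)⁻¹ • χ x =
          (Complex.I * s * ((2 * Real.arctan (η / δ) : ℝ) : ℂ)) • f 0 := by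
        rw [← integral_inv_sub_I_mul hs hδ hη, ← integral_smul_const, ← integral_indicator mI]
        refine integral_congr_ae (Eventually.of_forall fun x => ?_)
        simp only [hχ]
        by_cases hx : x ∈ Ioo (-η) η
        · rw [indicator_of_mem hx, indicator_of_mem hx]
        · rw [indicator_of_notMem hx, indicator_of_notMem hx, smul_zero]
      rw [← e4, ← integral_add (ikδ δ) (iχδ δ hδ)]
      refine integral_congr_ae (Eventually.of_forall fun x => ?_)
      change _ = _ • (f x - χ x) + _
      rw [← smul_add, sub_add_cancel]
    rw [tendsto_congr' e3]
    refine t1.add (Tendsto.smul_const ?_ _)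
    have t2 : Tendsto (fun δ : ℝ => Real.arctan (η / δ)) (𝓝[>] 0) (𝓝 (Real.pi / 2)) := by
      refine (Real.tendsto_arctan_atTop.mono_right nhdsWithin_le_nhds).comp ?_
      exact (tendsto_inv_nhdsGT_zero.const_mul_atTop hη).congr fun δ => (div_eq_mul_inv η δ).symm
    have t3 := ((Complex.continuous_ofReal.tendsto _).comp (t2.const_mul 2)).const_mul
      (Complex.I * s)
    refine (t3.congr fun δ => rfl).trans_eq ?_
    congr 1
    push_cast
    ring

/-- The Plemelj formula for the kernel `(u² - w²)⁻¹`. -/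
theorem plemelj_sq [CompleteSpace E] {g : ℝ → E} (hg : Integrable g) {u₀ m₀ : ℝ}
    (hpos : 0 < m₀ + u₀) (hsupp : ∀ u < m₀, g u = 0) {α C η : ℝ} (hα : 0 < α) (hη : 0 < η)
    (hH : ∀ u, |u - u₀| < η → ‖((u + u₀ : ℝ) : ℂ)⁻¹ • g u - ((u₀ + u₀ : ℝ) : ℂ)⁻¹ • g u₀‖ ≤
      C * |u - u₀| ^ α) :
    ∃ P : E,
      (∀ ε > 0, IntegrableOn (fun u : ℝ => ((u ^ 2 - u₀ ^ 2 : ℝ) : ℂ)⁻¹ • g u)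
        {u | ε < |u - u₀|}) ∧
      Tendsto (fun ε : ℝ => ∫ u in {u | ε < |u - u₀|}, ((u ^ 2 - u₀ ^ 2 : ℝ) : ℂ)⁻¹ • g u)
        (𝓝[>] 0) (𝓝 P) ∧
      ∀ s : ℝ, s ^ 2 = 1 →
        Tendsto (fun δ : ℝ => ∫ u : ℝ, ((u : ℂ) ^ 2 - (u₀ + Complex.I * s * δ) ^ 2)⁻¹ • g u)
          (𝓝[>] 0) (𝓝 (P + (Complex.I * Real.pi * s) • ((u₀ + u₀ : ℝ) : ℂ)⁻¹ • g u₀)) := by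
  -- Factor `u² - u₀² = (u - u₀)(u + u₀)` and absorb the second factor into the density; on the
  -- support `u + u₀ ≥ m₀ + u₀ > 0`, so integrability is preserved.
  set f : ℝ → E := fun u => ((u + u₀ : ℝ) : ℂ)⁻¹ • g u with hf
  have hker : ∀ w : ℂ, Measurable fun u : ℝ => ((u : ℂ) - w)⁻¹ := fun w => by fun_prop
  have hker' : ∀ w : ℂ, Measurable fun u : ℝ => ((u : ℂ) + w)⁻¹ := fun w => by fun_prop
  have hfi : Integrable f := by
    refine (hg.norm.const_mul (m₀ + u₀)⁻¹).mono'
      (AEStronglyMeasurable.smul (Measurable.aestronglyMeasurable (by fun_prop))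
        hg.aestronglyMeasurable) (Eventually.of_forall fun u => ?_)
    rw [hf, norm_smul, norm_inv, Complex.norm_real]
    rcases lt_or_ge u m₀ with h | h
    · simp [hsupp u h]
    · gcongr
      rw [Real.norm_eq_abs]
      exact (by linarith : m₀ + u₀ ≤ u + u₀).trans (le_abs_self _)
  have hfi0 : Integrable fun x => f (x + u₀) := hfi.comp_add_right u₀
  obtain ⟨P, h1, h2, h3⟩ := plemelj_zero hfi0 (α := α) (C := C) hα hη (fun x hx => by
    have := hH (x + u₀) (by simpa using hx)
    simpa [hf] using this)
  have mε : ∀ ε : ℝ, MeasurableSet {x : ℝ | ε < |x|} := fun ε =>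
    measurableSet_lt measurable_const measurable_id.abs
  have mε' : ∀ ε : ℝ, MeasurableSet {u : ℝ | ε < |u - u₀|} := fun ε =>
    measurableSet_lt measurable_const (by fun_prop)
  have hind : ∀ ε : ℝ, indicator {u | ε < |u - u₀|}
      (fun u : ℝ => ((u ^ 2 - u₀ ^ 2 : ℝ) : ℂ)⁻¹ • g u) =
      fun u => indicator {x : ℝ | ε < |x|} (fun x : ℝ => ((x : ℂ))⁻¹ • f (x + u₀)) (u - u₀) := by
    intro ε
    funext u
    by_cases hu : ε < |u - u₀|
    · rw [indicator_of_mem (by simpa using hu), indicator_of_mem (by simpa using hu)]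
      simp only [hf, sub_add_cancel]
      rw [smul_smul, ← mul_inv]
      congr 2
      push_cast
      ring
    · rw [indicator_of_notMem (by simpa using hu), indicator_of_notMem (by simpa using hu)]
  refine ⟨P, fun ε hε => ?_, h2.congr fun ε => ?_, fun s hs => ?_⟩
  · rw [← integrable_indicator_iff (mε' ε), hind]
    exact ((integrable_indicator_iff (mε ε)).2 (h1 ε hε)).comp_sub_right u₀
  · rw [← integral_indicator (mε' ε), hind, integral_sub_right_eq_self
      (indicator {x : ℝ | ε < |x|} fun x : ℝ => ((x : ℂ))⁻¹ • f (x + u₀)), integral_indicator (mε ε)]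
  · have hs1 : |s| = 1 := by rw [← sq_abs] at hs; nlinarith [abs_nonneg s]
    set w : ℝ → ℂ := fun δ => u₀ + Complex.I * s * δ with hw
    have hint : ∀ δ : ℝ, 0 < δ → Integrable fun u : ℝ => ((u : ℂ) - w δ)⁻¹ • f u := by
      intro δ hδ
      refine (hfi.norm.const_mul δ⁻¹).mono'
        ((hker _).aestronglyMeasurable.smul hfi.aestronglyMeasurable)
        (Eventually.of_forall fun x => ?_)
      rw [norm_smul, norm_inv]
      gcongr
      have h1 := Complex.abs_im_le_norm ((x : ℂ) - w δ)
      simpa [hw, abs_mul, hs1, abs_of_pos hδ] using h1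
    have hbd : ∀ δ : ℝ, 0 < δ → ∀ u : ℝ,
        ‖((u : ℂ) + w δ)⁻¹ • (Complex.I * s * δ) • ((u : ℂ) - w δ)⁻¹ • f u‖ ≤
          (m₀ + u₀)⁻¹ * ‖f u‖ := by
      intro δ hδ u
      rcases lt_or_ge u m₀ with h | h
      · simp [hf, hsupp u h]
      · have e1 : ‖(Complex.I * s * δ)‖ * ‖((u : ℂ) - w δ)⁻¹‖ ≤ 1 := by
          have h1 := Complex.abs_im_le_norm ((u : ℂ) - w δ)
          have h2 : δ ≤ ‖(u : ℂ) - w δ‖ := by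
            simpa [hw, abs_mul, hs1, abs_of_pos hδ] using h1
          rw [norm_inv, norm_mul, norm_mul, Complex.norm_I, Complex.norm_real, Complex.norm_real,
            Real.norm_eq_abs, Real.norm_eq_abs, hs1, abs_of_pos hδ, one_mul, one_mul,
            ← div_eq_mul_inv]
          exact div_le_one_of_le₀ h2 (norm_nonneg _)
        have e2 : ‖((u : ℂ) + w δ)⁻¹‖ ≤ (m₀ + u₀)⁻¹ := by
          rw [norm_inv]
          refine inv_anti₀ hpos ?_
          have h1 := Complex.abs_re_le_norm ((u : ℂ) + w δ)
          have h2 : |u + u₀| ≤ ‖(u : ℂ) + w δ‖ := by simpa [hw] using h1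
          exact ((by linarith : m₀ + u₀ ≤ u + u₀).trans (le_abs_self _)).trans h2
        rw [norm_smul, norm_smul, norm_smul, ← mul_assoc (‖(Complex.I * s * δ)‖)]
        calc _ ≤ (m₀ + u₀)⁻¹ * (1 * ‖f u‖) := by gcongr
          _ = _ := by rw [one_mul]
    have hmeas : ∀ δ : ℝ, AEStronglyMeasurable fun u : ℝ =>
        ((u : ℂ) + w δ)⁻¹ • (Complex.I * s * δ) • ((u : ℂ) - w δ)⁻¹ • f u := fun δ =>
      (hker' _).aestronglyMeasurable.smul
        (((hker _).aestronglyMeasurable.smul hfi.aestronglyMeasurable).const_smul _)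
    -- The error made by using `(u + u₀)⁻¹` in place of `(u + w)⁻¹`. The factor `isδ / (u - w)` has
    -- norm at most `1` and tends to `0` for `u ≠ u₀`, so dominated convergence applies.
    have t1 : Tendsto (fun δ : ℝ => ∫ u : ℝ,
        ((u : ℂ) + w δ)⁻¹ • (Complex.I * s * δ) • ((u : ℂ) - w δ)⁻¹ • f u) (𝓝[>] 0)
        (𝓝 (∫ _ : ℝ, (0 : E))) := by
      refine tendsto_integral_filter_of_dominated_convergence (fun u => (m₀ + u₀)⁻¹ * ‖f u‖)
        (Eventually.of_forall hmeas) ?_ (hfi.norm.const_mul _) ?_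
      · filter_upwards [self_mem_nhdsWithin] with δ hδ
        exact Eventually.of_forall (hbd δ hδ)
      · have ne0 : ∀ᵐ u : ℝ, u ≠ u₀ := by simp [ae_iff]
        filter_upwards [ne0] with u hu
        rcases lt_or_ge u m₀ with h | h
        · simp [hf, hsupp u h]
        have hw0 : Tendsto w (𝓝[>] 0) (𝓝 (u₀ : ℂ)) := by
          have : Tendsto w (𝓝[>] 0) (𝓝 (w 0)) :=
            (Continuous.tendsto (by fun_prop) 0).mono_left nhdsWithin_le_nhds
          simpa [hw] using this
        have hδ0 : Tendsto (fun δ : ℝ => Complex.I * s * δ) (𝓝[>] 0) (𝓝 0) := by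
          have : Tendsto (fun δ : ℝ => Complex.I * s * δ) (𝓝[>] 0)
              (𝓝 (Complex.I * s * (0 : ℝ))) :=
            (Continuous.tendsto (by fun_prop) 0).mono_left nhdsWithin_le_nhds
          simpa using this
        have l1 : Tendsto (fun δ => ((u : ℂ) + w δ)⁻¹) (𝓝[>] 0) (𝓝 ((u : ℂ) + u₀)⁻¹) :=
          (hw0.const_add _).inv₀ (by
            have : u + u₀ ≠ 0 := by linarith
            exact_mod_cast this)
        have l2 : Tendsto (fun δ => ((u : ℂ) - w δ)⁻¹) (𝓝[>] 0) (𝓝 ((u : ℂ) - u₀)⁻¹) :=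
          (hw0.const_sub _).inv₀ (by
            have : u - u₀ ≠ 0 := sub_ne_zero.2 hu
            exact_mod_cast this)
        have := l1.smul (hδ0.smul (l2.smul_const (f u)))
        simpa using this
    -- Since `isδ = w - u₀`, the algebra is `1 - (w - u₀)/(u + w) = (u + u₀)/(u + w)`. Below `m₀`
    -- both integrands vanish.
    have e5 : ∀ᶠ δ : ℝ in 𝓝[>] 0,
        (∫ x : ℝ, ((x : ℂ) - Complex.I * s * δ)⁻¹ • f (x + u₀)) -
          (∫ u : ℝ, ((u : ℂ) + w δ)⁻¹ • (Complex.I * s * δ) • ((u : ℂ) - w δ)⁻¹ • f u) =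
        ∫ u : ℝ, ((u : ℂ) ^ 2 - w δ ^ 2)⁻¹ • g u := by
      filter_upwards [self_mem_nhdsWithin] with δ hδ
      have hδ : 0 < δ := hδ
      have e6 : (∫ x : ℝ, ((x : ℂ) - Complex.I * s * δ)⁻¹ • f (x + u₀)) =
          ∫ u : ℝ, ((u : ℂ) - w δ)⁻¹ • f u := by
        rw [← integral_add_right_eq_self (fun u : ℝ => ((u : ℂ) - w δ)⁻¹ • f u) u₀]
        refine integral_congr_ae (Eventually.of_forall fun x => ?_)
        simp only [hw]
        congr 2
        push_cast
        ring
      rw [e6, ← integral_sub (hint δ hδ)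
        ((hfi.norm.const_mul _).mono' (hmeas δ) (Eventually.of_forall (hbd δ hδ)))]
      refine integral_congr_ae (Eventually.of_forall fun u => ?_)
      simp only
      rcases lt_or_ge u m₀ with h | h
      · simp [hf, hsupp u h]
      have n1 : (u : ℂ) + w δ ≠ 0 := by
        intro h0
        have := congrArg Complex.re h0
        simp [hw] at this
        linarith
      have n2 : (u : ℂ) - w δ ≠ 0 := by
        intro h0
        have := congrArg Complex.im h0
        simp only [hw, Complex.sub_im, Complex.ofReal_im, Complex.add_im, Complex.mul_im,
          Complex.mul_re, Complex.I_re, Complex.I_im, Complex.ofReal_re, Complex.zero_im] at this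
        have h4 : s * δ = 0 := by linarith
        rcases mul_eq_zero.1 h4 with h5 | h5
        · rw [h5] at hs1; simp at hs1
        · exact hδ.ne' h5
      have n3 : ((u + u₀ : ℝ) : ℂ) ≠ 0 := by
        have : u + u₀ ≠ 0 := by linarith
        exact_mod_cast this
      simp only [hf, smul_smul]
      rw [← sub_smul]
      congr 1
      have n4 : (u : ℂ) ^ 2 - w δ ^ 2 ≠ 0 := by
        rw [sq_sub_sq]; exact mul_ne_zero n1 n2
      have h6 : Complex.I * s * δ = w δ - u₀ := by simp only [hw]; ring
      rw [h6]
      push_cast at n3 ⊢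
      field_simp
      ring
    have t2 := ((h3 s hs).sub t1).congr' e5
    simpa [hf] using t2

end Plemelj

/-! ### The one-dimensional Hausdorff measure on a regular curve -/

section ArcLength

open Measure

variable {E : Type*} [NormedAddCommGroup E] [NormedSpace ℝ E] [MeasurableSpace E] [BorelSpace E]

/-- Near `x₀` strict differentiability makes `γ` Lipschitz with constant `‖v‖ + ε` and, if `‖v‖ >
ε`, injective with inverse Lipschitz of constant `(‖v‖ - ε)⁻¹`. Hausdorff measure grows at most by
these factors. If `‖v‖ ≤ ε`, the lower bound is trivial. -/
theorem hausdorffMeasure_image_near {γ : ℝ → E} {v : E} {x₀ : ℝ} (h : HasStrictDerivAt γ v x₀)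
    {ε : ℝ} (hε : 0 < ε) : ∃ η > 0, ∀ c d : ℝ, |c - x₀| < η → |d - x₀| < η → c ≤ d →
      μH[1] (γ '' Ioc c d) ≠ ⊤ ∧
      |(μH[1] (γ '' Ioc c d)).toReal - (d - c) * ‖v‖| ≤ ε * (d - c) := by
  have h1 := h.hasStrictFDerivAt.isLittleO.def hε
  obtain ⟨η, hη, h2⟩ := Metric.eventually_nhds_iff.1 h1
  have h3 : ∀ s t : ℝ, |s - x₀| < η → |t - x₀| < η →
      ‖γ s - γ t - (s - t) • v‖ ≤ ε * |s - t| := fun s t hs ht => by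
    have := h2 (y := (s, t)) (by
      rw [Prod.dist_eq]; exact max_lt (by simpa [Real.dist_eq]) (by simpa [Real.dist_eq]))
    simpa using this
  refine ⟨η, hη, fun c d hc hd hcd => ?_⟩
  have hmem : ∀ s ∈ Ioc c d, |s - x₀| < η := fun s hs => by
    rw [abs_lt] at *
    exact ⟨by linarith [hs.1], by linarith [hs.2]⟩
  have hvol : μH[1] (Ioc c d) = ENNReal.ofReal (d - c) := by
    rw [hausdorffMeasure_real, Real.volume_Ioc]
  -- upper bound
  have hup : μH[1] (γ '' Ioc c d) ≤ ENNReal.ofReal ((‖v‖ + ε) * (d - c)) := by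
    have hlip : LipschitzOnWith (‖v‖ + ε).toNNReal γ (Ioc c d) := by
      refine LipschitzOnWith.of_dist_le_mul fun s hs t ht => ?_
      rw [Real.coe_toNNReal _ (by positivity), dist_eq_norm, Real.dist_eq]
      have h4 := h3 s t (hmem s hs) (hmem t ht)
      calc ‖γ s - γ t‖ = ‖(γ s - γ t - (s - t) • v) + (s - t) • v‖ := by rw [sub_add_cancel]
        _ ≤ ε * |s - t| + |s - t| * ‖v‖ := by
            refine (norm_add_le _ _).trans (add_le_add h4 ?_)
            rw [norm_smul, Real.norm_eq_abs]
        _ = _ := by ring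
    refine (hlip.hausdorffMeasure_image_le zero_le_one).trans ?_
    rw [hvol, ENNReal.rpow_one, ENNReal.ofReal_mul (by positivity)]
    rfl
  have hfin : μH[1] (γ '' Ioc c d) ≠ ⊤ := ne_top_of_le_ne_top ENNReal.ofReal_ne_top hup
  refine ⟨hfin, ?_⟩
  have hup' := ENNReal.toReal_le_of_le_ofReal
    (mul_nonneg (by positivity) (sub_nonneg.2 hcd)) hup
  rw [abs_le]
  refine ⟨?_, by linarith⟩
  rcases le_or_gt ‖v‖ ε with hv | hv
  · have : 0 ≤ (μH[1] (γ '' Ioc c d)).toReal := ENNReal.toReal_nonneg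
    nlinarith [sub_nonneg.2 hcd]
  have hK : 0 < ‖v‖ - ε := sub_pos.2 hv
  have hlow : ∀ s ∈ Ioc c d, ∀ t ∈ Ioc c d, (‖v‖ - ε) * |s - t| ≤ ‖γ s - γ t‖ := by
    intro s hs t ht
    have h4 := h3 s t (hmem s hs) (hmem t ht)
    have h5 : |s - t| * ‖v‖ = ‖(γ s - γ t) - (γ s - γ t - (s - t) • v)‖ := by
      rw [sub_sub_cancel, norm_smul, Real.norm_eq_abs]
    have h6 := norm_sub_le (γ s - γ t) (γ s - γ t - (s - t) • v)
    linarith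
  have hinj : InjOn γ (Ioc c d) := fun s hs t ht hst => by
    have := hlow s hs t ht
    rw [hst, sub_self, norm_zero] at this
    have h7 : |s - t| ≤ 0 := by
      by_contra h8
      push Not at h8
      nlinarith
    exact sub_eq_zero.1 (abs_nonpos_iff.1 h7)
  have hlip : LipschitzOnWith (‖v‖ - ε)⁻¹.toNNReal (Function.invFunOn γ (Ioc c d))
      (γ '' Ioc c d) := by
    refine LipschitzOnWith.of_dist_le_mul ?_
    rintro _ ⟨s, hs, rfl⟩ _ ⟨t, ht, rfl⟩
    rw [hinj.leftInvOn_invFunOn hs, hinj.leftInvOn_invFunOn ht,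
      Real.coe_toNNReal _ (by positivity), dist_eq_norm (γ s), Real.dist_eq]
    rw [le_inv_mul_iff₀ hK]
    exact hlow s hs t ht
  have h8 := hlip.hausdorffMeasure_image_le (d := 1) zero_le_one
  rw [hinj.leftInvOn_invFunOn.image_image, hvol, ENNReal.rpow_one] at h8
  have h9 := ENNReal.toReal_mono (ENNReal.mul_ne_top ENNReal.coe_ne_top hfin) h8
  rw [ENNReal.toReal_mul, ENNReal.toReal_ofReal (sub_nonneg.2 hcd), ENNReal.coe_toReal,
    Real.coe_toNNReal _ (by positivity), le_inv_mul_iff₀ hK] at h9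
  linarith

variable {γ γ' : ℝ → E} {a b : ℝ}

/-- An instance of the Lusin–Souslin theorem: a continuous injection of a Polish space is a
measurable embedding. -/
theorem measurableEmbedding_curve (hγ : ∀ t ∈ Ioo a b, HasStrictDerivAt γ (γ' t) t)
    (hinj : InjOn γ (Ioo a b)) : MeasurableEmbedding fun t : Ioo a b => γ t := by
  have : PolishSpace (Ioo a b) := isOpen_Ioo.polishSpace
  refine Continuous.measurableEmbedding ?_ fun s t hst => Subtype.ext (hinj s.2 t.2 hst)
  exact continuousOn_iff_continuous_domRestrict.1 fun t ht =>
    (hγ t ht).hasDerivAt.continuousAt.continuousWithinAt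

/-- The length measure of a curve, on the space of parameters. -/
def lengthMeasure (γ : ℝ → E) (a b : ℝ) : Measure ℝ :=
  (Measure.comap (fun t : Ioo a b => γ t) μH[1]).map Subtype.val

theorem lengthMeasure_apply (hγ : ∀ t ∈ Ioo a b, HasStrictDerivAt γ (γ' t) t)
    (hinj : InjOn γ (Ioo a b)) {B : Set ℝ} (hB : MeasurableSet B) :
    lengthMeasure γ a b B = μH[1] (γ '' (Ioo a b ∩ B)) := by
  rw [lengthMeasure, map_apply measurable_subtype_coe hB,
    (measurableEmbedding_curve hγ hinj).comap_apply]
  congr 1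
  ext x
  constructor
  · rintro ⟨t, ht, rfl⟩
    exact ⟨t, ⟨t.2, ht⟩, rfl⟩
  · rintro ⟨t, ⟨ht1, ht2⟩, rfl⟩
    exact ⟨⟨t, ht1⟩, ht2, rfl⟩

theorem lengthMeasure_Ioc_aux (hγ : ∀ t ∈ Ioo a b, HasStrictDerivAt γ (γ' t) t)
    (hinj : InjOn γ (Ioo a b)) {c d : ℝ} (hc : a < c) (hd : d < b) :
    lengthMeasure γ a b (Ioc c d) = μH[1] (γ '' Ioc c d) := by
  rw [lengthMeasure_apply hγ hinj measurableSet_Ioc]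
  congr 2
  exact inter_eq_right.2 fun t ht => ⟨hc.trans ht.1, ht.2.trans_lt hd⟩

/-- Short arcs have finite length by `hausdorffMeasure_image_near`, and `[c, d]` is compact. -/
theorem lengthMeasure_Ioc_ne_top (hγ : ∀ t ∈ Ioo a b, HasStrictDerivAt γ (γ' t) t)
    (hinj : InjOn γ (Ioo a b)) {c d : ℝ} (hc : a < c) (hd : d < b) :
    lengthMeasure γ a b (Ioc c d) ≠ ⊤ := by
  refine ne_top_of_le_ne_top (b := lengthMeasure γ a b (Icc c d)) (LT.lt.ne ?_)
    (measure_mono Ioc_subset_Icc_self)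
  refine isCompact_Icc.measure_lt_top_of_nhdsWithin fun x hx => ?_
  have hx' : x ∈ Ioo a b := ⟨hc.trans_le hx.1, hx.2.trans_lt hd⟩
  obtain ⟨η, hη, h⟩ := hausdorffMeasure_image_near (hγ x hx') one_pos
  -- Half the minimum, so that the interval of radius `κ` lies both within the range of the local
  -- estimate and strictly inside `(a, b)`.
  set κ := min η (min (x - a) (b - x)) / 2 with hκ
  have hκ0 : 0 < κ := half_pos (lt_min hη (lt_min (sub_pos.2 hx'.1) (sub_pos.2 hx'.2)))
  have hκ1 : 2 * κ ≤ η := by rw [hκ, mul_div_cancel₀ _ two_ne_zero]; exact min_le_left _ _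
  have hκ2 : 2 * κ ≤ x - a := by
    rw [hκ, mul_div_cancel₀ _ two_ne_zero]
    exact (min_le_right _ _).trans (min_le_left _ _)
  have hκ3 : 2 * κ ≤ b - x := by
    rw [hκ, mul_div_cancel₀ _ two_ne_zero]
    exact (min_le_right _ _).trans (min_le_right _ _)
  refine ⟨Ioc (x - κ) (x + κ), mem_nhdsWithin_of_mem_nhds
    (Ioc_mem_nhds (by linarith) (by linarith)), ?_⟩
  rw [lengthMeasure_Ioc_aux hγ hinj (by linarith) (by linarith)]
  exact lt_top_iff_ne_top.2 (h _ _ (by rw [abs_lt]; constructor <;> linarith)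
    (by rw [abs_lt]; constructor <;> linarith) (by linarith)).1

/-- By additivity an increment of the arc length function is the length of a short arc adjacent to
`x`, and the local estimate holds for every `ε`. -/
theorem hasDerivAt_lengthMeasure (hγ : ∀ t ∈ Ioo a b, HasStrictDerivAt γ (γ' t) t)
    (hinj : InjOn γ (Ioo a b)) {c x : ℝ} (hc : a < c) (hcx : c < x) (hx : x < b) :
    HasDerivAt (fun y => (lengthMeasure γ a b (Ioc c y)).toReal) ‖γ' x‖ x := by
  rw [hasDerivAt_iff_isLittleO]
  refine Asymptotics.IsLittleO.of_bound fun ε hε => ?_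
  obtain ⟨η, hη, h⟩ := hausdorffMeasure_image_near (hγ x ⟨hc.trans hcx, hx⟩) hε
  have e1 : ∀ᶠ y in 𝓝 x, |y - x| < η := by
    filter_upwards [Metric.ball_mem_nhds x hη] with y hy
    simpa [Real.dist_eq] using hy
  have hadd : ∀ y z, c < y → y ≤ z → z < b →
      (lengthMeasure γ a b (Ioc c z)).toReal - (lengthMeasure γ a b (Ioc c y)).toReal =
        (μH[1] (γ '' Ioc y z)).toReal := by
    intro y z hy hyz hz
    rw [← lengthMeasure_Ioc_aux hγ hinj (hc.trans hy) hz, ← Ioc_union_Ioc_eq_Ioc hy.le hyz,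
      measure_union (Ioc_disjoint_Ioc_of_le le_rfl) measurableSet_Ioc,
      ENNReal.toReal_add (lengthMeasure_Ioc_ne_top hγ hinj hc (hyz.trans_lt hz))
        (lengthMeasure_Ioc_ne_top hγ hinj (hc.trans hy) hz), add_sub_cancel_left]
  filter_upwards [e1, Ioo_mem_nhds hcx hx] with y hy hy2
  rw [smul_eq_mul, Real.norm_eq_abs, Real.norm_eq_abs]
  have hx0 : |x - x| < η := by simpa
  rcases le_total x y with hxy | hxy
  · rw [hadd x y hcx hxy hy2.2, abs_of_nonneg (sub_nonneg.2 hxy)]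
    exact (h x y hx0 hy hxy).2
  · have h2 := (h y x hy hx0 hxy).2
    rw [← hadd y x hy2.1 hxy hx] at h2
    rw [abs_sub_comm y x, abs_of_nonneg (sub_nonneg.2 hxy), ← abs_neg]
    convert h2 using 2
    ring

theorem lengthMeasure_Ioc (hγ : ∀ t ∈ Ioo a b, HasStrictDerivAt γ (γ' t) t)
    (hcont : ContinuousOn γ' (Ioo a b)) (hinj : InjOn γ (Ioo a b)) {c d : ℝ} (hc : a < c)
    (hcd : c ≤ d) (hd : d < b) :
    lengthMeasure γ a b (Ioc c d) = ∫⁻ t in Ioc c d, (‖γ' t‖₊ : ℝ≥0∞) := by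
  -- The lengths are measured from a base point strictly to the left of `c`, so that the derivative
  -- formula is available on the whole closed interval `[c, d]`.
  obtain ⟨c', hc', hcc'⟩ := exists_between hc
  have hsub : Icc c d ⊆ Ioo a b := fun t ht => ⟨hc.trans_le ht.1, ht.2.trans_lt hd⟩
  have hcn : ContinuousOn (fun t => ‖γ' t‖) (Icc c d) := (hcont.mono hsub).norm
  have hint : IntervalIntegrable (fun t => ‖γ' t‖) volume c d :=
    ContinuousOn.intervalIntegrable (by rwa [uIcc_of_le hcd])
  have h1 := intervalIntegral.integral_eq_sub_of_hasDerivAt (fun x hx => by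
    rw [uIcc_of_le hcd] at hx
    exact hasDerivAt_lengthMeasure hγ hinj hc' (hcc'.trans_le hx.1) (hx.2.trans_lt hd)) hint
  have h2 : (lengthMeasure γ a b (Ioc c' d)) =
      lengthMeasure γ a b (Ioc c' c) + lengthMeasure γ a b (Ioc c d) := by
    rw [← Ioc_union_Ioc_eq_Ioc hcc'.le hcd,
      measure_union (Ioc_disjoint_Ioc_of_le le_rfl) measurableSet_Ioc]
  have hfin := lengthMeasure_Ioc_ne_top hγ hinj hc hd
  rw [h2, ENNReal.toReal_add (lengthMeasure_Ioc_ne_top hγ hinj hc' (hcd.trans_lt hd)) hfin,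
    add_sub_cancel_left, intervalIntegral.integral_of_le hcd] at h1
  rw [← ENNReal.ofReal_toReal hfin, ← h1, ofReal_integral_norm_eq_lintegral_enorm]
  · rfl
  · rw [← integrable_norm_iff]
    · exact (intervalIntegrable_iff_integrableOn_Ioc_of_le hcd).1 hint
    · exact ((hcont.mono hsub).mono Ioc_subset_Icc_self).aestronglyMeasurable measurableSet_Ioc

/-- Both measures agree on half-open intervals compactly contained in `(a, b)`, and countably many
of these with rational endpoints exhaust `(a, b)`. Neither measure charges the complement. -/
theorem lengthMeasure_eq_withDensity (hγ : ∀ t ∈ Ioo a b, HasStrictDerivAt γ (γ' t) t)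
    (hcont : ContinuousOn γ' (Ioo a b)) (hinj : InjOn γ (Ioo a b)) :
    lengthMeasure γ a b =
      (volume.restrict (Ioo a b)).withDensity fun t => (‖γ' t‖₊ : ℝ≥0∞) := by
  set ι := {p : ℚ × ℚ // a < p.1 ∧ (p.2 : ℝ) < b}
  set s : ι → Set ℝ := fun p => Ioc (p.1.1 : ℝ) (p.1.2 : ℝ)
  have hsub : ∀ p, s p ⊆ Ioo a b := fun p t ht => ⟨p.2.1.trans ht.1, ht.2.trans_lt p.2.2⟩
  have hU : Ioo a b = ⋃ p, s p := by
    refine Subset.antisymm (fun t ht => ?_) (iUnion_subset hsub)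
    obtain ⟨q1, h1, h2⟩ := exists_rat_btwn ht.1
    obtain ⟨q2, h3, h4⟩ := exists_rat_btwn ht.2
    exact mem_iUnion.2 ⟨⟨(q1, q2), h1, h4⟩, h2, h3.le⟩
  have hIoc : ∀ c d : ℝ, a < c → d < b → lengthMeasure γ a b (Ioc c d) =
      ((volume.restrict (Ioo a b)).withDensity fun t => (‖γ' t‖₊ : ℝ≥0∞)) (Ioc c d) := by
    intro c d hc hd
    rcases le_or_gt c d with hcd | hcd
    · rw [lengthMeasure_Ioc hγ hcont hinj hc hcd hd, withDensity_apply _ measurableSet_Ioc,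
        restrict_restrict measurableSet_Ioc,
        inter_eq_left.2 (show Ioc c d ⊆ Ioo a b from fun t ht =>
          ⟨hc.trans ht.1, ht.2.trans_lt hd⟩)]
    · rw [Ioc_eq_empty (not_lt.2 hcd.le), measure_empty, measure_empty]
  have key : (lengthMeasure γ a b).restrict (Ioo a b) =
      ((volume.restrict (Ioo a b)).withDensity fun t => (‖γ' t‖₊ : ℝ≥0∞)).restrict
        (Ioo a b) := by
    rw [hU, restrict_iUnion_congr, ← hU]
    intro p
    have hfin : IsFiniteMeasure ((lengthMeasure γ a b).restrict (s p)) := ⟨by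
      rw [restrict_apply_univ]
      exact lt_top_iff_ne_top.2 (lengthMeasure_Ioc_ne_top hγ hinj p.2.1 p.2.2)⟩
    refine ext_of_Ioc_finite _ _ ?_ fun c d _ => ?_
    · rw [restrict_apply_univ, restrict_apply_univ]
      exact hIoc _ _ p.2.1 p.2.2
    · rw [Measure.restrict_apply measurableSet_Ioc, Measure.restrict_apply measurableSet_Ioc, Ioc_inter_Ioc]
      exact hIoc _ _ (p.2.1.trans_le (le_max_right _ _)) ((min_le_right _ _).trans_lt p.2.2)
  rw [restrict_withDensity measurableSet_Ioo, restrict_restrict measurableSet_Ioo, inter_self]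
    at key
  rw [← key]
  refine (restrict_eq_self_of_ae_mem ?_).symm
  rw [lengthMeasure]
  exact (ae_map_iff measurable_subtype_coe.aemeasurable (p := fun x => x ∈ Ioo a b)
    measurableSet_Ioo).2 (Eventually.of_forall fun t => t.2)

variable {F : Type*} [NormedAddCommGroup F] [NormedSpace ℝ F]

theorem integrableOn_curve_iff (hγ : ∀ t ∈ Ioo a b, HasStrictDerivAt γ (γ' t) t)
    (hcont : ContinuousOn γ' (Ioo a b)) (hinj : InjOn γ (Ioo a b)) {G : E → F} :
    IntegrableOn G (γ '' Ioo a b) μH[1] ↔ IntegrableOn (fun t => ‖γ' t‖ • G (γ t)) (Ioo a b) := by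
  have hm := measurableEmbedding_curve hγ hinj
  have hr : γ '' Ioo a b = range fun t : Ioo a b => γ t := image_eq_range _ _
  have hγ' : AEMeasurable (fun t => ‖γ' t‖₊) (volume.restrict (Ioo a b)) :=
    (hcont.aestronglyMeasurable measurableSet_Ioo).nnnorm.aemeasurable
  have h2 := integrable_withDensity_iff_integrable_smul₀ hγ' (g := fun t => G (γ t))
  rw [← lengthMeasure_eq_withDensity hγ hcont hinj, lengthMeasure,
    (MeasurableEmbedding.subtype_coe measurableSet_Ioo).integrable_map_iff] at h2
  rw [IntegrableOn, hr, ← hm.map_comap, hm.integrable_map_iff]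
  exact h2

theorem setIntegral_curve (hγ : ∀ t ∈ Ioo a b, HasStrictDerivAt γ (γ' t) t)
    (hcont : ContinuousOn γ' (Ioo a b)) (hinj : InjOn γ (Ioo a b)) (G : E → F) :
    ∫ x in γ '' Ioo a b, G x ∂μH[1] = ∫ t in Ioo a b, ‖γ' t‖ • G (γ t) := by
  have hm := measurableEmbedding_curve hγ hinj
  have hr : γ '' Ioo a b = range fun t : Ioo a b => γ t := image_eq_range _ _
  have hγ' : AEMeasurable (fun t => ‖γ' t‖₊) (volume.restrict (Ioo a b)) :=
    (hcont.aestronglyMeasurable measurableSet_Ioo).nnnorm.aemeasurable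
  have h2 := integral_withDensity_eq_integral_smul₀ hγ' (fun t => G (γ t))
  rw [← lengthMeasure_eq_withDensity hγ hcont hinj, lengthMeasure,
    (MeasurableEmbedding.subtype_coe measurableSet_Ioo).integral_map] at h2
  rw [hr, ← hm.map_comap, hm.integral_map]
  exact h2

end ArcLength

/-! ### The inverse of `u ↦ sin² (π u)` -/

section SinSq

/-- The inverse of `u ↦ sin² (π u)` on `[0, 1/2]`. -/
def sinSqInv (x : ℝ) : ℝ := Real.arcsin √x / Real.pi

/-- The derivative of `sinSqInv` on `(0, 1)`. -/
def sinSqInvDeriv (x : ℝ) : ℝ := (2 * Real.pi * √(x * (1 - x)))⁻¹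

theorem sin_sq_sinSqInv {x : ℝ} (hx : x ∈ Icc (0 : ℝ) 1) :
    Real.sin (Real.pi * sinSqInv x) ^ 2 = x := by
  rw [sinSqInv, mul_div_cancel₀ _ Real.pi_ne_zero, Real.sin_arcsin
    (by linarith [Real.sqrt_nonneg x]) (Real.sqrt_le_one.2 hx.2), Real.sq_sqrt hx.1]

theorem sinSqInv_sin_sq {u : ℝ} (hu : u ∈ Icc (0 : ℝ) (1 / 2)) :
    sinSqInv (Real.sin (Real.pi * u) ^ 2) = u := by
  have h1 : 0 ≤ Real.pi * u := mul_nonneg Real.pi_pos.le hu.1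
  have h2 : Real.pi * u ≤ Real.pi / 2 := by nlinarith [Real.pi_pos, hu.2]
  rw [sinSqInv, Real.sqrt_sq (Real.sin_nonneg_of_nonneg_of_le_pi h1 (by linarith [Real.pi_pos])),
    Real.arcsin_sin (by linarith [Real.pi_pos]) h2, mul_div_cancel_left₀ _ Real.pi_ne_zero]

theorem continuous_sinSqInv : Continuous sinSqInv :=
  (Real.continuous_arcsin.comp Real.continuous_sqrt).div_const _

theorem monotone_sinSqInv : Monotone sinSqInv := fun x y h => by
  unfold sinSqInv
  have := Real.pi_pos
  gcongr

theorem sinSqInv_mem_Icc (x : ℝ) : sinSqInv x ∈ Icc (0 : ℝ) (1 / 2) := by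
  have h1 : 0 ≤ Real.arcsin √x := Real.arcsin_nonneg.2 (Real.sqrt_nonneg _)
  have h2 := Real.arcsin_le_pi_div_two √x
  refine ⟨div_nonneg h1 Real.pi_pos.le, ?_⟩
  rw [sinSqInv, div_le_iff₀ Real.pi_pos]
  linarith

theorem sinSqInv_mem_Ioo {x : ℝ} (hx : x ∈ Ioo (0 : ℝ) 1) : sinSqInv x ∈ Ioo (0 : ℝ) (1 / 2) := by
  have h := sinSqInv_mem_Icc x
  have h1 := sin_sq_sinSqInv (Ioo_subset_Icc_self hx)
  refine ⟨lt_of_le_of_ne h.1 fun h0 => ?_, lt_of_le_of_ne h.2 fun h0 => ?_⟩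
  · rw [← h0, mul_zero, Real.sin_zero] at h1
    exact hx.1.ne (by simpa using h1)
  · rw [h0, mul_one_div, Real.sin_pi_div_two] at h1
    exact hx.2.ne (by simpa using h1.symm)

theorem hasStrictDerivAt_sinSqInv {x : ℝ} (hx : x ∈ Ioo (0 : ℝ) 1) :
    HasStrictDerivAt sinSqInv (sinSqInvDeriv x) x := by
  have h0 : 0 < √x := Real.sqrt_pos.2 hx.1
  have h1 : √x < 1 := by rw [Real.sqrt_lt' one_pos]; simpa using hx.2
  have h2 : HasStrictDerivAt sinSqInv _ x := ((Real.hasStrictDerivAt_arcsin (x := √x) (by linarith) h1.ne).comp x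
    (Real.hasStrictDerivAt_sqrt hx.1.ne')).div_const Real.pi
  refine h2.congr_deriv ?_
  have h3 : 0 < 1 - x := sub_pos.2 hx.2
  have h4 : 0 < √(1 - x) := Real.sqrt_pos.2 h3
  rw [Real.sq_sqrt hx.1.le]
  unfold sinSqInvDeriv
  rw [Real.sqrt_mul hx.1.le]
  have := Real.pi_pos
  field_simp

theorem sinSqInvDeriv_nonneg (x : ℝ) : 0 ≤ sinSqInvDeriv x :=
  inv_nonneg.2 (mul_nonneg (by linarith [Real.pi_pos]) (Real.sqrt_nonneg _))

theorem sinSqInvDeriv_pos {x : ℝ} (hx : x ∈ Ioo (0 : ℝ) 1) : 0 < sinSqInvDeriv x := by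
  have h : 0 < x * (1 - x) := mul_pos hx.1 (sub_pos.2 hx.2)
  have := Real.pi_pos
  unfold sinSqInvDeriv
  positivity

theorem continuousOn_sinSqInvDeriv : ContinuousOn sinSqInvDeriv (Ioo 0 1) := by
  unfold sinSqInvDeriv
  refine ContinuousOn.inv₀ (by fun_prop) fun x hx => ?_
  have h : 0 < x * (1 - x) := mul_pos hx.1 (sub_pos.2 hx.2)
  have := Real.pi_pos
  positivity

theorem measurable_sinSqInvDeriv : Measurable sinSqInvDeriv := by
  unfold sinSqInvDeriv
  fun_prop

theorem integrableOn_sinSqInvDeriv : IntegrableOn sinSqInvDeriv (Ioo 0 1) := by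
  have h := intervalIntegral.integrableOn_deriv_of_nonneg (a := 0) (b := 1)
    continuous_sinSqInv.continuousOn
    (fun x hx => (hasStrictDerivAt_sinSqInv hx).hasDerivAt) (fun x _ => sinSqInvDeriv_nonneg x)
  exact h.mono_set Ioo_subset_Ioc_self

/-- With `sin² p - sin² q = sin(p - q) sin(p + q)`, both factors are at least `(2/π)(p - q)` for `0
≤ q ≤ p ≤ π/2`, by Jordan's inequality and `sin(p - q) ≤ sin(p + q)`. The estimate is uniform up to
the endpoints, where the derivative blows up. -/
theorem abs_sinSqInv_sub_le {x y : ℝ} (hx : x ∈ Icc (0 : ℝ) 1) (hy : y ∈ Icc (0 : ℝ) 1) :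
    |sinSqInv x - sinSqInv y| ≤ √|x - y| := by
  wlog hxy : y ≤ x generalizing x y
  · rw [abs_sub_comm, abs_sub_comm x]
    exact this hy hx (le_of_not_ge hxy)
  have hm := monotone_sinSqInv hxy
  rw [abs_of_nonneg (sub_nonneg.2 hm), abs_of_nonneg (sub_nonneg.2 hxy)]
  refine Real.le_sqrt_of_sq_le ?_
  have hπ := Real.pi_pos
  set p := Real.pi * sinSqInv x with hp
  set q := Real.pi * sinSqInv y with hq
  have h1 : x - y = Real.sin (p - q) * Real.sin (p + q) := by
    rw [← sin_sq_sinSqInv hx, ← sin_sq_sinSqInv hy, ← hp, ← hq, Real.sin_sub, Real.sin_add]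
    have := Real.sin_sq_add_cos_sq p
    have := Real.sin_sq_add_cos_sq q
    have e1 : Real.cos q ^ 2 = 1 - Real.sin q ^ 2 := by linarith
    have e2 : Real.cos p ^ 2 = 1 - Real.sin p ^ 2 := by linarith
    linear_combination (-Real.sin p ^ 2) * e1 + Real.sin q ^ 2 * e2
  have hx2 := sinSqInv_mem_Icc x
  have hy2 := sinSqInv_mem_Icc y
  have hq0 : 0 ≤ q := mul_nonneg hπ.le hy2.1
  have hpq : q ≤ p := by rw [hp, hq]; gcongr
  have hp1 : p ≤ Real.pi / 2 := by rw [hp]; nlinarith [hx2.2]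
  have h2 : 2 / Real.pi * (p - q) ≤ Real.sin (p - q) :=
    Real.mul_le_sin (by linarith) (by linarith)
  have h3 : Real.sin (p - q) ≤ Real.sin (p + q) := by
    have : Real.sin (p + q) - Real.sin (p - q) = 2 * Real.sin q * Real.cos p := by
      rw [Real.sin_sub, Real.sin_add]; ring
    have h4 : 0 ≤ Real.sin q := Real.sin_nonneg_of_nonneg_of_le_pi hq0 (by linarith)
    have h5 : 0 ≤ Real.cos p := Real.cos_nonneg_of_neg_pi_div_two_le_of_le (by linarith) hp1
    have : 0 ≤ 2 * Real.sin q * Real.cos p := by positivity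
    linarith
  have h6 : 2 / Real.pi * (p - q) = 2 * (sinSqInv x - sinSqInv y) := by
    rw [hp, hq]; field_simp
  rw [h6] at h2
  have h7 : 0 ≤ sinSqInv x - sinSqInv y := sub_nonneg.2 hm
  rw [h1]
  calc (sinSqInv x - sinSqInv y) ^ 2 ≤
      (2 * (sinSqInv x - sinSqInv y)) * (2 * (sinSqInv x - sinSqInv y)) := by nlinarith
    _ ≤ Real.sin (p - q) * Real.sin (p + q) := by
      refine mul_le_mul h2 (h2.trans h3) (by positivity) (by linarith)

/-- The Jacobian of the map `(τ, t) ↦ (sinSqInv (τ t), sinSqInv (τ (1 - t)))`. -/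
def kern (τ t : ℝ) : ℝ := τ * (sinSqInvDeriv (τ * t) * sinSqInvDeriv (τ * (1 - t)))

/-- The factor `τ` cancels against the square roots. The endpoint singularity in `t` is thereby the
integrable function `sinSqInvDeriv t`, the same for all `τ`, and the remaining weight is regular as
long as `τ` stays away from `1`. -/
theorem kern_eq {τ t : ℝ} (hτ : τ ∈ Ioo (0 : ℝ) 1) (ht : t ∈ Ioo (0 : ℝ) 1) :
    kern τ t = (2 * Real.pi)⁻¹ * sinSqInvDeriv t * (√((1 - τ * t) * (1 - τ * (1 - t))))⁻¹ := by
  have h1 : 0 < 1 - t := sub_pos.2 ht.2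
  have h2 : 0 < 1 - τ * t := by nlinarith [hτ.1, hτ.2, ht.1, ht.2]
  have h3 : 0 < 1 - τ * (1 - t) := by nlinarith [hτ.1, hτ.2, ht.1, ht.2]
  have h4 := hτ.1
  have h5 := ht.1
  have hπ := Real.pi_pos
  unfold kern sinSqInvDeriv
  rw [← mul_inv, ← mul_inv, ← mul_inv]
  have e1 : √(τ * t * (1 - τ * t)) * √(τ * (1 - t) * (1 - τ * (1 - t))) =
      τ * (√(t * (1 - t)) * √((1 - τ * t) * (1 - τ * (1 - t)))) := by
    rw [← Real.sqrt_mul (by positivity), ← Real.sqrt_mul (by positivity)]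
    have : τ * t * (1 - τ * t) * (τ * (1 - t) * (1 - τ * (1 - t))) =
        τ ^ 2 * (t * (1 - t) * ((1 - τ * t) * (1 - τ * (1 - t)))) := by ring
    rw [this, Real.sqrt_mul (by positivity), Real.sqrt_sq hτ.1.le]
  have e2 : 2 * Real.pi * √(τ * t * (1 - τ * t)) *
      (2 * Real.pi * √(τ * (1 - t) * (1 - τ * (1 - t)))) =
      τ * (2 * Real.pi * (2 * Real.pi * √(t * (1 - t))) *
        √((1 - τ * t) * (1 - τ * (1 - t)))) := by
    linear_combination (2 * Real.pi) ^ 2 * e1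
  rw [e2, mul_inv, mul_inv_cancel_left₀ h4.ne']

theorem kern_nonneg {τ : ℝ} (hτ : 0 ≤ τ) (t : ℝ) : 0 ≤ kern τ t :=
  mul_nonneg hτ (mul_nonneg (sinSqInvDeriv_nonneg _) (sinSqInvDeriv_nonneg _))

theorem measurable_kern : Measurable fun p : ℝ × ℝ => kern p.1 p.2 := by
  have := measurable_sinSqInvDeriv
  unfold kern
  fun_prop

/-- The weight in `kern_eq` is bounded below when `τ` stays away from `1`. -/
theorem sqrt_weight_ge {τ t c : ℝ} (hc : 0 ≤ c) (hτ : τ ∈ Icc (0 : ℝ) (1 - c))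
    (ht : t ∈ Ioo (0 : ℝ) 1) : c ≤ √((1 - τ * t) * (1 - τ * (1 - t))) := by
  refine Real.le_sqrt_of_sq_le ?_
  have h2 : c ≤ 1 - τ * t := by nlinarith [hτ.1, hτ.2, ht.1, ht.2]
  have h3 : c ≤ 1 - τ * (1 - t) := by nlinarith [hτ.1, hτ.2, ht.1, ht.2]
  nlinarith

theorem kern_le {τ t : ℝ} (hτ : τ ∈ Ioo (0 : ℝ) 1) (ht : t ∈ Ioo (0 : ℝ) 1) :
    kern τ t ≤ (2 * Real.pi)⁻¹ * (1 - τ)⁻¹ * sinSqInvDeriv t := by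
  rw [kern_eq hτ ht, mul_right_comm]
  have h1 := sinSqInvDeriv_nonneg t
  have h2 := sqrt_weight_ge (sub_pos.2 hτ.2).le ⟨hτ.1.le, by linarith⟩ ht
  have := sub_pos.2 hτ.2
  have := Real.pi_pos
  gcongr

theorem integrableOn_kern {τ : ℝ} (hτ : τ ∈ Ioo (0 : ℝ) 1) : IntegrableOn (kern τ) (Ioo 0 1) := by
  refine (integrableOn_sinSqInvDeriv.const_mul ((2 * Real.pi)⁻¹ * (1 - τ)⁻¹)).mono'
    (measurable_kern.comp measurable_prodMk_left).aestronglyMeasurable ?_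
  filter_upwards [ae_restrict_mem measurableSet_Ioo] with t ht
  rw [Real.norm_of_nonneg (kern_nonneg hτ.1.le t)]
  exact kern_le hτ ht

/-- The weights `S`, `S'` have polynomial squares, and `S'² - S² = (τ - τ')(1 - t(1 - t)(τ + τ'))`
with the bracket of absolute value at most `1`. Since `S, S' ≥ c`, passing to `S' - S` costs one
factor `c⁻¹` and passing to reciprocals costs `c⁻²`. -/
theorem abs_kern_sub_le {τ τ' t c : ℝ} (hc : 0 < c) (hτ : τ ∈ Ioc (0 : ℝ) (1 - c))
    (hτ' : τ' ∈ Ioc (0 : ℝ) (1 - c)) (ht : t ∈ Ioo (0 : ℝ) 1) :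
    |kern τ t - kern τ' t| ≤ (2 * Real.pi)⁻¹ * (c ^ 3)⁻¹ * |τ - τ'| * sinSqInvDeriv t := by
  have m1 : τ ∈ Ioo (0 : ℝ) 1 := ⟨hτ.1, by linarith [hτ.2]⟩
  have m2 : τ' ∈ Ioo (0 : ℝ) 1 := ⟨hτ'.1, by linarith [hτ'.2]⟩
  rw [kern_eq m1 ht, kern_eq m2 ht, ← mul_sub]
  set S := √((1 - τ * t) * (1 - τ * (1 - t))) with hS
  set S' := √((1 - τ' * t) * (1 - τ' * (1 - t))) with hS'
  have g1 : c ≤ S := sqrt_weight_ge hc.le ⟨hτ.1.le, hτ.2⟩ ht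
  have g2 : c ≤ S' := sqrt_weight_ge hc.le ⟨hτ'.1.le, hτ'.2⟩ ht
  have hS0 : 0 < S := hc.trans_le g1
  have hS0' : 0 < S' := hc.trans_le g2
  have p1 : 0 < 1 - τ * t := by nlinarith [m1.1, m1.2, ht.1, ht.2]
  have p2 : 0 < 1 - τ * (1 - t) := by nlinarith [m1.1, m1.2, ht.1, ht.2]
  have p1' : 0 < 1 - τ' * t := by nlinarith [m2.1, m2.2, ht.1, ht.2]
  have p2' : 0 < 1 - τ' * (1 - t) := by nlinarith [m2.1, m2.2, ht.1, ht.2]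
  have sqS : S ^ 2 = (1 - τ * t) * (1 - τ * (1 - t)) := Real.sq_sqrt (by positivity)
  have sqS' : S' ^ 2 = (1 - τ' * t) * (1 - τ' * (1 - t)) := Real.sq_sqrt (by positivity)
  have d1 : (S' - S) * (S' + S) = (τ - τ') * (1 - (t * (1 - t)) * (τ + τ')) := by
    linear_combination sqS' - sqS
  have b0 : 0 < t * (1 - t) := mul_pos ht.1 (sub_pos.2 ht.2)
  have b1 : |1 - (t * (1 - t)) * (τ + τ')| ≤ 1 := by
    rw [abs_le]
    have h1 : t * (1 - t) ≤ 1 / 4 := by nlinarith [sq_nonneg (t - 1 / 2)]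
    have h2 : 0 < τ + τ' := add_pos m1.1 m2.1
    have h3 : τ + τ' < 2 := by linarith [m1.2, m2.2]
    constructor <;> nlinarith
  have d2 : |S' - S| * c ≤ |τ - τ'| := by
    have h1 : |S' - S| * (S' + S) ≤ |τ - τ'| := by
      rw [← abs_of_pos (add_pos hS0' hS0), ← abs_mul, d1, abs_mul]
      exact mul_le_of_le_one_right (abs_nonneg _) b1
    refine le_trans ?_ h1
    gcongr
    linarith
  have d3 : |S⁻¹ - S'⁻¹| ≤ (c ^ 3)⁻¹ * |τ - τ'| := by
    rw [inv_sub_inv hS0.ne' hS0'.ne', abs_div, abs_of_pos (mul_pos hS0 hS0'),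
      div_le_iff₀ (mul_pos hS0 hS0')]
    have h1 : c ^ 2 ≤ S * S' := by nlinarith
    have h2 : |S' - S| ≤ c⁻¹ * |τ - τ'| := by
      rw [le_inv_mul_iff₀ hc, mul_comm]; exact d2
    refine h2.trans ?_
    have h3 : c⁻¹ = (c ^ 3)⁻¹ * c ^ 2 := by field_simp
    rw [h3, mul_right_comm]
    gcongr
  have hπ := Real.pi_pos
  have hn := sinSqInvDeriv_nonneg t
  rw [abs_mul, abs_of_nonneg (by positivity : 0 ≤ (2 * Real.pi)⁻¹ * sinSqInvDeriv t)]
  calc _ ≤ (2 * Real.pi)⁻¹ * sinSqInvDeriv t * ((c ^ 3)⁻¹ * |τ - τ'|) := by gcongr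
    _ = _ := by ring

end SinSq

/-! ### Parametrization of the level curves -/

section LevelCurves

/-- `sin² (π u)` or `cos² (π u)`. -/
def fold (κ : Bool) (u : ℝ) : ℝ :=
  if κ then Real.cos (Real.pi * u) ^ 2 else Real.sin (Real.pi * u) ^ 2

/-- The affine isometries unfolding `(0, 1/2)` onto the components of `(0, 1) \ {1/2}`. -/
def sheet : Bool → Bool → ℝ → ℝ
  | false, false, x => x
  | false, true, x => 1 - x
  | true, false, x => 1 / 2 + x
  | true, true, x => 1 / 2 - x

/-- The derivative of `sheet`. -/
def sheetSign (i : Bool) : ℝ := if i then -1 else 1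

theorem sheetSign_sq (i : Bool) : sheetSign i ^ 2 = 1 := by cases i <;> simp [sheetSign]

theorem hasStrictDerivAt_sheet (κ i : Bool) (x : ℝ) :
    HasStrictDerivAt (sheet κ i) (sheetSign i) x := by
  cases κ <;> cases i <;> simp only [sheetSign]
  · exact hasStrictDerivAt_id x
  · exact (hasStrictDerivAt_id x).const_sub 1
  · exact (hasStrictDerivAt_id x).const_add (1 / 2)
  · exact (hasStrictDerivAt_id x).const_sub (1 / 2)

theorem abs_sheet_sub (κ i : Bool) (x y : ℝ) : |sheet κ i x - sheet κ i y| = |x - y| := by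
  cases κ <;> cases i <;> simp only [sheet]
  · rw [← abs_neg]; ring_nf
  · ring_nf
  · rw [← abs_neg]; ring_nf

theorem fold_sheet (κ i : Bool) (x : ℝ) : fold κ (sheet κ i x) = Real.sin (Real.pi * x) ^ 2 := by
  cases κ <;> cases i <;> simp only [fold, sheet, if_true, if_false, Bool.false_eq_true]
  · rw [mul_sub, mul_one, Real.sin_pi_sub]
  · rw [mul_add, mul_one_div, add_comm, Real.cos_add_pi_div_two, neg_sq]
  · rw [mul_sub, mul_one_div, Real.cos_pi_div_two_sub]

theorem fold_add_fold (u : ℝ) : fold false u + fold true u = 1 := by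
  simp [fold]

theorem fold_nonneg (κ : Bool) (u : ℝ) : 0 ≤ fold κ u := by
  unfold fold; split_ifs <;> positivity

theorem fold_le_one (κ : Bool) (u : ℝ) : fold κ u ≤ 1 := by
  have := fold_add_fold u
  have := fold_nonneg false u
  have := fold_nonneg true u
  cases κ <;> linarith

theorem continuous_fold (κ : Bool) : Continuous (fold κ) := by
  cases κ
  · change Continuous fun u => Real.sin (Real.pi * u) ^ 2
    fun_prop
  · change Continuous fun u => Real.cos (Real.pi * u) ^ 2
    fun_prop

/-- The inverse branches of `fold`. -/
def branch (κ i : Bool) (x : ℝ) : ℝ := sheet κ i (sinSqInv x)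

theorem fold_branch (κ i : Bool) {x : ℝ} (hx : x ∈ Icc (0 : ℝ) 1) : fold κ (branch κ i x) = x := by
  rw [branch, fold_sheet, sin_sq_sinSqInv hx]

theorem branch_mem (κ i : Bool) {x : ℝ} (hx : x ∈ Ioo (0 : ℝ) 1) :
    branch κ i x ∈ Ioo (0 : ℝ) 1 ∧ branch κ i x ≠ 1 / 2 := by
  have h := sinSqInv_mem_Ioo hx
  cases κ <;> cases i <;> simp only [branch, sheet] <;>
    exact ⟨⟨by linarith [h.1, h.2], by linarith [h.1, h.2]⟩, fun h0 => by linarith [h.1, h.2]⟩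

theorem hasStrictDerivAt_branch (κ i : Bool) {x : ℝ} (hx : x ∈ Ioo (0 : ℝ) 1) :
    HasStrictDerivAt (branch κ i) (sheetSign i * sinSqInvDeriv x) x :=
  (hasStrictDerivAt_sheet κ i _).comp x (hasStrictDerivAt_sinSqInv hx)

theorem continuous_branch (κ i : Bool) : Continuous (branch κ i) :=
  (continuous_iff_continuousAt.2 fun x =>
    (hasStrictDerivAt_sheet κ i x).hasDerivAt.continuousAt).comp continuous_sinSqInv

theorem branch_index_unique {κ i j : Bool} {x y : ℝ} (hx : x ∈ Ioo (0 : ℝ) 1)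
    (hy : y ∈ Ioo (0 : ℝ) 1) (h : branch κ i x = branch κ j y) : i = j := by
  have h1 := sinSqInv_mem_Ioo hx
  have h2 := sinSqInv_mem_Ioo hy
  cases κ <;> cases i <;> cases j <;> first | rfl | skip
  all_goals
    simp only [branch, sheet] at h
    linarith [h1.1, h1.2, h2.1, h2.2]

/-- The points `0` and `1/2` are the critical points of `fold` in the fundamental interval.
Everywhere else one of the two inverse branches recovers the coordinate; the exceptions are later
discarded as null sets. -/
theorem exists_branch_eq (κ : Bool) {u : ℝ} (hu : u ∈ Ico (0 : ℝ) 1) :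
    (u = 0 ∨ u = 1 / 2) ∨ fold κ u ∈ Ioo (0 : ℝ) 1 ∧ ∃ i, branch κ i (fold κ u) = u := by
  by_cases h0 : u = 0
  · exact Or.inl (Or.inl h0)
  by_cases h1 : u = 1 / 2
  · exact Or.inl (Or.inr h1)
  right
  have hu0 : 0 < u := lt_of_le_of_ne hu.1 (Ne.symm h0)
  obtain ⟨i, x, hx, rfl⟩ : ∃ i, ∃ x ∈ Ioo (0 : ℝ) (1 / 2), sheet κ i x = u := by
    rcases lt_or_gt_of_ne h1 with h | h
    · cases κ
      · exact ⟨false, u, ⟨hu0, h⟩, rfl⟩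
      · exact ⟨true, 1 / 2 - u, ⟨by linarith, by linarith⟩, by simp [sheet]⟩
    · cases κ
      · exact ⟨true, 1 - u, ⟨by linarith [hu.2], by linarith⟩, by simp [sheet]⟩
      · exact ⟨false, u - 1 / 2, ⟨by linarith, by linarith [hu.2]⟩, by simp [sheet]⟩
  have h2 : 0 < Real.pi * x := mul_pos Real.pi_pos hx.1
  have h3 : Real.pi * x < Real.pi / 2 := by nlinarith [Real.pi_pos, hx.2]
  have h4 : 0 < Real.sin (Real.pi * x) := Real.sin_pos_of_pos_of_lt_pi h2 (by linarith)
  have h5 : 0 < Real.cos (Real.pi * x) :=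
    Real.cos_pos_of_mem_Ioo ⟨by linarith, by linarith⟩
  rw [fold_sheet]
  refine ⟨⟨by positivity, ?_⟩, i, ?_⟩
  · nlinarith [Real.sin_sq_add_cos_sq (Real.pi * x)]
  · rw [branch, sinSqInv_sin_sq (Ioo_subset_Icc_self hx)]

/-- Countability is what makes the exceptional points of a level curve null for `μH[1]`, and the
critical level null for area. -/
theorem countable_fold_eq (κ : Bool) (s : ℝ) : {u ∈ Ico (0 : ℝ) 1 | fold κ u = s}.Countable := by
  have : {u ∈ Ico (0 : ℝ) 1 | fold κ u = s} ⊆ {0, 1 / 2} ∪ range fun i => branch κ i s := by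
    rintro u ⟨hu, rfl⟩
    rcases exists_branch_eq κ hu with h | ⟨-, i, h⟩
    · exact Or.inl h
    · exact Or.inr ⟨i, h⟩
  exact ((Set.toFinite _).union (Set.finite_range _)).countable.mono this

/-- The value of `r_m` at a point where the sum of the folded coordinates is `τ`. -/
def levelValue (m : ℝ) (κ : Bool) (τ : ℝ) : ℝ := if κ then m ^ 2 + 8 - 4 * τ else m ^ 2 + 4 * τ

theorem norm_neg_one_add_exp_sq (x : ℝ) :
    ‖-1 + Complex.exp (-2 * Real.pi * Complex.I * (x : ℂ))‖ ^ 2 = 4 * Real.sin (Real.pi * x) ^ 2 := by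
  have h : Complex.exp (-2 * Real.pi * Complex.I * (x : ℂ)) =
      (Real.cos (2 * (Real.pi * x)) : ℂ) - Real.sin (2 * (Real.pi * x)) * Complex.I := by
    have : -2 * Real.pi * Complex.I * (x : ℂ) =
        ((-(2 * (Real.pi * x)) : ℝ) : ℂ) * Complex.I := by push_cast; ring
    rw [this, Complex.exp_mul_I, ← Complex.ofReal_cos, ← Complex.ofReal_sin, Real.cos_neg,
      Real.sin_neg]
    push_cast; ring
  rw [h, ← Complex.normSq_eq_norm_sq, Complex.normSq_apply]
  simp only [Complex.add_re, Complex.neg_re, Complex.one_re, Complex.sub_re, Complex.ofReal_re,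
    Complex.mul_re, Complex.I_re, Complex.ofReal_im, Complex.I_im, Complex.add_im, Complex.neg_im,
    Complex.one_im, Complex.sub_im, Complex.mul_im]
  rw [Real.cos_two_mul, Real.sin_two_mul]
  have := Real.sin_sq_add_cos_sq (Real.pi * x)
  have e : Real.cos (Real.pi * x) ^ 2 = 1 - Real.sin (Real.pi * x) ^ 2 := by linarith
  linear_combination (4 * Real.cos (Real.pi * x) ^ 2 - 4) * e

theorem r_eq_sin (m : ℝ) (ξ : Plane) :
    r m ξ = m ^ 2 + 4 * Real.sin (Real.pi * ξ 0) ^ 2 + 4 * Real.sin (Real.pi * ξ 1) ^ 2 := by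
  rw [r, a, b, norm_neg_one_add_exp_sq, norm_neg_one_add_exp_sq]

/-- Both values of `κ` describe the same function. With `κ = false` the sums in `(0, 1)` are the
levels between the minimum and the saddle value `m² + 4`; with `κ = true` they are those between the
saddle value and the maximum `m² + 8`. -/
theorem r_eq_levelValue (m : ℝ) (κ : Bool) (ξ : Plane) :
    r m ξ = levelValue m κ (fold κ (ξ 0) + fold κ (ξ 1)) := by
  rw [r_eq_sin]
  cases κ <;> simp only [levelValue, fold, if_true, if_false, Bool.false_eq_true]
  · ring
  · rw [Real.cos_sq', Real.cos_sq']; ring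

theorem levelValue_injective (m : ℝ) (κ : Bool) : Function.Injective (levelValue m κ) := by
  intro x y h
  cases κ <;> simp only [levelValue, if_true, if_false, Bool.false_eq_true] at h <;> linarith

/-- The gradient of `r_m`. -/
def gradR (ξ : Plane) : Plane :=
  !₂[4 * Real.pi * Real.sin (2 * (Real.pi * ξ 0)), 4 * Real.pi * Real.sin (2 * (Real.pi * ξ 1))]

theorem gradient_r (m : ℝ) (ξ : Plane) : gradient (r m) ξ = gradR ξ := by
  have hr : r m = fun ξ : Plane =>
      m ^ 2 + 4 * Real.sin (Real.pi * ξ 0) ^ 2 + 4 * Real.sin (Real.pi * ξ 1) ^ 2 :=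
    funext fun ξ => r_eq_sin m ξ
  have hc : ∀ i : Fin 2, HasFDerivAt (fun ξ : Plane => 4 * Real.sin (Real.pi * ξ i) ^ 2)
      ((4 * Real.pi * Real.sin (2 * (Real.pi * ξ i))) • (EuclideanSpace.proj i : Plane →L[ℝ] ℝ))
      ξ := by
    intro i
    have h1 : HasDerivAt (fun x : ℝ => 4 * Real.sin (Real.pi * x) ^ 2)
        (4 * Real.pi * Real.sin (2 * (Real.pi * ξ i))) (ξ i) := by
      have h2 := ((((hasDerivAt_id (ξ i)).const_mul Real.pi).sin).pow 2).const_mul 4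
      refine h2.congr_deriv ?_
      rw [Real.sin_two_mul]
      simp
      ring
    exact HasDerivAt.comp_hasFDerivAt (f := fun ξ : Plane => ξ i) ξ h1
      (EuclideanSpace.proj i : Plane →L[ℝ] ℝ).hasFDerivAt
  refine HasGradientAt.gradient ?_
  rw [hasGradientAt_iff_hasFDerivAt, hr]
  have h := ((hc 0).const_add (m ^ 2)).add (hc 1)
  refine (h.congr_fderiv ?_)
  ext v
  simp [gradR, PiLp.inner_apply, Fin.sum_univ_two]
  ring

/-- The parametrized arcs of a level curve. -/
def levelCurve (κ : Bool) (p : Bool × Bool) (τ t : ℝ) : Plane :=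
  !₂[branch κ p.1 (τ * t), branch κ p.2 (τ * (1 - t))]

/-- The velocity of `levelCurve`. -/
def levelCurveDeriv (p : Bool × Bool) (τ t : ℝ) : Plane :=
  !₂[τ * (sheetSign p.1 * sinSqInvDeriv (τ * t)),
    -(τ * (sheetSign p.2 * sinSqInvDeriv (τ * (1 - t))))]

theorem mul_mem_Ioo {τ t : ℝ} (hτ : τ ∈ Ioo (0 : ℝ) 1) (ht : t ∈ Ioo (0 : ℝ) 1) :
    τ * t ∈ Ioo (0 : ℝ) 1 :=
  ⟨mul_pos hτ.1 ht.1, by nlinarith [hτ.1, hτ.2, ht.1, ht.2]⟩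

theorem one_sub_mem_Ioo {t : ℝ} (ht : t ∈ Ioo (0 : ℝ) 1) : 1 - t ∈ Ioo (0 : ℝ) 1 :=
  ⟨by linarith [ht.2], by linarith [ht.1]⟩

theorem hasStrictDerivAt_levelCurve (κ : Bool) (p : Bool × Bool) {τ t : ℝ}
    (hτ : τ ∈ Ioo (0 : ℝ) 1) (ht : t ∈ Ioo (0 : ℝ) 1) :
    HasStrictDerivAt (levelCurve κ p τ) (levelCurveDeriv p τ t) t := by
  have h1 : HasStrictDerivAt (fun t => branch κ p.1 (τ * t))
      (τ * (sheetSign p.1 * sinSqInvDeriv (τ * t))) t := by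
    have := (hasStrictDerivAt_branch κ p.1 (mul_mem_Ioo hτ ht)).comp t
      ((hasStrictDerivAt_id t).const_mul τ)
    exact this.congr_deriv (by ring)
  have h2 : HasStrictDerivAt (fun t => branch κ p.2 (τ * (1 - t)))
      (-(τ * (sheetSign p.2 * sinSqInvDeriv (τ * (1 - t))))) t := by
    have := (hasStrictDerivAt_branch κ p.2 (mul_mem_Ioo hτ (one_sub_mem_Ioo ht))).comp t
      (((hasStrictDerivAt_id t).const_sub 1).const_mul τ)
    exact this.congr_deriv (by ring)
  have h3 : HasStrictDerivAt (fun t => (![branch κ p.1 (τ * t), branch κ p.2 (τ * (1 - t))] :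
      Fin 2 → ℝ)) ![τ * (sheetSign p.1 * sinSqInvDeriv (τ * t)),
        -(τ * (sheetSign p.2 * sinSqInvDeriv (τ * (1 - t))))] t := by
    rw [hasStrictDerivAt_pi]
    intro i
    fin_cases i
    · exact h1
    · exact h2
  exact ((PiLp.continuousLinearEquiv 2 ℝ fun _ : Fin 2 => ℝ).symm.toContinuousLinearMap).hasStrictFDerivAt.comp_hasStrictDerivAt t h3

theorem continuousOn_levelCurveDeriv (p : Bool × Bool) {τ : ℝ} (hτ : τ ∈ Ioo (0 : ℝ) 1) :
    ContinuousOn (levelCurveDeriv p τ) (Ioo 0 1) := by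
  have h1 : ContinuousOn (fun t => sinSqInvDeriv (τ * t)) (Ioo 0 1) :=
    continuousOn_sinSqInvDeriv.comp (by fun_prop) fun t ht => mul_mem_Ioo hτ ht
  have h2 : ContinuousOn (fun t => sinSqInvDeriv (τ * (1 - t))) (Ioo 0 1) :=
    continuousOn_sinSqInvDeriv.comp (by fun_prop) fun t ht => mul_mem_Ioo hτ (one_sub_mem_Ioo ht)
  refine (PiLp.continuousLinearEquiv 2 ℝ fun _ : Fin 2 => ℝ).symm.continuous.comp_continuousOn
    (continuousOn_pi.2 fun i => ?_)
  fin_cases i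
  · exact continuousOn_const.mul (continuousOn_const.mul h1)
  · exact (continuousOn_const.mul (continuousOn_const.mul h2)).neg

theorem fold_levelCurve_zero (κ : Bool) (p : Bool × Bool) {τ t : ℝ} (hτ : τ ∈ Ioo (0 : ℝ) 1)
    (ht : t ∈ Ioo (0 : ℝ) 1) : fold κ (levelCurve κ p τ t 0) = τ * t :=
  fold_branch κ p.1 (Ioo_subset_Icc_self (mul_mem_Ioo hτ ht))

theorem fold_levelCurve_one (κ : Bool) (p : Bool × Bool) {τ t : ℝ} (hτ : τ ∈ Ioo (0 : ℝ) 1)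
    (ht : t ∈ Ioo (0 : ℝ) 1) : fold κ (levelCurve κ p τ t 1) = τ * (1 - t) :=
  fold_branch κ p.2 (Ioo_subset_Icc_self (mul_mem_Ioo hτ (one_sub_mem_Ioo ht)))

theorem r_levelCurve (m : ℝ) (κ : Bool) (p : Bool × Bool) {τ t : ℝ} (hτ : τ ∈ Ioo (0 : ℝ) 1)
    (ht : t ∈ Ioo (0 : ℝ) 1) : r m (levelCurve κ p τ t) = levelValue m κ τ := by
  rw [r_eq_levelValue m κ, fold_levelCurve_zero κ p hτ ht, fold_levelCurve_one κ p hτ ht]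
  congr 1
  ring

theorem injOn_levelCurve (κ : Bool) (p : Bool × Bool) {τ : ℝ} (hτ : τ ∈ Ioo (0 : ℝ) 1) :
    InjOn (levelCurve κ p τ) (Ioo 0 1) := fun s hs t ht h => by
  have h1 := fold_levelCurve_zero κ p hτ hs
  rw [h, fold_levelCurve_zero κ p hτ ht] at h1
  exact (mul_left_cancel₀ hτ.1.ne' h1).symm

theorem abs_sin_branch (κ i : Bool) {x : ℝ} (hx : x ∈ Ioo (0 : ℝ) 1) :
    (4 * Real.pi * Real.sin (2 * (Real.pi * branch κ i x))) ^ 2 =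
      (4 * (sinSqInvDeriv x)⁻¹) ^ 2 := by
  have h1 : Real.sin (2 * (Real.pi * branch κ i x)) ^ 2 =
      4 * (fold false (branch κ i x) * fold true (branch κ i x)) := by
    rw [Real.sin_two_mul]; simp only [fold, if_true, if_false, Bool.false_eq_true]; ring
  have h2 : fold false (branch κ i x) * fold true (branch κ i x) = x * (1 - x) := by
    have h3 := fold_add_fold (branch κ i x)
    have h4 := fold_branch κ i (Ioo_subset_Icc_self hx)
    cases κ
    · have h5 : fold true (branch false i x) = 1 - x := by linarith
      rw [h4, h5]
    · have h5 : fold false (branch true i x) = 1 - x := by linarith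
      rw [h4, h5, mul_comm]
  have h5 : 0 ≤ x * (1 - x) := mul_nonneg hx.1.le (sub_nonneg.2 hx.2.le)
  rw [mul_pow, h1, h2, sinSqInvDeriv, inv_inv, mul_pow 4 (2 * Real.pi * _),
    mul_pow (2 * Real.pi), Real.sq_sqrt h5]
  ring

/-- Up to signs the velocity is `(τP, τQ)` and the gradient is `(4/P, 4/Q)`. Both norms contain
`√(P² + Q²)`, which cancels and leaves `τPQ/4`. -/
theorem norm_levelCurveDeriv_div (κ : Bool) (p : Bool × Bool) {τ t : ℝ}
    (hτ : τ ∈ Ioo (0 : ℝ) 1) (ht : t ∈ Ioo (0 : ℝ) 1) :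
    ‖levelCurveDeriv p τ t‖ * ‖gradR (levelCurve κ p τ t)‖⁻¹ = kern τ t / 4 := by
  have hx := mul_mem_Ioo hτ ht
  have hy := mul_mem_Ioo hτ (one_sub_mem_Ioo ht)
  have hp := sinSqInvDeriv_pos hx
  have hq := sinSqInvDeriv_pos hy
  set P := sinSqInvDeriv (τ * t) with hP
  set Q := sinSqInvDeriv (τ * (1 - t)) with hQ
  have e1 : ‖levelCurveDeriv p τ t‖ = τ * √(P ^ 2 + Q ^ 2) := by
    rw [EuclideanSpace.norm_eq, Fin.sum_univ_two]
    simp only [levelCurveDeriv, PiLp.toLp_apply, Matrix.cons_val_zero, Matrix.cons_val_one,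
      Real.norm_eq_abs, sq_abs, neg_sq, mul_pow, sheetSign_sq, one_mul]
    rw [← mul_add, Real.sqrt_mul (by positivity), Real.sqrt_sq hτ.1.le]
  have e2 : ‖gradR (levelCurve κ p τ t)‖ = 4 * (√(P ^ 2 + Q ^ 2) / (P * Q)) := by
    rw [EuclideanSpace.norm_eq, Fin.sum_univ_two]
    simp only [gradR, levelCurve, PiLp.toLp_apply, Matrix.cons_val_zero, Matrix.cons_val_one,
      Real.norm_eq_abs, sq_abs]
    rw [abs_sin_branch κ p.1 hx, abs_sin_branch κ p.2 hy, ← hP, ← hQ]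
    have : (4 * P⁻¹) ^ 2 + (4 * Q⁻¹) ^ 2 = (4 * (P * Q)⁻¹) ^ 2 * (P ^ 2 + Q ^ 2) := by
      field_simp
      ring
    rw [this, Real.sqrt_mul (by positivity), Real.sqrt_sq (by positivity)]
    field_simp
  have h3 : 0 < √(P ^ 2 + Q ^ 2) := by positivity
  rw [e1, e2, kern, ← hP, ← hQ]
  field_simp

end LevelCurves

/-! ### Integrals over level curves -/

section LevelIntegrals

theorem plane_ext {ξ η : Plane} (h0 : ξ 0 = η 0) (h1 : ξ 1 = η 1) : ξ = η := by
  ext i; fin_cases i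
  · exact h0
  · exact h1

theorem exists_levelCurve_eq {κ : Bool} {ξ : Plane} (h0 : ξ 0 ∈ Ico (0 : ℝ) 1)
    (h1 : ξ 1 ∈ Ico (0 : ℝ) 1) (n0 : ¬(ξ 0 = 0 ∨ ξ 0 = 1 / 2)) (n1 : ¬(ξ 1 = 0 ∨ ξ 1 = 1 / 2)) :
    ∃ p : Bool × Bool, ∃ t ∈ Ioo (0 : ℝ) 1,
      levelCurve κ p (fold κ (ξ 0) + fold κ (ξ 1)) t = ξ := by
  obtain ⟨f0, i, hi⟩ := (exists_branch_eq κ h0).resolve_left n0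
  obtain ⟨f1, j, hj⟩ := (exists_branch_eq κ h1).resolve_left n1
  have hs : 0 < fold κ (ξ 0) + fold κ (ξ 1) := add_pos f0.1 f1.1
  refine ⟨(i, j), fold κ (ξ 0) / (fold κ (ξ 0) + fold κ (ξ 1)), ⟨div_pos f0.1 hs, ?_⟩, ?_⟩
  · rw [div_lt_one hs]; linarith [f1.1]
  · refine plane_ext ?_ ?_
    · change branch κ i _ = _
      rw [mul_div_cancel₀ _ hs.ne', hi]
    · change branch κ j _ = _
      rw [mul_one_sub, mul_div_cancel₀ _ hs.ne', add_sub_cancel_left, hj]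

theorem levelCurve_index_unique {κ : Bool} {p q : Bool × Bool} {τ τ' s t : ℝ}
    (hτ : τ ∈ Ioo (0 : ℝ) 1) (hτ' : τ' ∈ Ioo (0 : ℝ) 1) (hs : s ∈ Ioo (0 : ℝ) 1)
    (ht : t ∈ Ioo (0 : ℝ) 1) (h : levelCurve κ p τ s = levelCurve κ q τ' t) : p = q := by
  have h0 : branch κ p.1 (τ * s) = branch κ q.1 (τ' * t) := congrArg (fun ξ : Plane => ξ 0) h
  have h1 : branch κ p.2 (τ * (1 - s)) = branch κ q.2 (τ' * (1 - t)) :=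
    congrArg (fun ξ : Plane => ξ 1) h
  exact Prod.ext (branch_index_unique (mul_mem_Ioo hτ hs) (mul_mem_Ioo hτ' ht) h0)
    (branch_index_unique (mul_mem_Ioo hτ (one_sub_mem_Ioo hs))
      (mul_mem_Ioo hτ' (one_sub_mem_Ioo ht)) h1)

/-- The arcs miss only points with a coordinate equal to `0` or `1/2`. Fixing one such coordinate
leaves countably many values for the other, so the missing set is null for one-dimensional Hausdorff
measure. -/
theorem levelSet_ae_eq (m : ℝ) (κ : Bool) {τ : ℝ} (hτ : τ ∈ Ioo (0 : ℝ) 1) :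
    {ξ : Plane | (∀ i, ξ i ∈ Ico (0 : ℝ) 1) ∧ r m ξ = levelValue m κ τ}
      =ᵐ[Measure.hausdorffMeasure 1] ⋃ p, levelCurve κ p τ '' Ioo 0 1 := by
  have hna := Measure.nullSingletonClass_hausdorff Plane one_pos
  have hsub : (⋃ p, levelCurve κ p τ '' Ioo 0 1) ⊆
      {ξ : Plane | (∀ i, ξ i ∈ Ico (0 : ℝ) 1) ∧ r m ξ = levelValue m κ τ} := by
    refine iUnion_subset fun p => ?_
    rintro _ ⟨t, ht, rfl⟩
    refine ⟨fun i => ?_, r_levelCurve m κ p hτ ht⟩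
    fin_cases i
    · exact Ioo_subset_Ico_self (branch_mem κ p.1 (mul_mem_Ioo hτ ht)).1
    · exact Ioo_subset_Ico_self (branch_mem κ p.2 (mul_mem_Ioo hτ (one_sub_mem_Ioo ht))).1
  set B : ℝ → Set ℝ := fun c => {u ∈ Ico (0 : ℝ) 1 | fold κ u = τ - fold κ c} with hB
  have hcount : ((⋃ c ∈ ({0, 1 / 2} : Set ℝ), (fun u : ℝ => (!₂[c, u] : Plane)) '' B c) ∪
      ⋃ c ∈ ({0, 1 / 2} : Set ℝ), (fun u : ℝ => (!₂[u, c] : Plane)) '' B c).Countable := by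
    have hf : ({0, 1 / 2} : Set ℝ).Countable := (Set.toFinite _).countable
    exact (hf.biUnion fun c _ => (countable_fold_eq κ _).image _).union
      (hf.biUnion fun c _ => (countable_fold_eq κ _).image _)
  filter_upwards [compl_mem_ae_iff.2 (hcount.measure_zero (Measure.hausdorffMeasure 1))]
    with ξ hξ
  refine propext ⟨fun h => ?_, fun h => hsub h⟩
  obtain ⟨hD, hr⟩ := h
  rw [r_eq_levelValue m κ] at hr
  have hsum := levelValue_injective m κ hr
  have n0 : ¬(ξ 0 = 0 ∨ ξ 0 = 1 / 2) := fun h0 => hξ (Or.inl (mem_biUnion (x := ξ 0) h0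
    ⟨ξ 1, ⟨hD 1, by linarith⟩, plane_ext rfl rfl⟩))
  have n1 : ¬(ξ 1 = 0 ∨ ξ 1 = 1 / 2) := fun h0 => hξ (Or.inr (mem_biUnion (x := ξ 1) h0
    ⟨ξ 0, ⟨hD 0, by linarith⟩, plane_ext rfl rfl⟩))
  obtain ⟨p, t, ht, h⟩ := exists_levelCurve_eq (κ := κ) (hD 0) (hD 1) n0 n1
  rw [hsum] at h
  exact mem_iUnion.2 ⟨p, t, ht, h⟩

theorem curveMeasure_levelValue (m : ℝ) (κ : Bool) {τ : ℝ} (hτ : τ ∈ Ioo (0 : ℝ) 1) :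
    curveMeasure m (levelValue m κ τ) =
      (Measure.hausdorffMeasure 1).restrict (⋃ p, levelCurve κ p τ '' Ioo 0 1) :=
  Measure.restrict_congr_set (levelSet_ae_eq m κ hτ)

theorem r_mem_Icc (m : ℝ) (ξ : Plane) : r m ξ ∈ Icc (m ^ 2) (m ^ 2 + 8) := by
  rw [r_eq_levelValue m false]
  have h1 := fold_nonneg false (ξ 0)
  have h2 := fold_nonneg false (ξ 1)
  have h3 := fold_le_one false (ξ 0)
  have h4 := fold_le_one false (ξ 1)
  simp only [levelValue, Bool.false_eq_true, if_false]
  exact ⟨by linarith, by linarith⟩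

theorem curveMeasure_eq_zero {m ρ : ℝ} (hρ : ρ ∉ Icc (m ^ 2) (m ^ 2 + 8)) :
    curveMeasure m ρ = 0 := by
  rw [curveMeasure, Measure.restrict_eq_zero]
  exact measure_mono_null (t := ∅) (fun ξ hξ => absurd (hξ.2 ▸ r_mem_Icc m ξ) hρ) measure_empty

variable {E : Type*} [NormedAddCommGroup E] [NormedSpace ℂ E]

/-- The integral of `F / |∇ r_m|` over a level curve. -/
def levelInt (m : ℝ) (F : Plane → E) (ρ : ℝ) : E :=
  ∫ ξ, ((‖gradient (r m) ξ‖⁻¹ : ℝ) : ℂ) • F ξ ∂curveMeasure m ρ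

/-- The sum of a function over the points of the four arcs with the same parameter. -/
def arcSum {E : Type*} [NormedAddCommGroup E] (F : Plane → E) (κ : Bool)
    (τ t : ℝ) : E := ∑ p : Bool × Bool, F (levelCurve κ p τ t)

theorem continuous_levelCurve (κ : Bool) (p : Bool × Bool) :
    Continuous fun x : ℝ × ℝ => levelCurve κ p x.1 x.2 := by
  have h := continuous_branch κ
  refine (PiLp.continuousLinearEquiv 2 ℝ fun _ : Fin 2 => ℝ).symm.continuous.comp
    (continuous_pi fun i => ?_)
  fin_cases i
  · exact (h p.1).comp (by fun_prop)
  · exact (h p.2).comp (by fun_prop)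

theorem norm_arcSum_le {E : Type*} [NormedAddCommGroup E] {F : Plane → E} {C : ℝ} (hC : ∀ ξ, ‖F ξ‖ ≤ C) (κ : Bool) (τ t : ℝ) :
    ‖arcSum F κ τ t‖ ≤ 4 * C := by
  refine (norm_sum_le_of_le _ fun p _ => hC _).trans ?_
  simp

theorem integrableOn_arc {F : Plane → E} (hF : Continuous F) {C : ℝ} (hC : ∀ ξ, ‖F ξ‖ ≤ C)
    (κ : Bool) (p : Bool × Bool) {τ : ℝ} (hτ : τ ∈ Ioo (0 : ℝ) 1) :
    IntegrableOn (fun t => kern τ t • F (levelCurve κ p τ t)) (Ioo 0 1) := by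
  have h1 : Continuous fun t : ℝ => (τ, t) := by fun_prop
  have h2 := (continuous_levelCurve κ p).comp h1
  change Continuous (fun t => levelCurve κ p τ t) at h2
  have hc : Continuous fun t => F (levelCurve κ p τ t) := hF.comp h2
  refine ((integrableOn_kern hτ).norm.const_mul C).mono' ((integrableOn_kern hτ).1.smul
    hc.aestronglyMeasurable) (Eventually.of_forall fun t => ?_)
  rw [norm_smul, mul_comm]
  gcongr
  exact hC _

/-- The arcs are pairwise disjoint and injectively parametrized, and on each of them the length
element divided by `|∇r_m|` is `kern τ t / 4` times `dt`. Integrability of `kern τ` gives absolute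
convergence for bounded continuous `F`. -/
theorem levelInt_levelValue [CompleteSpace E] {F : Plane → E} (hF : Continuous F) {C : ℝ}
    (hC : ∀ ξ, ‖F ξ‖ ≤ C) (m : ℝ) (κ : Bool) {τ : ℝ} (hτ : τ ∈ Ioo (0 : ℝ) 1) :
    Integrable (fun ξ => ((‖gradient (r m) ξ‖⁻¹ : ℝ) : ℂ) • F ξ)
      (curveMeasure m (levelValue m κ τ)) ∧
    levelInt m F (levelValue m κ τ) = (1 / 4 : ℝ) • ∫ t in Ioo (0 : ℝ) 1, kern τ t • arcSum F κ τ t := by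
  have hγ := fun p t (ht : t ∈ Ioo (0 : ℝ) 1) => hasStrictDerivAt_levelCurve κ p hτ ht
  have hc := fun p => continuousOn_levelCurveDeriv p hτ
  have hi := fun p => injOn_levelCurve κ p hτ
  have hpt : ∀ p, ∀ t ∈ Ioo (0 : ℝ) 1, ‖levelCurveDeriv p τ t‖ •
      (((‖gradient (r m) (levelCurve κ p τ t)‖⁻¹ : ℝ) : ℂ) • F (levelCurve κ p τ t)) =
      (1 / 4 : ℝ) • (kern τ t • F (levelCurve κ p τ t)) := by
    intro p t ht
    rw [Complex.coe_smul, smul_smul, gradient_r, norm_levelCurveDeriv_div κ p hτ ht, smul_smul]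
    congr 1
    ring
  have hint : ∀ p, IntegrableOn (fun ξ => ((‖gradient (r m) ξ‖⁻¹ : ℝ) : ℂ) • F ξ)
      (levelCurve κ p τ '' Ioo 0 1) (Measure.hausdorffMeasure 1) := by
    intro p
    rw [integrableOn_curve_iff (hγ p) (hc p) (hi p)]
    refine IntegrableOn.congr_fun ((integrableOn_arc hF hC κ p hτ).smul (1 / 4 : ℝ))
      (fun t ht => ?_) measurableSet_Ioo
    exact (hpt p t ht).symm
  refine ⟨?_, ?_⟩
  · rw [curveMeasure_levelValue m κ hτ]
    exact integrableOn_finite_iUnion.2 hint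
  · rw [levelInt, curveMeasure_levelValue m κ hτ, integral_iUnion_fintype ?_ ?_ hint]
    · have h1 : ∀ p, ∫ ξ in levelCurve κ p τ '' Ioo 0 1,
          ((‖gradient (r m) ξ‖⁻¹ : ℝ) : ℂ) • F ξ ∂(Measure.hausdorffMeasure 1) =
          (1 / 4 : ℝ) • ∫ t in Ioo (0 : ℝ) 1, kern τ t • F (levelCurve κ p τ t) := by
        intro p
        rw [setIntegral_curve (hγ p) (hc p) (hi p), setIntegral_congr_fun measurableSet_Ioo (hpt p),
          integral_smul]
      simp only [h1, arcSum, Finset.smul_sum]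
      rw [integral_finsetSum _ fun p _ => integrableOn_arc hF hC κ p hτ, Finset.smul_sum]
    · intro p
      rw [image_eq_range]
      exact (measurableEmbedding_curve (hγ p) (hi p)).measurableSet_range
    · intro p q hpq
      refine Set.disjoint_left.2 ?_
      rintro _ ⟨s, hs, rfl⟩ ⟨t, ht, h⟩
      exact hpq (levelCurve_index_unique hτ hτ hs ht h.symm)

/-- Bounded and Hölder continuous functions on the plane. -/
def BddHolder {E : Type*} [NormedAddCommGroup E] (α : ℝ) (F : Plane → E) : Prop :=
  ∃ C, 0 ≤ C ∧ (∀ ξ, ‖F ξ‖ ≤ C) ∧ ∀ ξ η, ‖F ξ - F η‖ ≤ C * ‖ξ - η‖ ^ α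

theorem BddHolder.continuous {E : Type*} [NormedAddCommGroup E] {α : ℝ} (hα : 0 < α) {F : Plane → E} (hF : BddHolder α F) :
    Continuous F := by
  obtain ⟨C, -, -, hC⟩ := hF
  refine continuous_iff_continuousAt.2 fun ξ => ?_
  rw [ContinuousAt, tendsto_iff_norm_sub_tendsto_zero]
  have h : Tendsto (fun η : Plane => C * ‖η - ξ‖ ^ α) (𝓝 ξ) (𝓝 (C * ‖ξ - ξ‖ ^ α)) :=
    Continuous.tendsto (continuous_const.mul ((continuous_id.sub continuous_const).norm.rpow_const
      fun _ => Or.inr hα.le)) ξ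
  rw [sub_self, norm_zero, Real.zero_rpow hα.ne', mul_zero] at h
  exact squeeze_zero (fun _ => norm_nonneg _) (fun η => hC η ξ) h

/-- The two coordinates move by at most the square roots of `|τ - τ'| t` and `|τ - τ'| (1 - t)`, so
the squares add up to at most `|τ - τ'|`. -/
theorem norm_levelCurve_sub_le (κ : Bool) (p : Bool × Bool) {τ τ' t : ℝ} (hτ : τ ∈ Ioo (0 : ℝ) 1)
    (hτ' : τ' ∈ Ioo (0 : ℝ) 1) (ht : t ∈ Ioo (0 : ℝ) 1) :
    ‖levelCurve κ p τ t - levelCurve κ p τ' t‖ ≤ √|τ - τ'| := by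
  rw [EuclideanSpace.norm_eq, Fin.sum_univ_two]
  refine Real.sqrt_le_sqrt ?_
  have h : ∀ i : Bool, ∀ s ∈ Ioo (0 : ℝ) 1,
      |branch κ i (τ * s) - branch κ i (τ' * s)| ^ 2 ≤ |τ - τ'| * s := by
    intro i s hs
    rw [branch, branch, abs_sheet_sub]
    have h1 := abs_sinSqInv_sub_le (Ioo_subset_Icc_self (mul_mem_Ioo hτ hs))
      (Ioo_subset_Icc_self (mul_mem_Ioo hτ' hs))
    have h2 := pow_le_pow_left₀ (abs_nonneg _) h1 2
    rw [Real.sq_sqrt (abs_nonneg _), ← sub_mul, abs_mul, abs_of_pos hs.1] at h2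
    exact h2
  have h1 := h p.1 t ht
  have h2 := h p.2 (1 - t) (one_sub_mem_Ioo ht)
  calc _ ≤ |τ - τ'| * t + |τ - τ'| * (1 - t) := add_le_add h1 h2
    _ = _ := by ring

/-- Hölder continuity of the level curve integrals at regular values. -/
theorem levelInt_holder [CompleteSpace E] {α : ℝ} (hα : 0 < α) (hα1 : α ≤ 1) {F : Plane → E}
    (hF : BddHolder α F) (m : ℝ) (κ : Bool) {τ₀ : ℝ} (hτ₀ : τ₀ ∈ Ioo (0 : ℝ) 1) :
    ∃ C, ∃ η > 0, ∀ τ, |τ - τ₀| < η → τ ∈ Ioo (0 : ℝ) 1 ∧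
      ‖levelInt m F (levelValue m κ τ) - levelInt m F (levelValue m κ τ₀)‖ ≤
        C * |τ - τ₀| ^ (α / 2) := by
  have hcont := hF.continuous hα
  obtain ⟨C, hC0, hC, hH⟩ := hF
  -- Every `τ` within `c` of `τ₀` satisfies `τ ≤ 1 - c`, where the estimates for `kern` are uniform;
  -- the other constraint `|τ - τ₀| < τ₀` keeps `τ` positive.
  set c := (1 - τ₀) / 2 with hc
  have hc0 : 0 < c := by rw [hc]; linarith [hτ₀.2]
  have hc1 : c < 1 := by rw [hc]; linarith [hτ₀.1]
  set A := (2 * Real.pi)⁻¹ * (c ^ 3)⁻¹ with hA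
  set B := (2 * Real.pi)⁻¹ * (1 - τ₀)⁻¹ with hB
  have hπ := Real.pi_pos
  have hB0 : 0 ≤ B := mul_nonneg (by positivity) (inv_nonneg.2 (by linarith [hτ₀.2]))
  have hA0 : 0 ≤ A := by positivity
  set K := A * (4 * C) + B * (4 * C) with hK
  refine ⟨(1 / 4) * (K * ∫ t in Ioo (0 : ℝ) 1, sinSqInvDeriv t), min c τ₀,
    lt_min hc0 hτ₀.1, fun τ hτ => ?_⟩
  have hτ1 : |τ - τ₀| < c := hτ.trans_le (min_le_left _ _)
  have hτ2 : |τ - τ₀| < τ₀ := hτ.trans_le (min_le_right _ _)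
  have hlt := abs_lt.1 hτ1
  have m0 : τ₀ ∈ Ioc (0 : ℝ) (1 - c) := ⟨hτ₀.1, by linarith [hc]⟩
  have m1 : τ ∈ Ioc (0 : ℝ) (1 - c) := ⟨by linarith [(abs_lt.1 hτ2).1], by linarith [hlt.2, hc]⟩
  have m2 : τ ∈ Ioo (0 : ℝ) 1 := ⟨m1.1, by linarith [m1.2]⟩
  refine ⟨m2, ?_⟩
  set x := |τ - τ₀| with hx
  have hx0 : 0 ≤ x := abs_nonneg _
  have hx1 : x ≤ x ^ (α / 2) := by
    rcases hx0.eq_or_lt with h | h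
    · rw [← h, Real.zero_rpow (by positivity)]
    · calc x = x ^ (1 : ℝ) := (Real.rpow_one x).symm
        _ ≤ _ := Real.rpow_le_rpow_of_exponent_ge h (by linarith) (by linarith)
  have hi : ∀ σ ∈ Ioo (0 : ℝ) 1, IntegrableOn (fun t => kern σ t • arcSum F κ σ t) (Ioo 0 1) := by
    intro σ hσ
    simp only [arcSum, Finset.smul_sum]
    exact integrable_finsetSum _ fun p _ => integrableOn_arc hcont hC κ p hσ
  rw [(levelInt_levelValue hcont hC m κ m2).2, (levelInt_levelValue hcont hC m κ hτ₀).2,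
    ← smul_sub, ← integral_sub (hi τ m2) (hi τ₀ hτ₀), norm_smul, Real.norm_of_nonneg (by norm_num),
    mul_assoc (1 / 4 : ℝ)]
  refine mul_le_mul_of_nonneg_left ?_ (by norm_num)
  have hb : ∀ t ∈ Ioo (0 : ℝ) 1, ‖kern τ t • arcSum F κ τ t - kern τ₀ t • arcSum F κ τ₀ t‖ ≤
      K * x ^ (α / 2) * sinSqInvDeriv t := by
    intro t ht
    have hn := sinSqInvDeriv_nonneg t
    -- The kernel and the points are varied separately. The kernel is Lipschitz in `τ`; the points
    -- move by `√|τ - τ₀|`, which halves the exponent `α` of `F`.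
    have e : kern τ t • arcSum F κ τ t - kern τ₀ t • arcSum F κ τ₀ t =
        (kern τ t - kern τ₀ t) • arcSum F κ τ t +
          kern τ₀ t • (arcSum F κ τ t - arcSum F κ τ₀ t) := by
      rw [sub_smul, smul_sub]; abel
    have h1 : ‖arcSum F κ τ t - arcSum F κ τ₀ t‖ ≤ 4 * C * x ^ (α / 2) := by
      rw [arcSum, arcSum, ← Finset.sum_sub_distrib]
      refine (norm_sum_le_of_le (n := fun _ => C * x ^ (α / 2)) _ fun p _ => ?_).trans ?_
      · refine (hH _ _).trans (mul_le_mul_of_nonneg_left ?_ hC0)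
        have h2 := Real.rpow_le_rpow (norm_nonneg _) (norm_levelCurve_sub_le κ p m2 hτ₀ ht) hα.le
        refine h2.trans_eq ?_
        rw [Real.sqrt_eq_rpow, ← Real.rpow_mul (abs_nonneg _)]
        congr 1
        ring
      · simp only [Finset.sum_const, Finset.card_univ, Fintype.card_prod, Fintype.card_bool,
          nsmul_eq_mul]
        norm_num
        linarith
    have h3 := abs_kern_sub_le hc0 m1 m0 ht
    have h4 := kern_le hτ₀ ht
    have h5 := norm_arcSum_le hC κ τ t
    rw [e]
    refine (norm_add_le _ _).trans ?_
    rw [norm_smul, norm_smul, Real.norm_eq_abs, Real.norm_of_nonneg (kern_nonneg hτ₀.1.le t)]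
    calc _ ≤ (A * x * sinSqInvDeriv t) * (4 * C) +
          (B * sinSqInvDeriv t) * (4 * C * x ^ (α / 2)) := by gcongr
      _ ≤ (A * x ^ (α / 2) * sinSqInvDeriv t) * (4 * C) +
          (B * sinSqInvDeriv t) * (4 * C * x ^ (α / 2)) := by gcongr
      _ = _ := by rw [hK]; ring
  refine (norm_integral_le_of_norm_le (integrableOn_sinSqInvDeriv.const_mul _)
    ((ae_restrict_mem measurableSet_Ioo).mono hb)).trans_eq ?_
  rw [integral_const_mul]
  ring

end LevelIntegrals

/-! ### The coarea formula for `r_m` -/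

section Coarea

/-- The point of the plane with the given coordinates. -/
def toPlane (x : ℝ × ℝ) : Plane := !₂[x.1, x.2]

theorem continuous_toPlane : Continuous toPlane := by
  refine (PiLp.continuousLinearEquiv 2 ℝ fun _ : Fin 2 => ℝ).symm.continuous.comp
    (continuous_pi fun i => ?_)
  fin_cases i
  · exact continuous_fst
  · exact continuous_snd

/-- The fundamental square of the torus. -/
def unitSquare : Set (ℝ × ℝ) := Ico 0 1 ×ˢ Ico 0 1

/-- The set of parameters of the charts. -/
def chartSource : Set (ℝ × ℝ) := Ioo 0 1 ×ˢ Ioo 0 1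

theorem measurableSet_chartSource : MeasurableSet chartSource :=
  measurableSet_Ioo.prod measurableSet_Ioo

/-- The charts of the torus adapted to the level curves. -/
def chart (κ : Bool) (p : Bool × Bool) (x : ℝ × ℝ) : ℝ × ℝ :=
  (branch κ p.1 (x.1 * x.2), branch κ p.2 (x.1 * (1 - x.2)))

theorem toPlane_chart (κ : Bool) (p : Bool × Bool) (x : ℝ × ℝ) :
    toPlane (chart κ p x) = levelCurve κ p x.1 x.2 := rfl

/-- The derivative of `chart`. -/
def chartDeriv (p : Bool × Bool) (x : ℝ × ℝ) : ℝ × ℝ →L[ℝ] ℝ × ℝ :=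
  (Matrix.toLin (.finTwoProd ℝ) (.finTwoProd ℝ)
    !![sheetSign p.1 * sinSqInvDeriv (x.1 * x.2) * x.2,
      sheetSign p.1 * sinSqInvDeriv (x.1 * x.2) * x.1;
      sheetSign p.2 * sinSqInvDeriv (x.1 * (1 - x.2)) * (1 - x.2),
      -(sheetSign p.2 * sinSqInvDeriv (x.1 * (1 - x.2)) * x.1)]).toContinuousLinearMap

theorem hasFDerivAt_chart (κ : Bool) (p : Bool × Bool) {x : ℝ × ℝ} (hx : x ∈ chartSource) :
    HasFDerivAt (chart κ p) (chartDeriv p x) x := by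
  have h1 := (hasStrictDerivAt_branch κ p.1 (mul_mem_Ioo hx.1 hx.2)).hasDerivAt.comp_hasFDerivAt x
    ((hasFDerivAt_fst (𝕜 := ℝ) (p := x)).mul (hasFDerivAt_snd (𝕜 := ℝ) (p := x)))
  have h2 := (hasStrictDerivAt_branch κ p.2
    (mul_mem_Ioo hx.1 (one_sub_mem_Ioo hx.2))).hasDerivAt.comp_hasFDerivAt x
    ((hasFDerivAt_fst (𝕜 := ℝ) (p := x)).mul ((hasFDerivAt_snd (𝕜 := ℝ) (p := x)).const_sub 1))
  unfold chartDeriv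
  rw [Matrix.toLin_finTwoProd_toContinuousLinearMap]
  refine (h1.prodMk h2).congr_fderiv ?_
  congr 1 <;> ext <;> simp

theorem abs_det_chartDeriv (p : Bool × Bool) {x : ℝ × ℝ} (hx : x ∈ chartSource) :
    |(chartDeriv p x).det| = kern x.1 x.2 := by
  have h : (chartDeriv p x).det = -(sheetSign p.1 * sheetSign p.2) * kern x.1 x.2 := by
    unfold chartDeriv kern
    simp only [LinearMap.det_toContinuousLinearMap, LinearMap.det_toLin, Matrix.det_fin_two_of]
    ring
  have h2 : ∀ i, |sheetSign i| = 1 := fun i => by cases i <;> simp [sheetSign]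
  rw [h, abs_mul, abs_neg, abs_mul, h2, h2, one_mul, one_mul,
    abs_of_nonneg (kern_nonneg hx.1.1.le _)]

theorem injOn_chart (κ : Bool) (p : Bool × Bool) : InjOn (chart κ p) chartSource := by
  intro x hx y hy h
  have h' : levelCurve κ p x.1 x.2 = levelCurve κ p y.1 y.2 := by
    rw [← toPlane_chart, ← toPlane_chart, h]
  have e0 := fold_levelCurve_zero κ p hx.1 hx.2
  have e1 := fold_levelCurve_one κ p hx.1 hx.2
  rw [h', fold_levelCurve_zero κ p hy.1 hy.2] at e0
  rw [h', fold_levelCurve_one κ p hy.1 hy.2] at e1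
  have e2 : x.1 = y.1 := by linarith
  refine Prod.ext e2 ?_
  rw [e2] at e0
  exact (mul_left_cancel₀ hy.1.1.ne' e0).symm

theorem fold_sum_chart (κ : Bool) (p : Bool × Bool) {x : ℝ × ℝ} (hx : x ∈ chartSource) :
    fold κ (chart κ p x).1 + fold κ (chart κ p x).2 = x.1 := by
  have e0 := fold_levelCurve_zero κ p hx.1 hx.2
  have e1 := fold_levelCurve_one κ p hx.1 hx.2
  change fold κ (levelCurve κ p x.1 x.2 0) + fold κ (levelCurve κ p x.1 x.2 1) = x.1
  rw [e0, e1]; ring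

/-- For different `κ`, a common point would have its sum of `sin²` and its sum of `cos²` both below
`1`, although together they make `2`. For equal `κ` the branches determine the index. -/
theorem chart_disjoint : Pairwise (Function.onFun Disjoint fun q : Bool × Bool × Bool =>
    chart q.1 q.2 '' chartSource) := by
  rintro ⟨κ, p⟩ ⟨κ', p'⟩ hne
  refine Set.disjoint_left.2 ?_
  rintro _ ⟨x, hx, rfl⟩ ⟨y, hy, h⟩
  have s1 := fold_sum_chart κ p hx
  have s2 := fold_sum_chart κ' p' hy
  simp only at h
  rw [h] at s2
  have f1 := fold_add_fold (chart κ p x).1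
  have f2 := fold_add_fold (chart κ p x).2
  have hκ : κ = κ' := by
    by_contra hκ
    have : x.1 + y.1 = 2 := by
      cases κ <;> cases κ' <;> first | exact absurd rfl hκ | linarith
    linarith [hx.1.2, hy.1.2]
  subst hκ
  have h' : levelCurve κ p' y.1 y.2 = levelCurve κ p x.1 x.2 := by
    rw [← toPlane_chart, ← toPlane_chart, h]
  exact hne (Prod.ext rfl (levelCurve_index_unique hx.1 hy.1 hx.2 hy.2 h'.symm))

theorem chart_mem (κ : Bool) (p : Bool × Bool) {x : ℝ × ℝ} (hx : x ∈ chartSource) :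
    chart κ p x ∈ unitSquare :=
  ⟨Ioo_subset_Ico_self (branch_mem κ p.1 (mul_mem_Ioo hx.1 hx.2)).1,
    Ioo_subset_Ico_self (branch_mem κ p.2 (mul_mem_Ioo hx.1 (one_sub_mem_Ioo hx.2))).1⟩

/-- The saddle level separates the two families of charts and belongs to neither. Its sections are
countable, so Fubini's theorem gives measure zero. -/
theorem measure_critical_level :
    volume {x : ℝ × ℝ | x ∈ unitSquare ∧ fold false x.1 + fold false x.2 = 1} = 0 := by
  have hm : MeasurableSet {x : ℝ × ℝ | x ∈ unitSquare ∧ fold false x.1 + fold false x.2 = 1} := by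
    refine (measurableSet_Ico.prod measurableSet_Ico).inter (measurableSet_eq_fun ?_ ?_)
    · exact (((continuous_fold false).comp continuous_fst).add
        ((continuous_fold false).comp continuous_snd)).measurable
    · exact measurable_const
  refine Measure.measure_prod_null_of_ae_null hm (Eventually.of_forall fun u => ?_)
  refine ((countable_fold_eq false (1 - fold false u)).mono ?_).measure_zero volume
  intro v hv
  exact ⟨hv.1.2, by linarith [hv.2]⟩

theorem unitSquare_ae_eq : unitSquare =ᵐ[volume]
    ⋃ q : Bool × Bool × Bool, chart q.1 q.2 '' chartSource := by
  have hne : ∀ c : ℝ, ∀ᵐ y : ℝ, y ≠ c := fun c => by simp [ae_iff]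
  have h1 : ∀ c : ℝ, ∀ᵐ x : ℝ × ℝ, x.1 ≠ c := fun c =>
    Measure.quasiMeasurePreserving_fst.ae (hne c)
  have h2 : ∀ c : ℝ, ∀ᵐ x : ℝ × ℝ, x.2 ≠ c := fun c =>
    Measure.quasiMeasurePreserving_snd.ae (hne c)
  filter_upwards [h1 0, h1 (1 / 2), h2 0, h2 (1 / 2), compl_mem_ae_iff.2 measure_critical_level]
    with x a1 a2 a3 a4 a5
  refine propext ⟨fun h => ?_, fun h => ?_⟩
  · have hD : x ∈ unitSquare := h
    have hs : fold false x.1 + fold false x.2 ≠ 1 := fun h0 => a5 ⟨hD, h0⟩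
    obtain ⟨κ, hκ⟩ : ∃ κ, fold κ x.1 + fold κ x.2 < 1 := by
      rcases lt_or_gt_of_ne hs with h0 | h0
      · exact ⟨false, h0⟩
      · exact ⟨true, by linarith [fold_add_fold x.1, fold_add_fold x.2]⟩
    obtain ⟨p, t, ht, h⟩ := exists_levelCurve_eq (κ := κ) (ξ := toPlane x) hD.1 hD.2
      (not_or.2 ⟨a1, a2⟩) (not_or.2 ⟨a3, a4⟩)
    have hpos : 0 < fold κ x.1 + fold κ x.2 := by
      have e1 := ((exists_branch_eq κ hD.1).resolve_left (not_or.2 ⟨a1, a2⟩)).1.1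
      linarith [fold_nonneg κ x.2]
    refine mem_iUnion.2 ⟨(κ, p), (fold κ x.1 + fold κ x.2, t), ⟨⟨hpos, hκ⟩, ht⟩, ?_⟩
    exact Prod.ext (congrArg (fun ξ : Plane => ξ 0) h) (congrArg (fun ξ : Plane => ξ 1) h)
  · obtain ⟨q, y, hy, rfl⟩ := mem_iUnion.1 h
    exact chart_mem q.1 q.2 hy

variable {E : Type*} [NormedAddCommGroup E] [NormedSpace ℂ E]

theorem integrableOn_chart {G : ℝ × ℝ → E} (hG : IntegrableOn G unitSquare) (κ : Bool)
    (p : Bool × Bool) : IntegrableOn (fun x => kern x.1 x.2 • G (chart κ p x)) chartSource := by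
  have h1 : IntegrableOn G (chart κ p '' chartSource) := hG.mono_set (by
    rintro _ ⟨x, hx, rfl⟩
    exact chart_mem κ p hx)
  rw [integrableOn_image_iff_integrableOn_abs_det_fderiv_smul volume measurableSet_chartSource
    (fun x hx => (hasFDerivAt_chart κ p hx).hasFDerivWithinAt) (injOn_chart κ p)] at h1
  refine h1.congr_fun (fun x hx => ?_) measurableSet_chartSource
  simp only [abs_det_chartDeriv p hx]

theorem setIntegral_unitSquare {G : ℝ × ℝ → E} (hG : IntegrableOn G unitSquare) :
    ∫ x in unitSquare, G x = ∑ κ, ∑ p, ∫ x in chartSource, kern x.1 x.2 • G (chart κ p x) := by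
  rw [setIntegral_congr_set unitSquare_ae_eq, integral_iUnion_fintype _ chart_disjoint,
    Fintype.sum_prod_type]
  · refine Finset.sum_congr rfl fun κ _ => Finset.sum_congr rfl fun p _ => ?_
    rw [integral_image_eq_integral_abs_det_fderiv_smul volume measurableSet_chartSource
      (fun x hx => (hasFDerivAt_chart κ p hx).hasFDerivWithinAt) (injOn_chart κ p)]
    refine setIntegral_congr_fun measurableSet_chartSource fun x hx => ?_
    simp only [abs_det_chartDeriv p hx]
  · rintro ⟨κ, p⟩
    refine hG.mono_set ?_
    rintro _ ⟨x, hx, rfl⟩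
    exact chart_mem κ p hx
  · rintro ⟨κ, p⟩
    exact measurable_image_of_fderivWithin measurableSet_chartSource
      (fun x hx => (hasFDerivAt_chart κ p hx).hasFDerivWithinAt) (injOn_chart κ p)

theorem hasDerivAt_levelValue (m : ℝ) (κ : Bool) (τ : ℝ) :
    HasDerivAt (levelValue m κ) (if κ then -4 else 4) τ := by
  cases κ
  · exact (((hasDerivAt_id τ).const_mul 4).const_add (m ^ 2)).congr_deriv (by simp)
  · exact (((hasDerivAt_id τ).const_mul 4).const_sub (m ^ 2 + 8)).congr_deriv (by simp)

theorem levelValue_image (m : ℝ) : levelValue m false '' Ioo 0 1 = Ioo (m ^ 2) (m ^ 2 + 4) ∧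
    levelValue m true '' Ioo 0 1 = Ioo (m ^ 2 + 4) (m ^ 2 + 8) := by
  constructor
  · ext ρ
    constructor
    · rintro ⟨τ, hτ, rfl⟩
      simp only [levelValue, Bool.false_eq_true, if_false]
      exact ⟨by linarith [hτ.1], by linarith [hτ.2]⟩
    · rintro ⟨h1, h2⟩
      refine ⟨(ρ - m ^ 2) / 4, ⟨by linarith, by linarith⟩, ?_⟩
      simp only [levelValue, Bool.false_eq_true, if_false]
      ring
  · ext ρ
    constructor
    · rintro ⟨τ, hτ, rfl⟩
      simp only [levelValue, if_true]
      exact ⟨by linarith [hτ.2], by linarith [hτ.1]⟩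
    · rintro ⟨h1, h2⟩
      refine ⟨(m ^ 2 + 8 - ρ) / 4, ⟨by linarith, by linarith⟩, ?_⟩
      simp only [levelValue, if_true]
      ring

theorem Ioc_ae_eq_levelValue (m : ℝ) : Ioc (m ^ 2) (m ^ 2 + 8) =ᵐ[volume]
    ⋃ κ, levelValue m κ '' Ioo 0 1 := by
  have hne : ∀ c : ℝ, ∀ᵐ y : ℝ, y ≠ c := fun c => by simp [ae_iff]
  filter_upwards [hne (m ^ 2 + 4), hne (m ^ 2 + 8)] with ρ h4 h8
  refine propext ⟨fun h => ?_, fun h => ?_⟩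
  · have h' : ρ ∈ Ioc (m ^ 2) (m ^ 2 + 8) := h
    rcases lt_or_gt_of_ne h4 with h0 | h0
    · exact mem_iUnion.2 ⟨false, (levelValue_image m).1 ▸ ⟨h'.1, h0⟩⟩
    · exact mem_iUnion.2 ⟨true, (levelValue_image m).2 ▸ ⟨h0, lt_of_le_of_ne h'.2 h8⟩⟩
  · obtain ⟨κ, hκ⟩ := mem_iUnion.1 h
    cases κ
    · rw [(levelValue_image m).1] at hκ
      exact ⟨hκ.1, by linarith [hκ.2]⟩
    · rw [(levelValue_image m).2] at hκ
      exact ⟨by linarith [hκ.1], hκ.2.le⟩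

theorem measurableSet_levelValue_image (m : ℝ) (κ : Bool) :
    MeasurableSet (levelValue m κ '' Ioo 0 1) := by
  cases κ
  · rw [(levelValue_image m).1]; exact measurableSet_Ioo
  · rw [(levelValue_image m).2]; exact measurableSet_Ioo

theorem levelValue_image_disjoint (m : ℝ) :
    Pairwise (Function.onFun Disjoint fun κ => levelValue m κ '' Ioo (0 : ℝ) 1) := by
  have h : Disjoint (levelValue m false '' Ioo 0 1) (levelValue m true '' Ioo 0 1) := by
    rw [(levelValue_image m).1, (levelValue_image m).2]
    exact Set.disjoint_left.2 fun x h1 h2 => by linarith [h1.2, h2.1]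
  intro κ κ' hne
  cases κ <;> cases κ' <;> first | exact absurd rfl hne | exact h | exact h.symm

theorem integrableOn_unitSquare {F : Plane → E} (hF : Continuous F) (m : ℝ) {φ : ℝ → ℂ}
    (hφ : ContinuousOn φ (Icc (m ^ 2) (m ^ 2 + 8))) :
    IntegrableOn (fun x => φ (r m (toPlane x)) • F (toPlane x)) unitSquare := by
  have hr : Continuous fun x => r m (toPlane x) := by
    simp only [r_eq_levelValue m false, levelValue, Bool.false_eq_true, if_false]
    have h0 : Continuous fun x : ℝ × ℝ => fold false (toPlane x 0) :=
      (continuous_fold false).comp continuous_fst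
    have h1 : Continuous fun x : ℝ × ℝ => fold false (toPlane x 1) :=
      (continuous_fold false).comp continuous_snd
    fun_prop
  have hc : Continuous fun x => φ (r m (toPlane x)) • F (toPlane x) :=
    (hφ.comp_continuous hr fun x => r_mem_Icc m _).smul (hF.comp continuous_toPlane)
  refine (hc.continuousOn.integrableOn_compact
    (isCompact_Icc.prod isCompact_Icc : IsCompact (Icc (0 : ℝ) 1 ×ˢ Icc (0 : ℝ) 1))).mono_set ?_
  exact prod_mono Ico_subset_Icc_self Ico_subset_Icc_self

/-- The coarea formula. -/
theorem coarea [CompleteSpace E] {F : Plane → E} (hF : Continuous F) {C : ℝ}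
    (hC : ∀ ξ, ‖F ξ‖ ≤ C) (m : ℝ) {φ : ℝ → ℂ} (hφ : ContinuousOn φ (Icc (m ^ 2) (m ^ 2 + 8))) :
    IntegrableOn (fun ρ => φ ρ • levelInt m F ρ) (Ioc (m ^ 2) (m ^ 2 + 8)) ∧
    ∫ ρ in Ioc (m ^ 2) (m ^ 2 + 8), φ ρ • levelInt m F ρ =
      ∫ x in unitSquare, φ (r m (toPlane x)) • F (toPlane x) := by
  set G : ℝ × ℝ → E := fun x => φ (r m (toPlane x)) • F (toPlane x) with hG
  have hGi : IntegrableOn G unitSquare := integrableOn_unitSquare hF m hφ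
  have hprod : (volume : Measure (ℝ × ℝ)).restrict chartSource =
      (volume.restrict (Ioo (0 : ℝ) 1)).prod (volume.restrict (Ioo (0 : ℝ) 1)) :=
    (Measure.prod_restrict _ _).symm
  -- The factor `4` is `|dρ/dτ|`; it cancels the `1/4` in the level integral. The function `φ` can
  -- be moved inside because `r_m` is constant on each arc. The coarea formula is then Fubini's
  -- theorem in the coordinates `(τ, t)`.
  have hH : ∀ κ, ∀ τ ∈ Ioo (0 : ℝ) 1, (4 : ℝ) • φ (levelValue m κ τ) • levelInt m F (levelValue m κ τ) =
      ∑ p, ∫ t in Ioo (0 : ℝ) 1, kern τ t • G (chart κ p (τ, t)) := by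
    intro κ τ hτ
    have e1 : ∀ p, ∫ t in Ioo (0 : ℝ) 1, kern τ t • G (chart κ p (τ, t)) =
        φ (levelValue m κ τ) • ∫ t in Ioo (0 : ℝ) 1, kern τ t • F (levelCurve κ p τ t) := by
      intro p
      rw [← integral_smul]
      refine setIntegral_congr_fun measurableSet_Ioo fun t ht => ?_
      simp only [hG, toPlane_chart, r_levelCurve m κ p hτ ht]
      rw [smul_comm]
    simp only [e1]
    rw [(levelInt_levelValue hF hC m κ hτ).2, ← Finset.smul_sum]
    simp only [arcSum, Finset.smul_sum (r := kern τ _)]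
    rw [integral_finsetSum _ fun p _ => integrableOn_arc hF hC κ p hτ, smul_comm (4 : ℝ), smul_smul]
    norm_num
  have hint : ∀ κ p, Integrable (fun τ => ∫ t in Ioo (0 : ℝ) 1, kern τ t • G (chart κ p (τ, t)))
      (volume.restrict (Ioo (0 : ℝ) 1)) := by
    intro κ p
    have h := integrableOn_chart hGi κ p
    rw [IntegrableOn, hprod] at h
    exact h.integral_prod_left
  have hIκ : ∀ κ, IntegrableOn (fun ρ => φ ρ • levelInt m F ρ) (levelValue m κ '' Ioo 0 1) := by
    intro κ
    rw [integrableOn_image_iff_integrableOn_abs_deriv_smul measurableSet_Ioo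
      (fun τ _ => (hasDerivAt_levelValue m κ τ).hasDerivWithinAt) (levelValue_injective m κ).injOn]
    refine IntegrableOn.congr_fun (integrable_finsetSum Finset.univ fun p _ => hint κ p)
      (fun τ hτ => ?_) measurableSet_Ioo
    rw [← hH κ τ hτ]
    congr 1
    cases κ <;> norm_num
  have hE : ∀ κ, ∫ ρ in levelValue m κ '' Ioo 0 1, φ ρ • levelInt m F ρ =
      ∑ p, ∫ x in chartSource, kern x.1 x.2 • G (chart κ p x) := by
    intro κ
    rw [integral_image_eq_integral_abs_deriv_smul measurableSet_Ioo
      (fun τ _ => (hasDerivAt_levelValue m κ τ).hasDerivWithinAt) (levelValue_injective m κ).injOn]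
    have e2 : ∀ p, ∫ x in chartSource, kern x.1 x.2 • G (chart κ p x) =
        ∫ τ in Ioo (0 : ℝ) 1, ∫ t in Ioo (0 : ℝ) 1, kern τ t • G (chart κ p (τ, t)) := by
      intro p
      have h := integrableOn_chart hGi κ p
      rw [IntegrableOn, hprod] at h
      rw [hprod, integral_prod _ h]
    simp only [e2]
    rw [← integral_finsetSum _ fun p _ => hint κ p]
    refine setIntegral_congr_fun measurableSet_Ioo fun τ hτ => ?_
    rw [← hH κ τ hτ]
    congr 1
    cases κ <;> norm_num
  constructor
  · exact (integrableOn_finite_iUnion.2 hIκ).congr_set_ae (Ioc_ae_eq_levelValue m)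
  · rw [setIntegral_congr_set (Ioc_ae_eq_levelValue m),
      integral_iUnion_fintype (measurableSet_levelValue_image m) (levelValue_image_disjoint m) hIκ,
      setIntegral_unitSquare hGi]
    exact Finset.sum_congr rfl fun κ _ => hE κ

end Coarea

/-! ### Fourier coefficients and the operators `T_{z,m}(ξ)` -/

section FourierCoefficients

open UnitAddTorus

theorem mFourier_apply_add (n : Vertex) (x y : Torus) :
    mFourier n (x + y) = mFourier n x * mFourier n y := by
  simp only [mFourier, ContinuousMap.coe_mk, Pi.add_apply, fourier_apply, smul_add,
    AddCircle.toCircle_add, Circle.coe_mul, Finset.prod_mul_distrib]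

theorem mFourier_apply_neg (n : Vertex) (x : Torus) : mFourier n (-x) = mFourier (-n) x := by
  simp only [mFourier, ContinuousMap.coe_mk, Pi.neg_apply, fourier_apply, smul_neg, neg_smul]

theorem coeFn_character (μ : Vertex) : character μ =ᵐ[torusVol] fun η => mFourier (-μ) η :=
  ContinuousMap.coeFn_toLp (𝕜 := ℂ) torusVol (mFourier (-μ))

theorem charBasis_repr (h : L2T) (μ : Vertex) :
    charBasis.repr h μ = ∫ η, mFourier μ η * h η ∂torusVol := by
  rw [HilbertBasis.repr_apply_apply, charBasis, HilbertBasis.coe_mk, L2.inner_def]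
  refine integral_congr_ae ?_
  filter_upwards [coeFn_character μ] with η h1
  rw [h1, RCLike.inner_apply, mul_comm, mFourier_neg, Complex.conj_conj]

theorem charBasis_repr_translate (τ : Torus) (h : L2T) (μ : Vertex) :
    charBasis.repr (translate τ h) μ = mFourier μ τ * charBasis.repr h μ := by
  rw [charBasis_repr, charBasis_repr, ← integral_const_mul]
  have h1 : ∫ η, mFourier μ η * translate τ h η ∂torusVol =
      ∫ η, (fun x => mFourier μ (x + τ) * h x) (η - τ) ∂torusVol := by
    refine integral_congr_ae ?_
    filter_upwards [Lp.coeFn_compMeasurePreserving h (measurePreserving_sub_right torusVol τ)]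
      with η h1
    rw [translate, h1]
    simp
  rw [h1, integral_sub_right_eq_self (fun x => mFourier μ (x + τ) * h x)]
  refine integral_congr_ae (Eventually.of_forall fun η => ?_)
  simp only [mFourier_apply_add]
  ring

theorem charBasis_repr_star_reflect (τ : Torus) (h : L2T) (μ : Vertex) :
    charBasis.repr (star (reflect τ h)) μ = mFourier μ τ * conj (charBasis.repr h μ) := by
  rw [charBasis_repr, charBasis_repr, ← integral_conj, ← integral_const_mul]
  have h1 : ∫ η, mFourier μ η * star (reflect τ h) η ∂torusVol =
      ∫ η, (fun x => mFourier μ (τ - x) * conj (h x)) (τ - η) ∂torusVol := by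
    refine integral_congr_ae ?_
    filter_upwards [Lp.coeFn_star (reflect τ h), Lp.coeFn_compMeasurePreserving h
      (Measure.measurePreserving_sub_left torusVol τ)] with η h1 h2
    rw [h1, Pi.star_apply, reflect, h2]
    simp
  rw [h1, integral_sub_left_eq_self (fun x => mFourier μ (τ - x) * conj (h x))]
  refine integral_congr_ae (Eventually.of_forall fun η => ?_)
  simp only [sub_eq_add_neg, mFourier_apply_add, mFourier_apply_neg, mFourier_neg, map_mul]
  ring

/-- The character `e^{2πi ξ·μ}`. -/
def phase (ξ : Plane) (μ : Vertex) : ℂ :=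
  Complex.exp (2 * Real.pi * Complex.I * ((ξ 0 * μ 0 + ξ 1 * μ 1 : ℝ) : ℂ))

theorem norm_phase (ξ : Plane) (μ : Vertex) : ‖phase ξ μ‖ = 1 := by
  have : 2 * Real.pi * Complex.I * ((ξ 0 * μ 0 + ξ 1 * μ 1 : ℝ) : ℂ) =
      ((2 * Real.pi * (ξ 0 * μ 0 + ξ 1 * μ 1) : ℝ) : ℂ) * Complex.I := by push_cast; ring
  rw [phase, this, Complex.norm_exp_ofReal_mul_I]

theorem mFourier_toTorus (μ : Vertex) (ξ : Plane) : mFourier μ (toTorus ξ) = phase ξ μ := by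
  simp only [mFourier, ContinuousMap.coe_mk, toTorus, Fin.prod_univ_two, fourier_coe_apply]
  rw [← Complex.exp_add, phase]
  congr 1
  push_cast
  ring

theorem memℓp_phase_mul (V : Potential) (j : Fin 3) (ξ : Plane) :
    Memℓp (fun μ => phase ξ μ * (√(V.v j μ) : ℂ)) 2 := by
  have h := memℓp_two_iff.1 (V.memℓp_sqrt_v j)
  rw [memℓp_two_iff]
  refine h.congr fun μ => ?_
  rw [norm_mul, norm_phase, one_mul]

/-- The sequence `e^{2πi ξ·μ} g_j(μ)`. -/
def modulated (V : Potential) (j : Fin 3) (ξ : Plane) : Ell2 Vertex :=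
  ⟨fun μ => phase ξ μ * (√(V.v j μ) : ℂ), memℓp_phase_mul V j ξ⟩

/-- The function `ĝ_j(· - ξ)`. -/
def shifted (V : Potential) (j : Fin 3) (ξ : Plane) : L2T := fourierT (modulated V j ξ)

theorem repr_ghat (V : Potential) (j : Fin 3) (μ : Vertex) :
    charBasis.repr (V.ghat j) μ = (√(V.v j μ) : ℂ) := by
  rw [Potential.ghat, fourierT, LinearIsometryEquiv.apply_symm_apply]
  rfl

theorem translate_ghat (V : Potential) (j : Fin 3) (ξ : Plane) :
    translate (toTorus ξ) (V.ghat j) = shifted V j ξ := by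
  rw [shifted, fourierT]
  apply charBasis.repr.injective
  rw [LinearIsometryEquiv.apply_symm_apply]
  ext μ
  rw [charBasis_repr_translate, mFourier_toTorus, repr_ghat]
  rfl

/-- As `g_j` is real, the conjugate of `ĝ_j(ξ - η)` is `ĝ_j(η - ξ)`. The functionals in `t_{z,m}(ξ)`
and the vectors in `t†_{z,m}(ξ)` thus come from the same elements of `L²(𝕋²)`. -/
theorem star_reflect_ghat (V : Potential) (j : Fin 3) (ξ : Plane) :
    star (reflect (toTorus ξ) (V.ghat j)) = shifted V j ξ := by
  rw [shifted, fourierT]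
  apply charBasis.repr.injective
  rw [LinearIsometryEquiv.apply_symm_apply]
  ext μ
  rw [charBasis_repr_star_reflect, mFourier_toTorus, repr_ghat, Complex.conj_ofReal]
  rfl

/-- The vector `t†_{z,m}(ξ)(1, 1, 1)`. -/
def leftVec (V : Potential) (m : ℝ) (z : ℂ) (ξ : Plane) : L2T3 :=
  WithLp.toLp 2 fun k => coefDag m z ξ k • shifted V k ξ

/-- The vector representing the functional `f ↦ ∑_j (t_{z,m}(ξ) f)_j`. -/
def rightVec (V : Potential) (m : ℝ) (z : ℂ) (ξ : Plane) : L2T3 :=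
  WithLp.toLp 2 fun k => conj (coef m z ξ k) • shifted V k ξ

/-- The operator `T_{z,m}(ξ)`, as a trace class operator. -/
def traceT (V : Potential) (m : ℝ) (z : ℂ) (ξ : Plane) : TC :=
  TraceClass.rankOne (leftVec V m z ξ) (rightVec V m z ξ)

/-- The all-ones matrix is the product of the column and the row `(1, 1, 1)`, so `T_{z,m}(ξ)` has
rank at most one: it evaluates the sum of the components of `t_{z,m}(ξ) f` and multiplies it by the
image of `(1, 1, 1)` under `t†_{z,m}(ξ)`. -/
theorem T_eq_incl (V : Potential) (m : ℝ) (z : ℂ) (ξ : Plane) :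
    T V m z ξ = TraceClass.incl (traceT V m z ξ) := by
  refine ContinuousLinearMap.ext fun f => ?_
  rw [traceT, TraceClass.incl_rankOne_apply]
  have h1 : ∀ j, t V m z ξ f j = coef m z ξ j * ⟪shifted V j ξ, f j⟫_ℂ := by
    intro j
    rw [← star_reflect_ghat]
    rfl
  have h2 : ⟪rightVec V m z ξ, f⟫_ℂ = ∑ j, t V m z ξ f j := by
    rw [PiLp.inner_apply]
    refine Finset.sum_congr rfl fun j _ => ?_
    rw [h1, rightVec, PiLp.toLp_apply, inner_smul_left, Complex.conj_conj]
  have h3 : ∀ k, Matrix.toEuclideanCLM (𝕜 := ℂ) (n := Fin 3) (Matrix.of fun _ _ => 1)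
      (t V m z ξ f) k = ∑ j, t V m z ξ f j := by
    intro k
    rw [Matrix.ofLp_toEuclideanCLM]
    simp [Matrix.mulVec, dotProduct]
  refine PiLp.ext fun k => ?_
  have h4 : T V m z ξ f k = (∑ j, t V m z ξ f j) • coefDag m z ξ k • shifted V k ξ := by
    rw [← translate_ghat, ← h3 k]
    rfl
  rw [h4, h2]
  rfl

end FourierCoefficients

/-! ### Hölder continuity of `T_{z,m}(ξ)` -/

section Holder

/-- `⟨μ⟩ = (1 + |μ|²)^{1/2}`. -/
def bracket (μ : Vertex) : ℝ := √(1 + ((μ 0 : ℝ) ^ 2 + (μ 1 : ℝ) ^ 2))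

theorem one_le_bracket (μ : Vertex) : 1 ≤ bracket μ := by
  rw [bracket, Real.one_le_sqrt]
  have : 0 ≤ (μ 0 : ℝ) ^ 2 + (μ 1 : ℝ) ^ 2 := by positivity
  linarith

/-- If `2^{k+1} ≤ x < 2^{k+2}`, then `x^s ≤ 4^s (2^k)^s` and `2^k < x` holds strictly, matching the
strict inequality in the tail sums of `Potential.Decay`. The summand `1` covers `x < 2`. -/
theorem rpow_le_dyadic {x s : ℝ} (hx : 1 ≤ x) (hs : 0 ≤ s) :
    ENNReal.ofReal (x ^ s) ≤ ENNReal.ofReal (4 ^ s) *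
      (1 + ∑' k : ℕ, if (2 : ℝ) ^ k < x then ENNReal.ofReal (((2 : ℝ) ^ k) ^ s) else 0) := by
  obtain ⟨n, h1, h2⟩ := exists_nat_pow_near hx one_lt_two
  rcases n with _ | k
  · calc ENNReal.ofReal (x ^ s) ≤ ENNReal.ofReal (4 ^ s) :=
          ENNReal.ofReal_le_ofReal (Real.rpow_le_rpow (by linarith) (by norm_num at h2; linarith) hs)
      _ = ENNReal.ofReal (4 ^ s) * 1 := (mul_one _).symm
      _ ≤ _ := by gcongr; exact le_self_add
  · have hk : (2 : ℝ) ^ k < x := by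
      have : (0 : ℝ) < 2 ^ k := by positivity
      rw [pow_succ] at h1
      linarith
    have hx4 : x ≤ 4 * 2 ^ k := by
      rw [pow_succ, pow_succ] at h2
      linarith
    calc ENNReal.ofReal (x ^ s) ≤ ENNReal.ofReal ((4 * 2 ^ k) ^ s) :=
          ENNReal.ofReal_le_ofReal (Real.rpow_le_rpow (by linarith) hx4 hs)
      _ = ENNReal.ofReal (4 ^ s) * ENNReal.ofReal (((2 : ℝ) ^ k) ^ s) := by
          rw [← ENNReal.ofReal_mul (by positivity), Real.mul_rpow (by norm_num) (by positivity)]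
      _ ≤ _ := by
          gcongr
          refine le_add_left ?_
          refine le_trans ?_ (ENNReal.le_tsum k)
          rw [if_pos hk]

/-- The tail beyond `2^k` is `O(2^{-2βk})`, so the series is dominated by a geometric one of ratio
`2^{2α - 2β} < 1`. This is why `α < β` must be strict. -/
theorem summable_dyadic_tail {V : Potential} {j : Fin 3} {β α : ℝ} (hV : V.Decay j β)
    (hαβ : α < β) : Summable fun k : ℕ => ((2 : ℝ) ^ k) ^ (2 * α) *
      ∑' μ : {μ : Vertex // (2 : ℝ) ^ k < bracket μ}, |V.v j μ| := by
  have h1 := hV.comp_tendsto (tendsto_pow_atTop_atTop_of_one_lt (one_lt_two (α := ℝ)))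
  have h2 : (fun k : ℕ => ((2 : ℝ) ^ k) ^ (2 * α) *
      ∑' μ : {μ : Vertex // (2 : ℝ) ^ k < bracket μ}, |V.v j μ|) =O[atTop]
      fun k : ℕ => ((2 : ℝ) ^ k) ^ (2 * α) * ((2 : ℝ) ^ k) ^ (-2 * β) :=
    (Asymptotics.isBigO_refl _ _).mul h1
  refine summable_of_isBigO_nat (g := fun k : ℕ => ((2 : ℝ) ^ (2 * α - 2 * β)) ^ k) ?_ ?_
  · refine summable_geometric_of_lt_one (by positivity) ?_
    exact Real.rpow_lt_one_of_one_lt_of_neg one_lt_two (by linarith)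
  · refine h2.congr_right fun k => ?_
    rw [← Real.rpow_add (by positivity), ← Real.rpow_natCast, ← Real.rpow_natCast,
      ← Real.rpow_mul (by norm_num), ← Real.rpow_mul (by norm_num)]
    congr 1
    ring

/-- Inserting the dyadic bound for `⟨μ⟩^{2α}` and exchanging the sums over `μ` and `k` leaves
weighted tail sums. Working in `ℝ≥0∞` makes the exchange free of conditions. -/
theorem summable_moment {V : Potential} {j : Fin 3} {β α : ℝ} (hV : V.Decay j β) (hα : 0 ≤ α)
    (hαβ : α < β) : Summable fun μ => V.v j μ * bracket μ ^ (2 * α) := by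
  have hnn : ∀ μ, 0 ≤ bracket μ ^ (2 * α) := fun μ =>
    Real.rpow_nonneg (by linarith [one_le_bracket μ]) _
  have hv := V.v_summable j
  have htail : ∀ k : ℕ, (∑' μ, ENNReal.ofReal (V.v j μ) *
      if (2 : ℝ) ^ k < bracket μ then ENNReal.ofReal (((2 : ℝ) ^ k) ^ (2 * α)) else 0) =
      ENNReal.ofReal (((2 : ℝ) ^ k) ^ (2 * α) *
        ∑' μ : {μ : Vertex // (2 : ℝ) ^ k < bracket μ}, |V.v j μ|) := by
    intro k
    rw [ENNReal.ofReal_mul (by positivity), ENNReal.ofReal_tsum_of_nonneg (fun _ => abs_nonneg _)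
      (hv.abs.subtype _)]
    have hsub : (∑' μ : {μ : Vertex // (2 : ℝ) ^ k < bracket μ}, ENNReal.ofReal |V.v j μ|) = _ :=
      tsum_subtype {μ : Vertex | (2 : ℝ) ^ k < bracket μ} fun μ => ENNReal.ofReal |V.v j μ|
    rw [hsub, ← ENNReal.tsum_mul_left]
    refine tsum_congr fun μ => ?_
    by_cases h : (2 : ℝ) ^ k < bracket μ
    · rw [if_pos h, indicator_of_mem (by exact h), abs_of_nonneg (V.v_nonneg j μ), mul_comm]
    · rw [if_neg h, indicator_of_notMem (by exact h), mul_zero, mul_zero]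
  have hfin : ∑' μ, ENNReal.ofReal (V.v j μ * bracket μ ^ (2 * α)) ≠ ⊤ := by
    have hle : ∑' μ, ENNReal.ofReal (V.v j μ * bracket μ ^ (2 * α)) ≤
        ENNReal.ofReal (4 ^ (2 * α)) * (∑' μ, ENNReal.ofReal (V.v j μ) +
          ∑' k : ℕ, ENNReal.ofReal (((2 : ℝ) ^ k) ^ (2 * α) *
            ∑' μ : {μ : Vertex // (2 : ℝ) ^ k < bracket μ}, |V.v j μ|)) := by
      simp only [← htail]
      rw [ENNReal.tsum_comm, ← ENNReal.tsum_add, ← ENNReal.tsum_mul_left]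
      refine ENNReal.tsum_le_tsum fun μ => ?_
      rw [ENNReal.ofReal_mul (V.v_nonneg j μ), ENNReal.tsum_mul_left]
      calc _ ≤ ENNReal.ofReal (V.v j μ) * (ENNReal.ofReal (4 ^ (2 * α)) * (1 + ∑' k : ℕ,
            if (2 : ℝ) ^ k < bracket μ then ENNReal.ofReal (((2 : ℝ) ^ k) ^ (2 * α)) else 0)) := by
            gcongr
            exact rpow_le_dyadic (one_le_bracket μ) (by linarith)
        _ = _ := by ring
    refine ne_top_of_le_ne_top (ENNReal.mul_ne_top ENNReal.ofReal_ne_top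
      (ENNReal.add_ne_top.2 ⟨?_, ?_⟩)) hle
    · rw [← ENNReal.ofReal_tsum_of_nonneg (V.v_nonneg j) hv]
      exact ENNReal.ofReal_ne_top
    · rw [← ENNReal.ofReal_tsum_of_nonneg (fun k => mul_nonneg (by positivity)
        (tsum_nonneg fun _ => abs_nonneg _)) (summable_dyadic_tail hV hαβ)]
      exact ENNReal.ofReal_ne_top
  refine (ENNReal.summable_toReal hfin).congr fun μ => ?_
  rw [ENNReal.toReal_ofReal (mul_nonneg (V.v_nonneg j μ) (hnn μ))]

/-- Interpolation between the trivial bound `2` and the Lipschitz bound `x = 2π‖ξ - η‖⟨μ⟩`, using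
`min 2 x ≤ 2 x^α` for `0 < α ≤ 1`. -/
theorem norm_phase_sub_le {α : ℝ} (hα : 0 < α) (hα1 : α ≤ 1) (ξ η : Plane) (μ : Vertex) :
    ‖phase ξ μ - phase η μ‖ ≤ 2 * (2 * Real.pi) ^ α * ‖ξ - η‖ ^ α * bracket μ ^ α := by
  have hb : 0 ≤ bracket μ := by linarith [one_le_bracket μ]
  have hπ := Real.pi_pos
  set x := 2 * Real.pi * ‖ξ - η‖ * bracket μ with hx
  have hx0 : 0 ≤ x := by positivity
  have e1 : 2 * (2 * Real.pi) ^ α * ‖ξ - η‖ ^ α * bracket μ ^ α = 2 * x ^ α := by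
    rw [hx, Real.mul_rpow (by positivity) hb, Real.mul_rpow (by positivity) (norm_nonneg _)]
    ring
  rw [e1]
  have h2 : ‖phase ξ μ - phase η μ‖ ≤ 2 := by
    refine (norm_sub_le _ _).trans ?_
    rw [norm_phase, norm_phase]
    norm_num
  have hinner : |(ξ 0 - η 0) * μ 0 + (ξ 1 - η 1) * μ 1| ≤ ‖ξ - η‖ * bracket μ := by
    have h : ((ξ 0 - η 0) * μ 0 + (ξ 1 - η 1) * μ 1) ^ 2 ≤
        ((ξ 0 - η 0) ^ 2 + (ξ 1 - η 1) ^ 2) * (1 + ((μ 0 : ℝ) ^ 2 + (μ 1 : ℝ) ^ 2)) := by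
      nlinarith [sq_nonneg ((ξ 0 - η 0) * μ 1 - (ξ 1 - η 1) * μ 0), sq_nonneg (ξ 0 - η 0),
        sq_nonneg (ξ 1 - η 1)]
    refine (Real.abs_le_sqrt h).trans_eq ?_
    rw [Real.sqrt_mul (by positivity), bracket, EuclideanSpace.norm_eq, Fin.sum_univ_two]
    simp
  have h1 : ‖phase ξ μ - phase η μ‖ ≤ x := by
    have e2 : phase ξ μ - phase η μ = phase η μ *
        (Complex.exp (Complex.I * ((2 * Real.pi *
          ((ξ 0 - η 0) * μ 0 + (ξ 1 - η 1) * μ 1) : ℝ) : ℂ)) - 1) := by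
      rw [mul_sub, mul_one, phase, phase, ← Complex.exp_add]
      congr 2
      push_cast
      ring
    rw [e2, norm_mul, norm_phase, one_mul]
    refine (Real.norm_exp_I_mul_ofReal_sub_one_le).trans ?_
    rw [Real.norm_eq_abs, abs_mul, abs_of_pos (by positivity : 0 < 2 * Real.pi), hx,
      mul_assoc (2 * Real.pi) ‖ξ - η‖ (bracket μ)]
    exact mul_le_mul_of_nonneg_left hinner (by positivity)
  rcases le_or_gt x 1 with hx1 | hx1
  · have h3 : x ≤ x ^ α := by
      rcases hx0.eq_or_lt with h | h
      · rw [← h, Real.zero_rpow hα.ne']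
      · calc x = x ^ (1 : ℝ) := (Real.rpow_one x).symm
          _ ≤ _ := Real.rpow_le_rpow_of_exponent_ge h hx1 hα1
    have : 0 ≤ x ^ α := Real.rpow_nonneg hx0 _
    linarith
  · have := Real.one_le_rpow hx1.le hα.le
    linarith

section Closure

variable {E F : Type*} [NormedAddCommGroup E] [NormedSpace ℂ E] [NormedAddCommGroup F]
  [NormedSpace ℂ F] {α : ℝ}

theorem BddHolder.add {E : Type*} [NormedAddCommGroup E] {f g : Plane → E} (hf : BddHolder α f) (hg : BddHolder α g) :
    BddHolder α fun ξ => f ξ + g ξ := by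
  obtain ⟨C, hC, h1, h2⟩ := hf
  obtain ⟨D, hD, k1, k2⟩ := hg
  refine ⟨C + D, add_nonneg hC hD, fun ξ => norm_add_le_of_le (h1 ξ) (k1 ξ), fun ξ η => ?_⟩
  rw [add_sub_add_comm, add_mul]
  exact norm_add_le_of_le (h2 ξ η) (k2 ξ η)

theorem BddHolder.clm (L : E →L[ℂ] F) {f : Plane → E} (hf : BddHolder α f) :
    BddHolder α fun ξ => L (f ξ) := by
  obtain ⟨C, hC, h1, h2⟩ := hf
  refine ⟨‖L‖ * C, by positivity, fun ξ => L.le_opNorm_of_le (h1 ξ), fun ξ η => ?_⟩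
  rw [← map_sub, mul_assoc]
  exact L.le_opNorm_of_le (h2 ξ η)

theorem BddHolder.const {E : Type*} [NormedAddCommGroup E] (c : E) : BddHolder α fun _ => c :=
  ⟨‖c‖, norm_nonneg _, fun _ => le_rfl, fun ξ η => by
    rw [sub_self, norm_zero]; positivity⟩

theorem BddHolder.smul {f : Plane → ℂ} {g : Plane → E} (hf : BddHolder α f)
    (hg : BddHolder α g) : BddHolder α fun ξ => f ξ • g ξ := by
  obtain ⟨C, hC, h1, h2⟩ := hf
  obtain ⟨D, hD, k1, k2⟩ := hg
  have hb : ∀ ξ, ‖f ξ • g ξ‖ ≤ C * D := fun ξ => by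
    rw [norm_smul]; exact mul_le_mul (h1 ξ) (k1 ξ) (norm_nonneg _) hC
  refine ⟨2 * (C * D), by positivity, fun ξ => (hb ξ).trans (by nlinarith [mul_nonneg hC hD]),
    fun ξ η => ?_⟩
  have e : f ξ • g ξ - f η • g η = (f ξ - f η) • g ξ + f η • (g ξ - g η) := by
    rw [sub_smul, smul_sub]; abel
  rw [e]
  refine (norm_add_le _ _).trans ?_
  rw [norm_smul, norm_smul]
  have hr : 0 ≤ ‖ξ - η‖ ^ α := Real.rpow_nonneg (norm_nonneg _) _
  calc _ ≤ (C * ‖ξ - η‖ ^ α) * D + C * (D * ‖ξ - η‖ ^ α) :=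
        add_le_add (mul_le_mul (h2 ξ η) (k1 ξ) (norm_nonneg _) (by positivity))
          (mul_le_mul (h1 η) (k2 ξ η) (norm_nonneg _) hC)
    _ = _ := by ring

theorem BddHolder.conj {f : Plane → ℂ} (hf : BddHolder α f) :
    BddHolder α fun ξ => conj (f ξ) := by
  obtain ⟨C, hC, h1, h2⟩ := hf
  refine ⟨C, hC, fun ξ => ?_, fun ξ η => ?_⟩
  · rw [RCLike.norm_conj]; exact h1 ξ
  · rw [← map_sub, RCLike.norm_conj]; exact h2 ξ η

/-- Changing one vector at a time, the trace norm of a rank one operator being at most the product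
of the norms of its two vectors. -/
theorem BddHolder.rankOne {H : Type*} [NormedAddCommGroup H] [InnerProductSpace ℂ H]
    {y x : Plane → H} (hy : BddHolder α y) (hx : BddHolder α x) :
    BddHolder α fun ξ => TraceClass.rankOne (y ξ) (x ξ) := by
  obtain ⟨C, hC, h1, h2⟩ := hy
  obtain ⟨D, hD, k1, k2⟩ := hx
  have hb : ∀ ξ, ‖TraceClass.rankOne (y ξ) (x ξ)‖ ≤ C * D := fun ξ =>
    (TraceClass.norm_rankOne_le _ _).trans (mul_le_mul (h1 ξ) (k1 ξ) (norm_nonneg _) hC)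
  refine ⟨2 * (C * D), by positivity, fun ξ => (hb ξ).trans (by nlinarith [mul_nonneg hC hD]),
    fun ξ η => ?_⟩
  rw [TraceClass.rankOne_sub_rankOne]
  refine (norm_add_le _ _).trans ((add_le_add (TraceClass.norm_rankOne_le _ _)
    (TraceClass.norm_rankOne_le _ _)).trans ?_)
  have hr : 0 ≤ ‖ξ - η‖ ^ α := Real.rpow_nonneg (norm_nonneg _) _
  calc _ ≤ (C * ‖ξ - η‖ ^ α) * D + C * (D * ‖ξ - η‖ ^ α) :=
        add_le_add (mul_le_mul (h2 ξ η) (k1 ξ) (norm_nonneg _) (by positivity))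
          (mul_le_mul (h1 η) (k2 ξ η) (norm_nonneg _) hC)
    _ = _ := by ring

end Closure

theorem bddHolder_phase {α : ℝ} (hα : 0 < α) (hα1 : α ≤ 1) (μ : Vertex) :
    BddHolder α fun ξ => phase ξ μ := by
  have hb : 0 ≤ bracket μ := by linarith [one_le_bracket μ]
  have hπ := Real.pi_pos
  have h0 : 0 ≤ 2 * (2 * Real.pi) ^ α * bracket μ ^ α := by positivity
  refine ⟨1 + 2 * (2 * Real.pi) ^ α * bracket μ ^ α, by positivity, fun ξ => ?_, fun ξ η => ?_⟩
  · rw [norm_phase]; linarith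
  · refine (norm_phase_sub_le hα hα1 ξ η μ).trans ?_
    have hr : 0 ≤ ‖ξ - η‖ ^ α := Real.rpow_nonneg (norm_nonneg _) _
    nlinarith

/-- By Parseval the squared distance is `∑ |e^{2πiξ·μ} - e^{2πiη·μ}|² v_j(μ)`, which the
interpolated phase bound controls by `‖ξ - η‖^{2α}` times the moment of order `2α`. -/
theorem bddHolder_shifted {V : Potential} {j : Fin 3} {β α : ℝ} (hV : V.Decay j β) (hα : 0 < α)
    (hα1 : α ≤ 1) (hαβ : α < β) : BddHolder α (shifted V j) := by
  have hsum := summable_moment hV hα.le hαβ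
  set S := ∑' μ, V.v j μ * bracket μ ^ (2 * α) with hS
  have hS0 : 0 ≤ S := tsum_nonneg fun μ => mul_nonneg (V.v_nonneg j μ)
    (Real.rpow_nonneg (by linarith [one_le_bracket μ]) _)
  have hπ := Real.pi_pos
  have hnorm : ∀ ξ, ‖shifted V j ξ‖ = ‖V.g j‖ := fun ξ => by
    rw [shifted, LinearIsometryEquiv.norm_map, lp.norm_eq_tsum_rpow (by norm_num),
      lp.norm_eq_tsum_rpow (by norm_num)]
    congr 1
    refine tsum_congr fun μ => ?_
    change ‖phase ξ μ * (√(V.v j μ) : ℂ)‖ ^ _ = ‖(√(V.v j μ) : ℂ)‖ ^ _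
    rw [norm_mul, norm_phase, one_mul]
  set K := 2 * (2 * Real.pi) ^ α * √S with hK
  have hK0 : 0 ≤ K := by positivity
  refine ⟨‖V.g j‖ + K, by positivity, fun ξ => by rw [hnorm]; linarith, fun ξ η => ?_⟩
  have hr : 0 ≤ ‖ξ - η‖ ^ α := Real.rpow_nonneg (norm_nonneg _) _
  have hmain : ‖shifted V j ξ - shifted V j η‖ ^ 2 ≤ (K * ‖ξ - η‖ ^ α) ^ 2 := by
    rw [shifted, shifted, ← map_sub, LinearIsometryEquiv.norm_map]
    have h1 := lp.norm_rpow_eq_tsum (p := 2) (by norm_num) (modulated V j ξ - modulated V j η)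
    have h2 : ‖modulated V j ξ - modulated V j η‖ ^ 2 =
        ∑' μ, ‖(modulated V j ξ - modulated V j η) μ‖ ^ 2 := by simpa using h1
    have hsum2 : Summable fun μ => ‖(modulated V j ξ - modulated V j η) μ‖ ^ 2 :=
      memℓp_two_iff.1 (lp.memℓp _)
    rw [h2]
    have hpt : ∀ μ, ‖(modulated V j ξ - modulated V j η) μ‖ ^ 2 ≤
        (2 * (2 * Real.pi) ^ α * ‖ξ - η‖ ^ α) ^ 2 * (V.v j μ * bracket μ ^ (2 * α)) := by
      intro μ
      have hb : 0 ≤ bracket μ := by linarith [one_le_bracket μ]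
      have e : (modulated V j ξ - modulated V j η) μ =
          (phase ξ μ - phase η μ) * (√(V.v j μ) : ℂ) := by
        rw [sub_mul]; rfl
      rw [e, norm_mul, mul_pow, Complex.norm_real, Real.norm_of_nonneg (Real.sqrt_nonneg _),
        Real.sq_sqrt (V.v_nonneg j μ)]
      have h3 := pow_le_pow_left₀ (norm_nonneg _) (norm_phase_sub_le hα hα1 ξ η μ) 2
      have e2 : bracket μ ^ (2 * α) = (bracket μ ^ α) ^ 2 := by
        rw [mul_comm, Real.rpow_mul hb, Real.rpow_two]
      rw [e2]
      calc _ ≤ (2 * (2 * Real.pi) ^ α * ‖ξ - η‖ ^ α * bracket μ ^ α) ^ 2 * V.v j μ :=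
            mul_le_mul_of_nonneg_right h3 (V.v_nonneg j μ)
        _ = _ := by ring
    refine (hsum2.tsum_le_tsum hpt (hsum.mul_left _)).trans_eq ?_
    rw [tsum_mul_left, ← hS, hK, mul_pow (_ * √S), mul_pow _ (√S), Real.sq_sqrt hS0]
    ring
  have h4 := (pow_le_pow_iff_left₀ (norm_nonneg _) (mul_nonneg hK0 hr) two_ne_zero).1 hmain
  refine h4.trans ?_
  have : 0 ≤ ‖V.g j‖ * ‖ξ - η‖ ^ α := by positivity
  linarith

end Holder

/-! ### `T_{z,m}(ξ)` as a polynomial in `m + z` -/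

section Decomposition

/-- The inclusion of the `k`-th component of `L²(𝕋²; ℂ³)`. -/
def component (k : Fin 3) : L2T →L[ℂ] L2T3 :=
  (PiLp.continuousLinearEquiv 2 ℂ fun _ : Fin 3 => L2T).symm.toContinuousLinearMap ∘L
    ContinuousLinearMap.single ℂ (fun _ : Fin 3 => L2T) k

theorem toLp_eq_sum_component (h : Fin 3 → L2T) :
    (WithLp.toLp 2 h : L2T3) = component 0 (h 0) + (component 1 (h 1) + component 2 (h 2)) := by
  refine PiLp.ext fun k => ?_
  fin_cases k <;> simp [component]

/-- The vector `(ĝ₁(· - ξ), 0, 0)`. -/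
def vertVec (V : Potential) (ξ : Plane) : L2T3 := component 0 (shifted V 0 ξ)

/-- The vector `(0, \overline{a(ξ)} ĝ₂(· - ξ), \overline{b(ξ)} ĝ₃(· - ξ))`. -/
def edgeVec (V : Potential) (ξ : Plane) : L2T3 :=
  component 1 (conj (a ξ) • shifted V 1 ξ) + component 2 (conj (b ξ) • shifted V 2 ξ)

theorem leftVec_eq (V : Potential) (m : ℝ) (z : ℂ) (ξ : Plane) :
    leftVec V m z ξ = ((m : ℂ) + z) • vertVec V ξ + edgeVec V ξ := by
  rw [leftVec, toLp_eq_sum_component, vertVec, edgeVec, ← map_smul]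
  rfl

theorem rightVec_eq (V : Potential) (m : ℝ) (z : ℂ) (ξ : Plane) :
    rightVec V m z ξ = conj ((m : ℂ) + z) • vertVec V ξ + edgeVec V ξ := by
  rw [rightVec, toLp_eq_sum_component, vertVec, edgeVec, ← map_smul]
  rfl

/-- The coefficients of `T_{z,m}(ξ)` as a polynomial in `m + z`. -/
def traceCoeff (V : Potential) (ξ : Plane) : Fin 3 → TC :=
  ![TraceClass.rankOne (edgeVec V ξ) (edgeVec V ξ),
    TraceClass.rankOne (vertVec V ξ) (edgeVec V ξ) + TraceClass.rankOne (edgeVec V ξ) (vertVec V ξ),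
    TraceClass.rankOne (vertVec V ξ) (vertVec V ξ)]

/-- The conjugate of `m + z` in the right vector is undone by antilinearity, so the dependence on
`z` is polynomial. The coefficients do not depend on `z`, which lets the Plemelj formula act on
fixed densities although `J_z` varies with `z`. -/
theorem traceT_eq_sum (V : Potential) (m : ℝ) (z : ℂ) (ξ : Plane) :
    traceT V m z ξ = ∑ k : Fin 3, ((m : ℂ) + z) ^ (k : ℕ) • traceCoeff V ξ k := by
  refine TraceClass.ext_apply fun v => ?_
  rw [Fin.sum_univ_three, traceT]
  simp only [traceCoeff, Matrix.cons_val_zero, Matrix.cons_val_one, Matrix.cons_val, map_add,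
    map_smul, add_apply, smul_apply,
    TraceClass.incl_rankOne_apply, leftVec_eq, rightVec_eq, inner_add_left, inner_smul_left,
    Complex.conj_conj]
  simp only [Fin.val_zero, Fin.val_one, Fin.val_two, pow_zero, pow_one, one_smul]
  module

theorem a_eq_phase (ξ : Plane) : a ξ = -1 + phase ξ (Pi.single 0 (-1)) := by
  rw [a, phase]
  congr 2
  simp

theorem b_eq_phase (ξ : Plane) : b ξ = -1 + phase ξ (Pi.single 1 (-1)) := by
  rw [b, phase]
  congr 2
  simp

theorem bddHolder_traceCoeff {V : Potential} {α : ℝ} {β : Fin 3 → ℝ} (hV : ∀ j, V.Decay j (β j))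
    (hα : 0 < α) (hα1 : α ≤ 1) (hαβ : ∀ j, α < β j) (k : Fin 3) :
    BddHolder α fun ξ => traceCoeff V ξ k := by
  have hs : ∀ j, BddHolder α (shifted V j) := fun j => bddHolder_shifted (hV j) hα hα1 (hαβ j)
  have ha : BddHolder α a := by
    rw [show a = _ from funext a_eq_phase]
    exact (BddHolder.const _).add (bddHolder_phase hα hα1 _)
  have hb : BddHolder α b := by
    rw [show b = _ from funext b_eq_phase]
    exact (BddHolder.const _).add (bddHolder_phase hα hα1 _)
  have h0 : BddHolder α (vertVec V) := (hs 0).clm (component 0)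
  have h1 : BddHolder α (edgeVec V) :=
    ((ha.conj.smul (hs 1)).clm (component 1)).add ((hb.conj.smul (hs 2)).clm (component 2))
  fin_cases k
  · exact h1.rankOne h1
  · exact (h0.rankOne h1).add (h1.rankOne h0)
  · exact h0.rankOne h0

theorem bddHolder_traceT {V : Potential} {α : ℝ}
    (hT : ∀ k, BddHolder α fun ξ => traceCoeff V ξ k) (m : ℝ) (z : ℂ) :
    BddHolder α (traceT V m z) := by
  have h : ∀ k : Fin 3, BddHolder α fun ξ => ((m : ℂ) + z) ^ (k : ℕ) • traceCoeff V ξ k :=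
    fun k => (BddHolder.const _).smul (hT k)
  have := (h 0).add ((h 1).add (h 2))
  refine (congrArg (BddHolder α) (funext fun ξ => ?_)).mp this
  rw [traceT_eq_sum, Fin.sum_univ_three, add_assoc]

end Decomposition

/-! ### The operator `H₀` and its Fourier representation -/

section FourierRepresentation

open UnitAddTorus

/-- The shift `f ↦ f(· - ν)` on `ℓ²(ℤ²)`. -/
def shift (ν : Vertex) (f : Ell2 Vertex) : Ell2 Vertex :=
  ⟨fun μ => f (μ - ν), memℓp_comp (lp.memℓp f) (fun μ => μ - ν) (sub_left_injective)⟩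

theorem shift_apply (ν : Vertex) (f : Ell2 Vertex) (μ : Vertex) : shift ν f μ = f (μ - ν) := rfl

theorem inner_shift_left (ν : Vertex) (f g : Ell2 Vertex) :
    ⟪shift ν f, g⟫_ℂ = ⟪f, shift (-ν) g⟫_ℂ := by
  rw [lp.inner_eq_tsum, lp.inner_eq_tsum,
    ← (Equiv.subRight ν).tsum_eq (fun x => ⟪f x, shift (-ν) g x⟫_ℂ)]
  refine tsum_congr fun x => ?_
  simp [shift_apply]

theorem fourierT_shift (ν : Vertex) (f : Ell2 Vertex) :
    fourierT (shift ν f) =ᵐ[torusVol] fun x => mFourier (-ν) x * fourierT f x := by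
  have hmem : MemLp (fun x => mFourier (-ν) x * fourierT f x) 2 torusVol := by
    refine MemLp.of_le (Lp.memLp (fourierT f))
      ((mFourier (-ν)).continuous.aestronglyMeasurable.mul (Lp.aestronglyMeasurable _))
      (Eventually.of_forall fun x => ?_)
    rw [norm_mul]
    refine mul_le_of_le_one_left (norm_nonneg _) ?_
    exact ((mFourier (-ν)).norm_coe_le_norm x).trans_eq mFourier_norm
  have h : fourierT (shift ν f) = hmem.toLp := by
    have h0 : ∀ f, charBasis.repr (fourierT f) = f := charBasis.repr.apply_symm_apply
    apply charBasis.repr.injective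
    rw [h0]
    ext μ
    rw [charBasis_repr, shift_apply]
    have h1 : f (μ - ν) = charBasis.repr (fourierT f) (μ - ν) := by rw [h0]
    rw [h1, charBasis_repr]
    refine integral_congr_ae ?_
    filter_upwards [hmem.coeFn_toLp] with x hx
    rw [hx, sub_eq_add_neg, mFourier_add, mul_assoc]
  rw [h]
  exact hmem.coeFn_toLp

/-- For an absolutely summable sequence the series converges uniformly, so the `L²` transform is
represented by its pointwise sum. -/
theorem fourierT_of_summable {f : Ell2 Vertex} (hf : Summable fun μ => ‖f μ‖) :
    fourierT f =ᵐ[torusVol] fun x => ∑' μ, f μ * mFourier (-μ) x := by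
  have hs : Summable fun μ => f μ • mFourier (d := Fin 2) (-μ) := by
    refine Summable.of_norm (hf.congr fun μ => ?_)
    rw [norm_smul, mFourier_norm, mul_one]
  have h1 := (hs.hasSum).mapL (ContinuousMap.toLp (E := ℂ) 2 torusVol ℂ)
  have h2 : HasSum (fun μ => f μ • character μ) (fourierT f) := by
    have := charBasis.hasSum_repr_symm f
    simpa [charBasis, fourierT] using this
  have h3 : fourierT f = ContinuousMap.toLp (E := ℂ) 2 torusVol ℂ
      (∑' μ, f μ • mFourier (-μ)) := by
    refine h2.unique (h1.congr_fun fun μ => ?_)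
    rw [map_smul]
    rfl
  rw [h3]
  refine (ContinuousMap.coeFn_toLp (𝕜 := ℂ) torusVol _).trans (Eventually.of_forall fun x => ?_)
  have h4 := ContinuousMap.hasSum_apply hs.hasSum x
  simpa using h4.tsum_eq.symm

theorem cells_zero_H₀ (m : ℝ) (f : L2X) :
    cellEquiv (H₀ m f) 0 = (m : ℂ) • cellEquiv f 0 +
      (shift (Pi.single 0 1) (cellEquiv f 1) - cellEquiv f 1) +
      (shift (Pi.single 1 1) (cellEquiv f 2) - cellEquiv f 2) := by
  ext x
  change (H₀ m f).vert x = m * f.vert x + (f.edge (x - Pi.single 0 1, 0, 1) - f.edge (x, 0, 1)) +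
    (f.edge (x - Pi.single 1 1, 1, 1) - f.edge (x, 1, 1))
  have hu : (Finset.univ : Finset ℤˣ) = {1, -1} := by decide
  rw [H₀_vert, coboundaryAdj, Fintype.sum_prod_type, Fin.sum_univ_two, hu,
    Finset.sum_pair (by decide), Finset.sum_pair (by decide), L2X.slice_neg, L2X.slice_neg]
  ring

theorem cells_one_H₀ (m : ℝ) (f : L2X) :
    cellEquiv (H₀ m f) 1 = (shift (-Pi.single 0 1) (cellEquiv f 0) - cellEquiv f 0) -
      (m : ℂ) • cellEquiv f 1 := by
  ext x
  change (H₀ m f).edge (x, 0, 1) = (f.vert (x - -Pi.single 0 1) - f.vert x) - m * f.edge (x, 0, 1)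
  rw [H₀_edge, coboundary, sub_neg_eq_add]
  rfl

theorem cells_two_H₀ (m : ℝ) (f : L2X) :
    cellEquiv (H₀ m f) 2 = (shift (-Pi.single 1 1) (cellEquiv f 0) - cellEquiv f 0) -
      (m : ℂ) • cellEquiv f 2 := by
  ext x
  change (H₀ m f).edge (x, 1, 1) = (f.vert (x - -Pi.single 1 1) - f.vert x) - m * f.edge (x, 1, 1)
  rw [H₀_edge, coboundary, sub_neg_eq_add]
  rfl

theorem inner_eq_sum_cells (f g : L2X) : ⟪f, g⟫_ℂ = ∑ j, ⟪cellEquiv f j, cellEquiv g j⟫_ℂ := by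
  rw [← cellEquiv.inner_map_map, PiLp.inner_apply]

/-- On the cells, the blocks `d` and `d*` are differences built from mutually adjoint shifts. -/
theorem isSelfAdjoint_H₀ (m : ℝ) : IsSelfAdjoint (H₀ m) := by
  rw [ContinuousLinearMap.isSelfAdjoint_iff_isSymmetric]
  intro f g
  change ⟪H₀ m f, g⟫_ℂ = ⟪f, H₀ m g⟫_ℂ
  rw [inner_eq_sum_cells, inner_eq_sum_cells, Fin.sum_univ_three, Fin.sum_univ_three]
  simp only [cells_zero_H₀, cells_one_H₀, cells_two_H₀, inner_add_left, inner_sub_left,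
    inner_smul_left, inner_add_right, inner_sub_right, inner_smul_right, inner_shift_left, neg_neg,
    Complex.conj_ofReal]
  ring

theorem isUnit_H₀_sub {z : ℂ} (hz : z.im ≠ 0) (m : ℝ) :
    IsUnit (H₀ m - z • ContinuousLinearMap.id ℂ L2X) := by
  by_contra h
  have h1 : z ∈ spectrum ℂ (H₀ m) := by
    rw [spectrum.mem_iff]
    intro hu
    apply h
    rw [← IsUnit.neg_iff, neg_sub]
    exact hu
  exact hz ((isSelfAdjoint_H₀ m).im_eq_zero_of_mem_spectrum h1)

end FourierRepresentation

/-! ### The Fourier representation of `K(z)` -/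

section Sandwich

open UnitAddTorus

theorem measurePreserving_toTorus : MeasurePreserving (fun x : ℝ × ℝ => toTorus (toPlane x))
    (volume.restrict unitSquare) torusVol := by
  have h1 : ∀ _ : Fin 2, MeasurePreserving ((↑) : ℝ → UnitAddCircle)
      (volume.restrict (Ioc 0 (0 + 1))) AddCircle.haarAddCircle :=
    fun _ => by
      have h := UnitAddCircle.measurePreserving_mk 0
      rwa [AddCircle.volume_eq_smul_haarAddCircle, ENNReal.ofReal_one, one_smul] at h
  have h2 := measurePreserving_pi _ _ h1
  have h3 := (measurePreserving_finTwoArrow (volume.restrict (Ioc (0 : ℝ) (0 + 1)))).symm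
  have h4 := h2.comp h3
  have h5 : (volume.restrict (Ioc (0 : ℝ) (0 + 1))).prod (volume.restrict (Ioc (0 : ℝ) (0 + 1))) =
      volume.restrict unitSquare := by
    rw [zero_add, ← Measure.restrict_congr_set Ico_ae_eq_Ioc, Measure.prod_restrict]
    rfl
  rw [h5] at h4
  refine (congrArg (fun f => MeasurePreserving f _ _) (funext fun x => ?_)).mp h4
  funext i
  fin_cases i <;> rfl

theorem inner_eq_setIntegral (f g : L2T) : ⟪f, g⟫_ℂ = ∫ x in unitSquare,
    conj (f (toTorus (toPlane x))) * g (toTorus (toPlane x)) := by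
  have h := integral_map measurePreserving_toTorus.aemeasurable
    (f := fun x => ⟪f x, g x⟫_ℂ) (by
      rw [measurePreserving_toTorus.map_eq]
      exact (L2.integrable_inner (𝕜 := ℂ) f g).aestronglyMeasurable)
  rw [measurePreserving_toTorus.map_eq] at h
  rw [L2.inner_def, h]
  exact integral_congr_ae (Eventually.of_forall fun x => mul_comm _ _)

theorem integrable_conj_mul (f g : L2T) : IntegrableOn (fun x =>
    conj (f (toTorus (toPlane x))) * g (toTorus (toPlane x))) unitSquare := by
  have h := measurePreserving_toTorus.integrable_comp_of_integrable (L2.integrable_inner (𝕜 := ℂ) f g)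
  exact h.congr (Eventually.of_forall fun x => mul_comm _ _)

theorem conj_phase (ξ : Plane) (μ : Vertex) : conj (phase ξ μ) = phase ξ (-μ) := by
  rw [← mFourier_toTorus, ← mFourier_toTorus, mFourier_neg]

/-- A product of two square summable sequences is absolutely summable, so the transform of `V^{1/2}
f` has pointwise values. They are exactly the convolution functionals that make up `t_{z,m}(ξ)`. -/
theorem fourierT_sqrt_mul (V : Potential) (j : Fin 3) {f s : Ell2 Vertex}
    (hs : ∀ μ, s μ = (√(V.v j μ) : ℂ) * f μ) : ∀ᵐ x ∂(volume.restrict unitSquare),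
      fourierT s (toTorus (toPlane x)) = ⟪shifted V j (toPlane x), fourierT f⟫_ℂ := by
  have hsum : Summable fun μ => ‖s μ‖ := by
    refine (lp.summable_inner (𝕜 := ℂ) (V.g j) f).norm.congr fun μ => ?_
    rw [hs, RCLike.inner_apply, norm_mul, norm_mul, RCLike.norm_conj, mul_comm]
    rfl
  filter_upwards [measurePreserving_toTorus.quasiMeasurePreserving.ae
    (fourierT_of_summable hsum)] with x hx
  rw [hx, shifted, LinearIsometryEquiv.inner_map_map, lp.inner_eq_tsum]
  refine tsum_congr fun μ => ?_
  rw [RCLike.inner_apply, mFourier_toTorus, ← conj_phase, hs]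
  change _ = f μ * conj (phase (toPlane x) μ * (√(V.v j μ) : ℂ))
  rw [map_mul, Complex.conj_ofReal]
  ring

theorem cells_sqrtOp (V : Potential) (f : L2X) (j : Fin 3) (μ : Vertex) :
    cellEquiv (V.sqrtOp f) j μ = (√(V.v j μ) : ℂ) * cellEquiv f j μ := by
  refine Fin.cases rfl (fun i => rfl) j

theorem cells_op (V : Potential) (f : L2X) (j : Fin 3) (μ : Vertex) :
    cellEquiv (V.op f) j μ = (V.v j μ : ℂ) * cellEquiv f j μ := by
  refine Fin.cases rfl (fun i => rfl) j

theorem inner_sqrtOp_left (V : Potential) (f g : L2X) :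
    ⟪V.sqrtOp f, g⟫_ℂ = ⟪f, V.sqrtOp g⟫_ℂ := by
  rw [inner_eq_sum_cells, inner_eq_sum_cells]
  refine Finset.sum_congr rfl fun j _ => ?_
  rw [lp.inner_eq_tsum, lp.inner_eq_tsum]
  refine tsum_congr fun μ => ?_
  rw [cells_sqrtOp, cells_sqrtOp, RCLike.inner_apply, RCLike.inner_apply, map_mul,
    Complex.conj_ofReal]
  ring

theorem inner_op_cells (V : Potential) (f g : L2X) (j : Fin 3) :
    ⟪cellEquiv f j, cellEquiv (V.op g) j⟫_ℂ =
      ⟪cellEquiv (V.sqrtOp f) j, cellEquiv (V.sqrtOp g) j⟫_ℂ := by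
  rw [lp.inner_eq_tsum, lp.inner_eq_tsum]
  refine tsum_congr fun μ => ?_
  rw [cells_sqrtOp, cells_sqrtOp, cells_op, RCLike.inner_apply, RCLike.inner_apply, map_mul,
    Complex.conj_ofReal]
  have h : (V.v j μ : ℂ) = (√(V.v j μ) : ℂ) * (√(V.v j μ) : ℂ) := by
    rw [← Complex.ofReal_mul, Real.mul_self_sqrt (V.v_nonneg j μ)]
  rw [h]
  ring

theorem mFourier_neg_single_zero (ξ : Plane) :
    mFourier (-Pi.single 0 1) (toTorus ξ) = 1 + a ξ := by
  rw [mFourier_toTorus, a_eq_phase, Pi.single_neg]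
  ring

theorem mFourier_neg_single_one (ξ : Plane) :
    mFourier (-Pi.single 1 1) (toTorus ξ) = 1 + b ξ := by
  rw [mFourier_toTorus, b_eq_phase, Pi.single_neg]
  ring

theorem mFourier_single_zero (ξ : Plane) :
    mFourier (Pi.single 0 1) (toTorus ξ) = 1 + conj (a ξ) := by
  rw [← neg_neg (Pi.single 0 1 : Vertex), mFourier_neg, mFourier_neg_single_zero]
  simp

theorem mFourier_single_one (ξ : Plane) :
    mFourier (Pi.single 1 1) (toTorus ξ) = 1 + conj (b ξ) := by
  rw [← neg_neg (Pi.single 1 1 : Vertex), mFourier_neg, mFourier_neg_single_one]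
  simp

/-- A shift multiplies the transform by a character, so the difference operators become
multiplication by `a`, `b` or their conjugates. -/
theorem fourierT_H₀ (m : ℝ) (f : L2X) : ∀ᵐ x ∂(volume.restrict unitSquare),
    let F : Fin 3 → ℂ := fun j => fourierT (cellEquiv f j) (toTorus (toPlane x))
    let G : Fin 3 → ℂ := fun j => fourierT (cellEquiv (H₀ m f) j) (toTorus (toPlane x))
    G 0 = m * F 0 + a (toPlane x) * F 1 + b (toPlane x) * F 2 ∧
      G 1 = conj (a (toPlane x)) * F 0 - m * F 1 ∧
      G 2 = conj (b (toPlane x)) * F 0 - m * F 2 := by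
  have key : ∀ᵐ y ∂torusVol,
      fourierT (cellEquiv (H₀ m f) 0) y = m * fourierT (cellEquiv f 0) y +
        (mFourier (-Pi.single 0 1) y * fourierT (cellEquiv f 1) y - fourierT (cellEquiv f 1) y) +
        (mFourier (-Pi.single 1 1) y * fourierT (cellEquiv f 2) y - fourierT (cellEquiv f 2) y) ∧
      fourierT (cellEquiv (H₀ m f) 1) y =
        (mFourier (Pi.single 0 1) y * fourierT (cellEquiv f 0) y - fourierT (cellEquiv f 0) y) -
          m * fourierT (cellEquiv f 1) y ∧
      fourierT (cellEquiv (H₀ m f) 2) y =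
        (mFourier (Pi.single 1 1) y * fourierT (cellEquiv f 0) y - fourierT (cellEquiv f 0) y) -
          m * fourierT (cellEquiv f 2) y := by
    have hs := fun (ν : Vertex) (j : Fin 3) => fourierT_shift ν (cellEquiv f j)
    have hd := fun (ν : Vertex) (j : Fin 3) =>
      Lp.coeFn_sub (fourierT (shift ν (cellEquiv f j))) (fourierT (cellEquiv f j))
    have hm := fun j : Fin 3 => Lp.coeFn_smul (m : ℂ) (fourierT (cellEquiv f j))
    rw [cells_zero_H₀, cells_one_H₀, cells_two_H₀]
    simp only [map_add, map_sub, map_smul]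
    filter_upwards [hs (Pi.single 0 1) 1, hs (Pi.single 1 1) 2, hs (-Pi.single 0 1) 0,
      hs (-Pi.single 1 1) 0, hd (Pi.single 0 1) 1, hd (Pi.single 1 1) 2, hd (-Pi.single 0 1) 0,
      hd (-Pi.single 1 1) 0, hm 0, hm 1, hm 2,
      Lp.coeFn_add ((m : ℂ) • fourierT (cellEquiv f 0) +
        (fourierT (shift (Pi.single 0 1) (cellEquiv f 1)) - fourierT (cellEquiv f 1)))
        (fourierT (shift (Pi.single 1 1) (cellEquiv f 2)) - fourierT (cellEquiv f 2)),
      Lp.coeFn_add ((m : ℂ) • fourierT (cellEquiv f 0))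
        (fourierT (shift (Pi.single 0 1) (cellEquiv f 1)) - fourierT (cellEquiv f 1)),
      Lp.coeFn_sub (fourierT (shift (-Pi.single 0 1) (cellEquiv f 0)) - fourierT (cellEquiv f 0))
        ((m : ℂ) • fourierT (cellEquiv f 1)),
      Lp.coeFn_sub (fourierT (shift (-Pi.single 1 1) (cellEquiv f 0)) - fourierT (cellEquiv f 0))
        ((m : ℂ) • fourierT (cellEquiv f 2))]
      with y s1 s2 s3 s4 d1 d2 d3 d4 m0 m1 m2 e1 e2 e3 e4
    refine ⟨?_, ?_, ?_⟩
    · rw [e1, Pi.add_apply, e2, Pi.add_apply, m0, d1, d2, Pi.sub_apply, Pi.sub_apply, s1, s2,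
        Pi.smul_apply, smul_eq_mul]
    · rw [e3, Pi.sub_apply, m1, d3, Pi.sub_apply, s3, Pi.smul_apply, smul_eq_mul, neg_neg]
    · rw [e4, Pi.sub_apply, m2, d4, Pi.sub_apply, s4, Pi.smul_apply, smul_eq_mul, neg_neg]
  filter_upwards [measurePreserving_toTorus.quasiMeasurePreserving.ae key] with x hx
  obtain ⟨h0, h1, h2⟩ := hx
  refine ⟨?_, ?_, ?_⟩
  · change fourierT (cellEquiv (H₀ m f) 0) (toTorus (toPlane x)) = _
    rw [h0, mFourier_neg_single_zero, mFourier_neg_single_one]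
    ring
  · change fourierT (cellEquiv (H₀ m f) 1) (toTorus (toPlane x)) = _
    rw [h1, mFourier_single_zero]
    ring
  · change fourierT (cellEquiv (H₀ m f) 2) (toTorus (toPlane x)) = _
    rw [h2, mFourier_single_one]
    ring

theorem ofReal_sub_sq_ne_zero {z : ℂ} (hz : z.im ≠ 0) {ρ : ℝ} (hρ : 0 ≤ ρ) :
    (ρ : ℂ) - z ^ 2 ≠ 0 := by
  intro h
  have h1 := congrArg Complex.re h
  have h2 := congrArg Complex.im h
  simp only [sq, Complex.sub_re, Complex.sub_im, Complex.ofReal_re, Complex.ofReal_im,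
    Complex.mul_re, Complex.mul_im, Complex.zero_re, Complex.zero_im] at h1 h2
  have h3 : z.re = 0 := by
    have : z.re * z.im = 0 := by linarith
    exact (mul_eq_zero.1 this).resolve_right hz
  have := mul_self_pos.2 hz
  rw [h3] at h1
  linarith

theorem r_nonneg (m : ℝ) (ξ : Plane) : 0 ≤ r m ξ := by
  rw [r]; positivity

end Sandwich

/-! ### Solving the resolvent equation in Fourier space -/

section Sandwich

theorem continuousOn_inv_sub_sq {z : ℂ} (hz : z.im ≠ 0) (m : ℝ) :
    ContinuousOn (fun ρ : ℝ => ((ρ : ℂ) - z ^ 2)⁻¹) (Icc (m ^ 2) (m ^ 2 + 8)) :=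
  ContinuousOn.inv₀ (by fun_prop) fun ρ hρ =>
    ofReal_sub_sq_ne_zero hz ((sq_nonneg m).trans hρ.1)

/-- A Schur complement: the combination `(m + z)u₀ + a u₁ + b u₂` eliminates `x₁` and `x₂` and
equals `(ρ - z²) x₀`. The two edge equations then give `(m + z) x₁ = conj a * x₀ - u₁` and `(m + z)
x₂ = conj b * x₀ - u₂`; the terms `-u₁`, `-u₂` are the source of `diag(0, -1, -1)`. -/
theorem resolvent_solve {m ρ : ℝ} {z a b x₀ x₁ x₂ u₀ u₁ u₂ h₀ h₁ h₂ : ℂ}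
    (hρ : ρ = m ^ 2 + ‖a‖ ^ 2 + ‖b‖ ^ 2) (hmz : (m : ℂ) + z ≠ 0) (hr : (ρ : ℂ) - z ^ 2 ≠ 0)
    (e₀ : m * x₀ + a * x₁ + b * x₂ - z * x₀ = u₀) (e₁ : conj a * x₀ - m * x₁ - z * x₁ = u₁)
    (e₂ : conj b * x₀ - m * x₂ - z * x₂ = u₂) :
    h₀ * x₀ + h₁ * x₁ + h₂ * x₂ = ((m : ℂ) + z)⁻¹ * (((ρ : ℂ) - z ^ 2)⁻¹ *
      (((m + z) * u₀ + a * u₁ + b * u₂) * ((m + z) * h₀ + conj a * h₁ + conj b * h₂)) -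
        h₁ * u₁ - h₂ * u₂) := by
  have hρ' : (ρ : ℂ) = m ^ 2 + a * conj a + b * conj b := by
    rw [Complex.mul_conj', Complex.mul_conj', hρ]
    push_cast
    ring
  have h0 : (m + z) * u₀ + a * u₁ + b * u₂ = ((ρ : ℂ) - z ^ 2) * x₀ := by
    rw [← e₀, ← e₁, ← e₂, hρ']
    ring
  rw [h0, mul_assoc ((ρ : ℂ) - z ^ 2), inv_mul_cancel_left₀ hr, ← e₁, ← e₂, eq_comm,
    inv_mul_eq_iff_eq_mul₀ hmz]
  ring

theorem fourierT_cellEquiv_symm (ψ : L2T3) (j : Fin 3) :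
    fourierT (cellEquiv (𝒰.symm ψ) j) = ψ j := by
  have h : 𝒰 (𝒰.symm ψ) j = ψ j := by rw [LinearIsometryEquiv.apply_symm_apply]
  exact h

theorem inner_conjU_apply (S : L2X →L[ℂ] L2X) (φ ψ : L2T3) :
    ⟪φ, conjU S ψ⟫_ℂ = ⟪𝒰.symm φ, S (𝒰.symm ψ)⟫_ℂ := by
  have h : conjU S ψ = 𝒰 (S (𝒰.symm ψ)) := rfl
  rw [h, ← 𝒰.inner_map_map (𝒰.symm φ), LinearIsometryEquiv.apply_symm_apply]

theorem inner_conjU_op_negEdgeProj (V : Potential) (φ ψ : L2T3) :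
    ⟪φ, (conjU V.op ∘L negEdgeProj) ψ⟫_ℂ =
      -⟪cellEquiv (V.sqrtOp (𝒰.symm φ)) 1, cellEquiv (V.sqrtOp (𝒰.symm ψ)) 1⟫_ℂ -
        ⟪cellEquiv (V.sqrtOp (𝒰.symm φ)) 2, cellEquiv (V.sqrtOp (𝒰.symm ψ)) 2⟫_ℂ := by
  have hc : ∀ j, cellEquiv (𝒰.symm (negEdgeProj ψ)) j =
      (![0, -1, -1] : Fin 3 → ℂ) j • cellEquiv (𝒰.symm ψ) j := by
    intro j
    apply fourierT.injective
    rw [map_smul, fourierT_cellEquiv_symm, fourierT_cellEquiv_symm]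
    rfl
  have hs : ∀ j, cellEquiv (V.sqrtOp (𝒰.symm (negEdgeProj ψ))) j =
      (![0, -1, -1] : Fin 3 → ℂ) j • cellEquiv (V.sqrtOp (𝒰.symm ψ)) j := by
    intro j
    ext μ
    rw [cells_sqrtOp, hc, lp.coeFn_smul, lp.coeFn_smul, Pi.smul_apply, Pi.smul_apply, cells_sqrtOp,
      smul_eq_mul, smul_eq_mul]
    ring
  rw [ContinuousLinearMap.comp_apply, inner_conjU_apply, inner_eq_sum_cells, Fin.sum_univ_three]
  simp only [inner_op_cells, hs, inner_smul_right]
  simp [sub_eq_add_neg]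

/-- Tested against `φ` and `ψ`, both sides are integrals over the fundamental square. With `u =
V^{1/2} 𝒰* ψ`, the transform of `X = (H₀ - z)⁻¹ u` solves the `3 × 3` system at almost every `ξ`,
and `resolvent_solve` identifies the integrands. -/
theorem conjU_K (V : Potential) {m : ℝ} {z : ℂ} (hz : z.im ≠ 0)
    (hT : Continuous (traceT V m z)) :
    conjU (K V m z) = ((m : ℂ) + z)⁻¹ • (conjU V.op ∘L negEdgeProj + TraceClass.incl
      (∫ x in unitSquare, ((r m (toPlane x) : ℂ) - z ^ 2)⁻¹ • traceT V m z (toPlane x))) := by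
  have hmz : (m : ℂ) + z ≠ 0 := fun h => hz (by simpa using congrArg Complex.im h)
  have hint := integrableOn_unitSquare hT m (continuousOn_inv_sub_sq hz m)
  refine ContinuousLinearMap.ext fun ψ => ext_inner_left ℂ fun φ => ?_
  set f := 𝒰.symm ψ with hf
  set g := 𝒰.symm φ with hg
  set u := V.sqrtOp f with hu
  set h := V.sqrtOp g with hh
  set X := Ring.inverse (H₀ m - z • ContinuousLinearMap.id ℂ L2X) u with hX
  have hres : H₀ m X = u + z • X := by
    have h1 := Ring.mul_inverse_cancel _ (isUnit_H₀_sub hz m)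
    have h2 := congrArg (fun S : L2X →L[ℂ] L2X => S u) h1
    exact sub_eq_iff_eq_add.1 h2
  have e1 : ⟪φ, conjU (K V m z) ψ⟫_ℂ = ∑ j, ∫ x in unitSquare,
      conj (fourierT (cellEquiv h j) (toTorus (toPlane x))) *
        fourierT (cellEquiv X j) (toTorus (toPlane x)) := by
    rw [inner_conjU_apply]
    change ⟪g, V.sqrtOp X⟫_ℂ = _
    rw [← inner_sqrtOp_left, inner_eq_sum_cells]
    refine Finset.sum_congr rfl fun j _ => ?_
    rw [← fourierT.inner_map_map, inner_eq_setIntegral]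
  set L : TC →L[ℂ] ℂ := innerSL ℂ φ ∘L
    ContinuousLinearMap.apply ℂ L2T3 ψ ∘L TraceClass.incl with hL
  have e2 : ⟪φ, TraceClass.incl (∫ x in unitSquare, ((r m (toPlane x) : ℂ) - z ^ 2)⁻¹ •
      traceT V m z (toPlane x)) ψ⟫_ℂ = ∫ x in unitSquare, ((r m (toPlane x) : ℂ) - z ^ 2)⁻¹ *
        (⟪rightVec V m z (toPlane x), ψ⟫_ℂ * ⟪φ, leftVec V m z (toPlane x)⟫_ℂ) := by
    change L _ = _
    rw [← L.integral_comp_comm hint]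
    refine integral_congr_ae (Eventually.of_forall fun x => ?_)
    simp only [map_smul, smul_eq_mul]
    congr 1
    change ⟪φ, TraceClass.incl (traceT V m z (toPlane x)) ψ⟫_ℂ = _
    rw [traceT, TraceClass.incl_rankOne_apply, inner_smul_right]
  have hint2 : IntegrableOn (fun x => ((r m (toPlane x) : ℂ) - z ^ 2)⁻¹ *
      (⟪rightVec V m z (toPlane x), ψ⟫_ℂ * ⟪φ, leftVec V m z (toPlane x)⟫_ℂ)) unitSquare := by
    refine (L.integrable_comp hint).congr (Eventually.of_forall fun x => ?_)
    simp only [map_smul, smul_eq_mul]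
    congr 1
    change ⟪φ, TraceClass.incl (traceT V m z (toPlane x)) ψ⟫_ℂ = _
    rw [traceT, TraceClass.incl_rankOne_apply, inner_smul_right]
  have hi := fun (v w : L2X) (j : Fin 3) =>
    integrable_conj_mul (fourierT (cellEquiv v j)) (fourierT (cellEquiv w j))
  have e3 : ∀ {A B C : ℝ × ℝ → ℂ} (c : ℂ), IntegrableOn A unitSquare → IntegrableOn B unitSquare →
      IntegrableOn C unitSquare → c * (-(∫ x in unitSquare, B x) - (∫ x in unitSquare, C x) +
        ∫ x in unitSquare, A x) = ∫ x in unitSquare, c * (A x - B x - C x) := by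
    intro A B C c hA hB hC
    rw [integral_const_mul, integral_sub (f := fun x => A x - B x) (hA.sub hB) hC,
      integral_sub hA hB]
    ring
  rw [e1, ← integral_finsetSum _ fun j _ => hi h X j, smul_apply, add_apply, inner_smul_right,
    inner_add_right, e2, inner_conjU_op_negEdgeProj, ← fourierT.inner_map_map,
    ← fourierT.inner_map_map (cellEquiv _ 2), inner_eq_setIntegral, inner_eq_setIntegral,
    e3 _ hint2 (hi h u 1) (hi h u 2)]
  refine integral_congr_ae ?_
  have hcoe : ∀ j, ∀ᵐ x ∂(volume.restrict unitSquare),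
      fourierT (cellEquiv (H₀ m X) j) (toTorus (toPlane x)) =
        fourierT (cellEquiv u j) (toTorus (toPlane x)) +
          z * fourierT (cellEquiv X j) (toTorus (toPlane x)) := by
    intro j
    have h1 : fourierT (cellEquiv (H₀ m X) j) =
        fourierT (cellEquiv u j) + z • fourierT (cellEquiv X j) := by
      rw [hres, map_add, map_smul, PiLp.add_apply, PiLp.smul_apply, map_add, map_smul]
    rw [h1]
    filter_upwards [measurePreserving_toTorus.quasiMeasurePreserving.ae (Lp.coeFn_add
      (fourierT (cellEquiv u j)) (z • fourierT (cellEquiv X j))),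
      measurePreserving_toTorus.quasiMeasurePreserving.ae (Lp.coeFn_smul z
        (fourierT (cellEquiv X j)))] with x h2 h3
    rw [h2, Pi.add_apply, h3]
    rfl
  have hU := fun j => fourierT_sqrt_mul V j (cells_sqrtOp V f j)
  have hH := fun j => fourierT_sqrt_mul V j (cells_sqrtOp V g j)
  filter_upwards [fourierT_H₀ m X, hcoe 0, hcoe 1, hcoe 2, hU 0, hU 1, hU 2, hH 0, hH 1, hH 2]
    with x hx c0 c1 c2 u0 u1 u2 h0 h1 h2
  obtain ⟨x0, x1, x2⟩ := hx
  have hkey := resolvent_solve (m := m) (z := z) (ρ := r m (toPlane x))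
    (h₀ := conj (fourierT (cellEquiv h 0) (toTorus (toPlane x))))
    (h₁ := conj (fourierT (cellEquiv h 1) (toTorus (toPlane x))))
    (h₂ := conj (fourierT (cellEquiv h 2) (toTorus (toPlane x))))
    (u₀ := fourierT (cellEquiv u 0) (toTorus (toPlane x)))
    (u₁ := fourierT (cellEquiv u 1) (toTorus (toPlane x)))
    (u₂ := fourierT (cellEquiv u 2) (toTorus (toPlane x))) rfl hmz
    (ofReal_sub_sq_ne_zero hz (r_nonneg m _))
    (sub_eq_iff_eq_add.2 (x0.symm.trans c0)) (sub_eq_iff_eq_add.2 (x1.symm.trans c1))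
    (sub_eq_iff_eq_add.2 (x2.symm.trans c2))
  have hR : ⟪rightVec V m z (toPlane x), ψ⟫_ℂ =
      (m + z) * fourierT (cellEquiv u 0) (toTorus (toPlane x)) +
      a (toPlane x) * fourierT (cellEquiv u 1) (toTorus (toPlane x)) +
      b (toPlane x) * fourierT (cellEquiv u 2) (toTorus (toPlane x)) := by
    rw [u0, u1, u2, hf, fourierT_cellEquiv_symm, fourierT_cellEquiv_symm, fourierT_cellEquiv_symm,
      PiLp.inner_apply, Fin.sum_univ_three]
    simp [rightVec, coef, inner_smul_left]
  have hLft : ⟪φ, leftVec V m z (toPlane x)⟫_ℂ =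
      (m + z) * conj (fourierT (cellEquiv h 0) (toTorus (toPlane x))) +
      conj (a (toPlane x)) * conj (fourierT (cellEquiv h 1) (toTorus (toPlane x))) +
      conj (b (toPlane x)) * conj (fourierT (cellEquiv h 2) (toTorus (toPlane x))) := by
    rw [h0, h1, h2, hg, fourierT_cellEquiv_symm, fourierT_cellEquiv_symm, fourierT_cellEquiv_symm,
      PiLp.inner_apply, Fin.sum_univ_three]
    simp [leftVec, coefDag, inner_smul_right]
  simp only [hR, hLft, Fin.sum_univ_three]
  exact hkey

end Sandwich

/-! ### Level-curve integrals as functions of the level -/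

section Level

/-- `ρ` is not a critical value of `r_m`. -/
def RegularLevel (m ρ : ℝ) : Prop := ρ ≠ m ^ 2 ∧ ρ ≠ m ^ 2 + 4 ∧ ρ ≠ m ^ 2 + 8

theorem RegularLevel.eq_levelValue {m ρ : ℝ} (h : RegularLevel m ρ)
    (hρ : ρ ∈ Icc (m ^ 2) (m ^ 2 + 8)) :
    ∃ κ, ∃ τ ∈ Ioo (0 : ℝ) 1, levelValue m κ τ = ρ := by
  have h1 : m ^ 2 < ρ := lt_of_le_of_ne hρ.1 h.1.symm
  have h2 : ρ < m ^ 2 + 8 := lt_of_le_of_ne hρ.2 h.2.2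
  rcases lt_or_gt_of_ne h.2.1 with h3 | h3
  · exact ⟨false, ((levelValue_image m).1 ▸ (⟨h1, h3⟩ : ρ ∈ Ioo _ _) :
      ρ ∈ levelValue m false '' Ioo 0 1)⟩
  · exact ⟨true, ((levelValue_image m).2 ▸ (⟨h3, h2⟩ : ρ ∈ Ioo _ _) :
      ρ ∈ levelValue m true '' Ioo 0 1)⟩

theorem ae_ne (c : ℝ) : ∀ᵐ y : ℝ, y ≠ c := by simp [ae_iff]

theorem ae_regularLevel (m : ℝ) : ∀ᵐ ρ : ℝ, RegularLevel m ρ := by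
  filter_upwards [ae_ne (m ^ 2), ae_ne (m ^ 2 + 4), ae_ne (m ^ 2 + 8)] with ρ h1 h2 h3
  exact ⟨h1, h2, h3⟩

theorem ae_sq_ne (c : ℝ) : ∀ᵐ u : ℝ, u ^ 2 ≠ c := by
  filter_upwards [ae_ne (√c), ae_ne (-√c)] with u h1 h2 h
  have h3 : u ^ 2 = √c ^ 2 := by rw [Real.sq_sqrt (h ▸ sq_nonneg u), h]
  exact (sq_eq_sq_iff_eq_or_eq_neg.1 h3).elim h1 h2

theorem ae_regularLevel_sq (m : ℝ) : ∀ᵐ u : ℝ, RegularLevel m (u ^ 2) := by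
  filter_upwards [ae_sq_ne (m ^ 2), ae_sq_ne (m ^ 2 + 4), ae_sq_ne (m ^ 2 + 8)] with ρ h1 h2 h3
  exact ⟨h1, h2, h3⟩

theorem abs_eq_sqrt_of_sq_eq {x c : ℝ} (h : x ^ 2 = c) : x = √c ∨ x = -√c := by
  refine sq_eq_sq_iff_eq_or_eq_neg.1 ?_
  rw [Real.sq_sqrt (h ▸ sq_nonneg x), h]

theorem regularLevel_sq {m lam : ℝ} (hlam : lam ∉ thresholds m) : RegularLevel m (lam ^ 2) := by
  simp only [thresholds, mem_insert_iff, mem_singleton_iff, not_or] at hlam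
  obtain ⟨h1, h2, h3, h4, h5, h6⟩ := hlam
  exact ⟨fun h => (sq_eq_sq_iff_eq_or_eq_neg.1 h).elim h1 h2,
    fun h => (abs_eq_sqrt_of_sq_eq h).elim h3 h4, fun h => (abs_eq_sqrt_of_sq_eq h).elim h5 h6⟩

variable {E : Type*} [NormedAddCommGroup E] [NormedSpace ℂ E]

theorem levelInt_eq_zero {m ρ : ℝ} (hρ : ρ ∉ Icc (m ^ 2) (m ^ 2 + 8)) (F : Plane → E) :
    levelInt m F ρ = 0 := by
  rw [levelInt, curveMeasure_eq_zero hρ, integral_zero_measure]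

theorem RegularLevel.integrable [CompleteSpace E] {F : Plane → E} (hF : Continuous F) {C : ℝ}
    (hC : ∀ ξ, ‖F ξ‖ ≤ C) {m ρ : ℝ} (hρ : RegularLevel m ρ) :
    Integrable (fun ξ => ((‖gradient (r m) ξ‖⁻¹ : ℝ) : ℂ) • F ξ) (curveMeasure m ρ) := by
  by_cases h : ρ ∈ Icc (m ^ 2) (m ^ 2 + 8)
  · obtain ⟨κ, τ, hτ, rfl⟩ := hρ.eq_levelValue h
    exact (levelInt_levelValue hF hC m κ hτ).1
  · rw [curveMeasure_eq_zero h]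
    exact integrable_zero_measure

/-- Within the band `levelValue` is affine of slope `±4`, so `levelInt_holder` applies after
rescaling. Outside the band the level set is empty for all nearby levels. -/
theorem RegularLevel.holder [CompleteSpace E] {α : ℝ} (hα : 0 < α) (hα1 : α ≤ 1) {F : Plane → E}
    (hF : BddHolder α F) {m ρ₀ : ℝ} (hρ : RegularLevel m ρ₀) :
    ∃ C, 0 ≤ C ∧ ∃ η > 0, ∀ ρ, |ρ - ρ₀| < η →
      ‖levelInt m F ρ - levelInt m F ρ₀‖ ≤ C * |ρ - ρ₀| ^ (α / 2) := by
  by_cases h : ρ₀ ∈ Icc (m ^ 2) (m ^ 2 + 8)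
  · obtain ⟨κ, τ₀, hτ₀, rfl⟩ := hρ.eq_levelValue h
    obtain ⟨C, η, hη, hC⟩ := levelInt_holder hα hα1 hF m κ hτ₀
    refine ⟨|C| * (1 / 4) ^ (α / 2), by positivity, 4 * η, by positivity, fun ρ hρη => ?_⟩
    obtain ⟨τ, rfl⟩ : ∃ τ, levelValue m κ τ = ρ := by
      cases κ
      · exact ⟨(ρ - m ^ 2) / 4, by simp only [levelValue, Bool.false_eq_true, if_false]; ring⟩
      · exact ⟨(m ^ 2 + 8 - ρ) / 4, by simp only [levelValue, if_true]; ring⟩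
    have hd : |levelValue m κ τ - levelValue m κ τ₀| = 4 * |τ - τ₀| := by
      cases κ
      · simp only [levelValue, Bool.false_eq_true, if_false]
        rw [show m ^ 2 + 4 * τ - (m ^ 2 + 4 * τ₀) = 4 * (τ - τ₀) by ring, abs_mul]
        norm_num
      · simp only [levelValue, if_true]
        rw [show m ^ 2 + 8 - 4 * τ - (m ^ 2 + 8 - 4 * τ₀) = -(4 * (τ - τ₀)) by ring, abs_neg,
          abs_mul]
        norm_num
    rw [hd] at hρη ⊢
    refine (hC τ (by linarith)).2.trans ?_
    rw [mul_assoc, ← Real.mul_rpow (by norm_num) (by positivity), ← mul_assoc]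
    norm_num only [one_mul]
    exact mul_le_mul_of_nonneg_right (le_abs_self C) (by positivity)
  · obtain ⟨η, hη, hball⟩ := Metric.isOpen_iff.1 (isClosed_Icc.isOpen_compl) ρ₀ h
    refine ⟨0, le_rfl, η, hη, fun ρ hρη => ?_⟩
    have h1 : ρ ∉ Icc (m ^ 2) (m ^ 2 + 8) := hball (by rwa [Metric.mem_ball, Real.dist_eq])
    rw [levelInt_eq_zero h, levelInt_eq_zero h1, sub_self, norm_zero, zero_mul]

theorem sq_image_Ioo {m : ℝ} (hm : 0 ≤ m) :
    (fun u : ℝ => u ^ 2) '' Ioo m (√(m ^ 2 + 8)) = Ioo (m ^ 2) (m ^ 2 + 8) := by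
  ext ρ
  constructor
  · rintro ⟨u, hu, rfl⟩
    exact ⟨pow_lt_pow_left₀ hu.1 hm two_ne_zero,
      (Real.lt_sqrt (hm.trans hu.1.le)).1 hu.2⟩
  · intro hρ
    have h0 : 0 ≤ ρ := (sq_nonneg m).trans hρ.1.le
    exact ⟨√ρ, ⟨Real.lt_sqrt_of_sq_lt hρ.1, Real.sqrt_lt_sqrt h0 hρ.2⟩, Real.sq_sqrt h0⟩

theorem injOn_sq_Ioo {m : ℝ} (hm : 0 ≤ m) :
    InjOn (fun u : ℝ => u ^ 2) (Ioo m (√(m ^ 2 + 8))) := fun _ hx _ hy h =>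
  (pow_left_inj₀ (hm.trans hx.1.le) (hm.trans hy.1.le) two_ne_zero).1 h

theorem integrableOn_sq_iff {m : ℝ} (hm : 0 ≤ m) (h : ℝ → E) :
    IntegrableOn h (Ioc (m ^ 2) (m ^ 2 + 8)) ↔
      IntegrableOn (fun u : ℝ => ((2 * u : ℝ) : ℂ) • h (u ^ 2)) (Icc m (√(m ^ 2 + 8))) := by
  rw [integrableOn_Ioc_iff_integrableOn_Ioo, integrableOn_Icc_iff_integrableOn_Ioo,
    ← sq_image_Ioo hm, integrableOn_image_iff_integrableOn_abs_deriv_smul measurableSet_Ioo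
      (fun u _ => (hasDerivAt_pow 2 u).hasDerivWithinAt) (injOn_sq_Ioo hm)]
  refine integrableOn_congr_fun (fun u hu => ?_) measurableSet_Ioo
  have hu0 : 0 ≤ u := hm.trans hu.1.le
  simp only [Nat.cast_ofNat, Nat.add_one_sub_one, pow_one]
  rw [abs_of_nonneg (by positivity), Complex.coe_smul]

theorem integral_sq {m : ℝ} (hm : 0 ≤ m) (h : ℝ → E) :
    ∫ ρ in Ioc (m ^ 2) (m ^ 2 + 8), h ρ =
      ∫ u in Icc m (√(m ^ 2 + 8)), ((2 * u : ℝ) : ℂ) • h (u ^ 2) := by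
  rw [integral_Ioc_eq_integral_Ioo, integral_Icc_eq_integral_Ioo,
    ← sq_image_Ioo hm, integral_image_eq_integral_abs_deriv_smul measurableSet_Ioo
      (fun u _ => (hasDerivAt_pow 2 u).hasDerivWithinAt) (injOn_sq_Ioo hm)]
  refine setIntegral_congr_fun measurableSet_Ioo (fun u hu => ?_)
  have hu0 : 0 ≤ u := hm.trans hu.1.le
  simp only [Nat.cast_ofNat, Nat.add_one_sub_one, pow_one]
  rw [abs_of_nonneg (by positivity), Complex.coe_smul]

/-- The function `2u J(u²)` on `[m, M_m]`. -/
def sqDensity (m : ℝ) (F : Plane → E) : ℝ → E :=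
  (Icc m (√(m ^ 2 + 8))).indicator fun u => ((2 * u : ℝ) : ℂ) • levelInt m F (u ^ 2)

/-- Beyond `M_m` the level set is empty, so the cutoff at the upper endpoint is automatic and
creates no discontinuity; only the one at `m` has to be watched. -/
theorem sqDensity_of_le {m : ℝ} (F : Plane → E) {u : ℝ} (hu : m ≤ u) :
    sqDensity m F u = ((2 * u : ℝ) : ℂ) • levelInt m F (u ^ 2) := by
  by_cases h : u ∈ Icc m (√(m ^ 2 + 8))
  · rw [sqDensity, indicator_of_mem h]
  · rw [sqDensity, indicator_of_notMem h, levelInt_eq_zero, smul_zero]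
    intro h1
    exact h ⟨hu, Real.le_sqrt_of_sq_le h1.2⟩

theorem sqDensity_of_lt {m : ℝ} (F : Plane → E) {u : ℝ} (hu : u < m) : sqDensity m F u = 0 :=
  indicator_of_notMem (fun h => absurd h.1 (not_le.2 hu)) _

/-- Division by `2u₀` undoes the Jacobian of `ρ = u²`, so the point term of the Plemelj formula is
the level integral itself. Below `m` both sides vanish. -/
theorem sqDensity_self {m u₀ : ℝ} (hm : 0 ≤ m) (F : Plane → E) (h0 : 0 ≤ u₀) (hne : u₀ ≠ m) :
    ((u₀ + u₀ : ℝ) : ℂ)⁻¹ • sqDensity m F u₀ = levelInt m F (u₀ ^ 2) := by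
  rcases lt_or_gt_of_ne hne with h | h
  · rw [sqDensity_of_lt F h, smul_zero, levelInt_eq_zero]
    exact fun h1 => absurd h1.1 (not_le.2 (pow_lt_pow_left₀ h h0 two_ne_zero))
  · have hu : (0 : ℝ) < u₀ := hm.trans_lt h
    rw [sqDensity_of_le F h.le, smul_smul, two_mul, inv_mul_cancel₀, one_smul]
    exact Complex.ofReal_ne_zero.2 (by positivity)

theorem sqDensity_holder [CompleteSpace E] {α : ℝ} (hα : 0 < α) (hα1 : α ≤ 1) {F : Plane → E}
    (hF : BddHolder α F) {m u₀ : ℝ} (hm : 0 ≤ m) (h0 : 0 ≤ u₀) (hreg : RegularLevel m (u₀ ^ 2)) :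
    ∃ C, ∃ η > 0, ∀ u, |u - u₀| < η →
      ‖((u + u₀ : ℝ) : ℂ)⁻¹ • sqDensity m F u - ((u₀ + u₀ : ℝ) : ℂ)⁻¹ • sqDensity m F u₀‖ ≤
        C * |u - u₀| ^ (α / 2) := by
  have hne : u₀ ≠ m := fun h => hreg.1 (by rw [h])
  rcases lt_or_gt_of_ne hne with h | h
  · refine ⟨0, m - u₀, sub_pos.2 h, fun u hu => ?_⟩
    have h1 : u < m := by linarith [(abs_lt.1 hu).2]
    rw [sqDensity_of_lt F h1, sqDensity_of_lt F h, smul_zero, smul_zero, sub_self, norm_zero,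
      zero_mul]
  have hu₀ : (0 : ℝ) < u₀ := hm.trans_lt h
  obtain ⟨C, hC0, η, hη, hC⟩ := hreg.holder hα hα1 hF
  set L := levelInt m F (u₀ ^ 2) with hL
  -- The three radii bound `u + u₀` by `2u₀ + 1`, keep `u` above `m`, and keep `u²` in the range of
  -- the Hölder estimate. The constant collects the variation of the level integral and that of
  -- `2u/(u + u₀) = 1 + (u - u₀)/(u + u₀)`.
  refine ⟨2 * (C * (2 * u₀ + 1) ^ (α / 2)) + ‖L‖ / u₀,
    min (min 1 (u₀ - m)) (η / (2 * u₀ + 1)), ?_, fun u hu => ?_⟩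
  · have := sub_pos.2 h
    positivity
  obtain ⟨⟨h1, h2⟩, h3⟩ := (lt_min_iff.trans (and_congr_left' lt_min_iff)).1 hu
  have hum : m < u := by linarith [(abs_lt.1 h2).1]
  have hu0 : 0 < u := hm.trans_lt hum
  have hd : |u ^ 2 - u₀ ^ 2| ≤ (2 * u₀ + 1) * |u - u₀| := by
    rw [show u ^ 2 - u₀ ^ 2 = (u + u₀) * (u - u₀) by ring, abs_mul,
      abs_of_pos (by positivity : 0 < u + u₀)]
    have := (abs_lt.1 h1).2
    exact mul_le_mul_of_nonneg_right (by linarith) (abs_nonneg _)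
  have hdη : |u ^ 2 - u₀ ^ 2| < η := by
    refine hd.trans_lt ?_
    rw [lt_div_iff₀ (by positivity)] at h3
    linarith
  rw [sqDensity_self hm F h0 hne, sqDensity_of_le F hum.le, smul_smul]
  have e : ((u + u₀ : ℝ) : ℂ)⁻¹ * ((2 * u : ℝ) : ℂ) = ((2 * u / (u + u₀) : ℝ) : ℂ) := by
    push_cast
    ring
  have e2 : ((2 * u / (u + u₀) : ℝ) : ℂ) • levelInt m F (u ^ 2) - L =
      ((2 * u / (u + u₀) : ℝ) : ℂ) • (levelInt m F (u ^ 2) - L) +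
        (((u - u₀) / (u + u₀) : ℝ) : ℂ) • L := by
    have : ((2 * u / (u + u₀) : ℝ) : ℂ) = 1 + (((u - u₀) / (u + u₀) : ℝ) : ℂ) := by
      rw [← Complex.ofReal_one, ← Complex.ofReal_add]
      congr 1
      field_simp
      ring
    rw [this]
    module
  rw [e, e2]
  refine (norm_add_le _ _).trans ?_
  rw [norm_smul, norm_smul, Complex.norm_real, Complex.norm_real, Real.norm_eq_abs, Real.norm_eq_abs,
    abs_div, abs_div, abs_of_pos (by positivity : 0 < u + u₀),
    abs_of_pos (by positivity : 0 < 2 * u), add_mul]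
  have hx : |u - u₀| ≤ |u - u₀| ^ (α / 2) := by
    rcases (abs_nonneg (u - u₀)).eq_or_lt with hz | hz
    · rw [← hz, Real.zero_rpow (by positivity)]
    · calc |u - u₀| = |u - u₀| ^ (1 : ℝ) := (Real.rpow_one _).symm
        _ ≤ _ := Real.rpow_le_rpow_of_exponent_ge hz h1.le (by linarith)
  refine add_le_add ?_ ?_
  · have hle : 2 * u / (u + u₀) ≤ 2 := by
      rw [div_le_iff₀ (by positivity)]
      linarith
    have h5 : ‖levelInt m F (u ^ 2) - L‖ ≤ C * ((2 * u₀ + 1) ^ (α / 2) * |u - u₀| ^ (α / 2)) := by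
      refine (hC _ hdη).trans (mul_le_mul_of_nonneg_left ?_ hC0)
      rw [← Real.mul_rpow (by positivity) (abs_nonneg _)]
      exact Real.rpow_le_rpow (abs_nonneg _) hd (by positivity)
    calc _ ≤ 2 * (C * ((2 * u₀ + 1) ^ (α / 2) * |u - u₀| ^ (α / 2))) :=
          mul_le_mul hle h5 (norm_nonneg _) zero_le_two
      _ = _ := by ring
  · calc |u - u₀| / (u + u₀) * ‖L‖ ≤ |u - u₀| ^ (α / 2) / u₀ * ‖L‖ := by
          gcongr
          linarith
      _ = _ := by ring

end Level

/-! ### Boundary values -/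

section BoundaryValue

variable {E : Type*} [NormedAddCommGroup E] [NormedSpace ℂ E]

theorem indicator_pv_eq (m lam : ℝ) (F : Plane → E) (u : ℝ) :
    ((u ^ 2 - |lam| ^ 2 : ℝ) : ℂ)⁻¹ • sqDensity m F u = (Icc m (√(m ^ 2 + 8))).indicator
      (fun u => ((2 * u / (u ^ 2 - lam ^ 2) : ℝ) : ℂ) • levelInt m F (u ^ 2)) u := by
  by_cases h : u ∈ Icc m (√(m ^ 2 + 8))
  · rw [sqDensity, indicator_of_mem h, indicator_of_mem h, smul_smul, sq_abs]
    congr 1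
    push_cast
    ring
  · rw [sqDensity, indicator_of_notMem h, indicator_of_notMem h, smul_zero]

theorem pvDomain_eq (m lam ε : ℝ) :
    pvDomain m lam ε = Icc m (√(m ^ 2 + 8)) ∩ {u | ε < |u - (|lam|)|} := rfl

/-- Boundary values of the Cauchy type integrals of level-curve integrals. -/
theorem boundaryValue [CompleteSpace E] {α : ℝ} (hα : 0 < α) (hα1 : α ≤ 1) {F : Plane → E}
    (hF : BddHolder α F) {m lam : ℝ} (hm : 0 ≤ m) (hlam : lam ∉ thresholds m) :
    ∃ P : E,
      (∀ ε > 0, IntegrableOn (fun u : ℝ => ((2 * u / (u ^ 2 - lam ^ 2) : ℝ) : ℂ) •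
        levelInt m F (u ^ 2)) (pvDomain m lam ε)) ∧
      Tendsto (fun ε : ℝ => ∫ u in pvDomain m lam ε, ((2 * u / (u ^ 2 - lam ^ 2) : ℝ) : ℂ) •
        levelInt m F (u ^ 2)) (𝓝[>] 0) (𝓝 P) ∧
      Tendsto (fun δ : ℝ => ∫ ρ in Ioc (m ^ 2) (m ^ 2 + 8),
          ((ρ : ℂ) - ((lam : ℂ) + δ * Complex.I) ^ 2)⁻¹ • levelInt m F ρ) (𝓝[>] 0)
        (𝓝 (P + (Complex.I * Real.pi * SignType.sign lam) • levelInt m F (lam ^ 2))) := by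
  have hcont := hF.continuous hα
  obtain ⟨D, hD⟩ : ∃ D, ∀ ξ, ‖F ξ‖ ≤ D := by
    obtain ⟨D, _, h, _⟩ := hF
    exact ⟨D, h⟩
  have hreg : RegularLevel m (|lam| ^ 2) := by
    rw [sq_abs]
    exact regularLevel_sq hlam
  have hg : Integrable (sqDensity m F) := by
    have h1 := (coarea hcont hD m (φ := fun _ => 1) continuousOn_const).1
    simp only [one_smul] at h1
    exact (integrable_indicator_iff measurableSet_Icc).2 ((integrableOn_sq_iff hm _).1 h1)
  -- The numbers `m` and `λ` cannot both vanish, since `m` is itself a threshold.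
  have hpos : 0 < m + |lam| := by
    rcases hm.eq_or_lt with h | h
    · have : lam ≠ 0 := by
        rintro rfl
        exact hreg.1 (by rw [abs_zero, ← h])
      rw [← h, zero_add]
      exact abs_pos.2 this
    · positivity
  obtain ⟨C, η, hη, hC⟩ := sqDensity_holder hα hα1 hF hm (abs_nonneg lam) hreg
  obtain ⟨P, h1, h2, h3⟩ := plemelj_sq hg hpos (fun u hu => sqDensity_of_lt F hu)
    (half_pos hα) hη hC
  simp only [indicator_pv_eq] at h1 h2
  refine ⟨P, fun ε hε => ?_, ?_, ?_⟩
  · have h := h1 ε hε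
    rw [IntegrableOn, integrable_indicator_iff measurableSet_Icc, IntegrableOn,
      Measure.restrict_restrict measurableSet_Icc] at h
    exact h
  · refine h2.congr fun ε => ?_
    rw [setIntegral_indicator measurableSet_Icc, inter_comm, ← pvDomain_eq]
  · obtain ⟨s, hs, hsl, hsgn⟩ : ∃ s : ℝ, s ^ 2 = 1 ∧ |lam| = s * lam ∧
        (Complex.I * Real.pi * s) • levelInt m F (lam ^ 2) =
          (Complex.I * Real.pi * SignType.sign lam) • levelInt m F (lam ^ 2) := by
      rcases lt_trichotomy lam 0 with h | h | h
      · exact ⟨-1, by norm_num, by rw [abs_of_neg h]; ring, by simp [sign_neg h]⟩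
      · refine ⟨1, by norm_num, by rw [h]; simp, ?_⟩
        rw [levelInt_eq_zero, smul_zero, smul_zero]
        intro h0
        have : 0 < m := by
          rw [h, abs_zero, add_zero] at hpos
          exact hpos
        rw [h] at h0
        have := h0.1
        nlinarith
      · exact ⟨1, by norm_num, by rw [abs_of_pos h]; ring, by simp [sign_pos h]⟩
    have h4 := h3 s hs
    rw [sqDensity_self hm F (abs_nonneg lam) (fun h => hreg.1 (by rw [h])), sq_abs, hsgn] at h4
    refine h4.congr fun δ => ?_
    have hw : (((|lam| : ℝ) : ℂ) + Complex.I * s * δ) ^ 2 = ((lam : ℂ) + δ * Complex.I) ^ 2 := by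
      have hs' : (s : ℂ) ^ 2 = 1 := by exact_mod_cast hs
      rw [hsl]
      push_cast
      linear_combination ((lam : ℂ) + δ * Complex.I) ^ 2 * hs'
    rw [integral_sq hm, hw, ← integral_indicator measurableSet_Icc]
    refine integral_congr_ae (Eventually.of_forall fun u => ?_)
    by_cases h : u ∈ Icc m (√(m ^ 2 + 8))
    · simp only [sqDensity, indicator_of_mem h]
      rw [smul_comm]
      push_cast
      rfl
    · simp only [sqDensity, indicator_of_notMem h, smul_zero]

end BoundaryValue

/-! ### From trace class integrals to the operators of the statement -/

section Operators

theorem TraceIntegrable.congr {α : Type*} [MeasurableSpace α] {F G : α → L2T3 →L[ℂ] L2T3}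
    {ν : Measure α} (hF : TraceIntegrable F ν) (h : F =ᵐ[ν] G) : TraceIntegrable G ν := by
  refine ⟨hF.1.congr h, ?_⟩
  have h1 : ∫⁻ x, traceNorm (G x) ∂ν = ∫⁻ x, traceNorm (F x) ∂ν :=
    lintegral_congr_ae (h.symm.fun_comp traceNorm)
  rw [h1]
  exact hF.2

theorem integral_sum_const_smul {α ι E : Type*} [MeasurableSpace α] [Fintype ι]
    [NormedAddCommGroup E] [NormedSpace ℂ E] {ν : Measure α} {f : ι → α → E} (c : ι → ℂ)
    (hf : ∀ k, Integrable (f k) ν) : ∫ x, ∑ k, c k • f k x ∂ν = ∑ k, c k • ∫ x, f k x ∂ν := by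
  rw [integral_finsetSum (f := fun k x => c k • f k x) _ fun k _ => (hf k).smul (c k)]
  exact Finset.sum_congr rfl fun k _ => integral_smul _ _

theorem curveIntegrand_eq (V : Potential) (m : ℝ) (z : ℂ) :
    curveIntegrand V m z = fun ξ => TraceClass.incl
      (((‖gradient (r m) ξ‖⁻¹ : ℝ) : ℂ) • traceT V m z ξ) := by
  funext ξ
  rw [curveIntegrand, T_eq_incl, map_smul]

variable {V : Potential} {α : ℝ}

theorem BddHolder.integrable {E : Type*} [NormedAddCommGroup E] [NormedSpace ℂ E]
    [CompleteSpace E] (hα : 0 < α) {F : Plane → E} (hF : BddHolder α F) {m ρ : ℝ}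
    (hρ : RegularLevel m ρ) :
    Integrable (fun ξ => ((‖gradient (r m) ξ‖⁻¹ : ℝ) : ℂ) • F ξ) (curveMeasure m ρ) := by
  have hc := hF.continuous hα
  obtain ⟨D, _, h, _⟩ := hF
  exact hρ.integrable hc h

theorem traceIntegrable_curveIntegrand (hα : 0 < α)
    (hT : ∀ k, BddHolder α fun ξ => traceCoeff V ξ k) {m ρ : ℝ} (hρ : RegularLevel m ρ) (z : ℂ) :
    TraceIntegrable (curveIntegrand V m z) (curveMeasure m ρ) := by
  rw [curveIntegrand_eq]
  exact traceIntegrable_incl ((bddHolder_traceT hT m z).integrable hα hρ)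

theorem levelIntegral_eq_incl (hα : 0 < α)
    (hT : ∀ k, BddHolder α fun ξ => traceCoeff V ξ k) {m ρ : ℝ} (hρ : RegularLevel m ρ) (z : ℂ) :
    levelIntegral V m z ρ = TraceClass.incl (levelInt m (traceT V m z) ρ) := by
  rw [levelIntegral, curveIntegrand_eq]
  exact TraceClass.integral_incl ((bddHolder_traceT hT m z).integrable hα hρ)

theorem levelInt_traceT (hα : 0 < α)
    (hT : ∀ k, BddHolder α fun ξ => traceCoeff V ξ k) {m ρ : ℝ} (hρ : RegularLevel m ρ) (z : ℂ) :
    levelInt m (traceT V m z) ρ =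
      ∑ k : Fin 3, ((m : ℂ) + z) ^ (k : ℕ) • levelInt m (fun ξ => traceCoeff V ξ k) ρ := by
  refine Eq.trans ?_ (integral_sum_const_smul (fun k : Fin 3 => ((m : ℂ) + z) ^ (k : ℕ))
    fun k => (hT k).integrable hα hρ)
  refine integral_congr_ae (Eventually.of_forall fun ξ => ?_)
  simp only [traceT_eq_sum, Finset.smul_sum]
  exact Finset.sum_congr rfl fun k _ => smul_comm _ _ _

/-- Trace norm convergence of the level integral is available at regular levels only; the three
critical values form a null set. -/
theorem resolventIntegrand_ae (hα : 0 < α)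
    (hT : ∀ k, BddHolder α fun ξ => traceCoeff V ξ k) (m : ℝ) (z : ℂ) :
    ∀ᵐ ρ : ℝ, TraceClass.incl (((ρ : ℂ) - z ^ 2)⁻¹ • levelInt m (traceT V m z) ρ) =
      resolventIntegrand V m z ρ := by
  filter_upwards [ae_regularLevel m] with ρ hρ
  rw [resolventIntegrand, levelIntegral_eq_incl hα hT hρ, map_smul]

theorem BddHolder.coarea {E : Type*} [NormedAddCommGroup E] [NormedSpace ℂ E]
    [CompleteSpace E] (hα : 0 < α) {F : Plane → E} (hF : BddHolder α F) (m : ℝ) {z : ℂ}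
    (hz : z.im ≠ 0) :
    IntegrableOn (fun ρ : ℝ => ((ρ : ℂ) - z ^ 2)⁻¹ • levelInt m F ρ) (Ioc (m ^ 2) (m ^ 2 + 8)) ∧
    ∫ ρ in Ioc (m ^ 2) (m ^ 2 + 8), ((ρ : ℂ) - z ^ 2)⁻¹ • levelInt m F ρ =
      ∫ x in unitSquare, ((r m (toPlane x) : ℂ) - z ^ 2)⁻¹ • F (toPlane x) := by
  have hc := hF.continuous hα
  obtain ⟨D, _, h, _⟩ := hF
  exact DiracZ2.coarea hc h m (continuousOn_inv_sub_sq hz m)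

theorem traceIntegrable_resolventIntegrand (hα : 0 < α)
    (hT : ∀ k, BddHolder α fun ξ => traceCoeff V ξ k) (m : ℝ) {z : ℂ} (hz : z.im ≠ 0) :
    TraceIntegrable (resolventIntegrand V m z) (volume.restrict (Ioc (m ^ 2) (m ^ 2 + 8))) :=
  (traceIntegrable_incl ((bddHolder_traceT hT m z).coarea hα m hz).1).congr
    (ae_restrict_of_ae (resolventIntegrand_ae hα hT m z))

theorem resolventIntegral_eq_incl (hα : 0 < α)
    (hT : ∀ k, BddHolder α fun ξ => traceCoeff V ξ k) (m : ℝ) {z : ℂ} (hz : z.im ≠ 0) :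
    resolventIntegral V m z = TraceClass.incl (∫ ρ in Ioc (m ^ 2) (m ^ 2 + 8),
      ((ρ : ℂ) - z ^ 2)⁻¹ • levelInt m (traceT V m z) ρ) := by
  rw [resolventIntegral,
    ← TraceClass.integral_incl ((bddHolder_traceT hT m z).coarea hα m hz).1]
  refine integral_congr_ae ?_
  filter_upwards [ae_restrict_of_ae (resolventIntegrand_ae hα hT m z)] with ρ hρ
  exact hρ.symm

theorem integral_levelInt_traceT (hα : 0 < α)
    (hT : ∀ k, BddHolder α fun ξ => traceCoeff V ξ k) (m : ℝ) {z : ℂ} (hz : z.im ≠ 0) :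
    ∫ ρ in Ioc (m ^ 2) (m ^ 2 + 8), ((ρ : ℂ) - z ^ 2)⁻¹ • levelInt m (traceT V m z) ρ =
      ∑ k : Fin 3, ((m : ℂ) + z) ^ (k : ℕ) • ∫ ρ in Ioc (m ^ 2) (m ^ 2 + 8),
        ((ρ : ℂ) - z ^ 2)⁻¹ • levelInt m (fun ξ => traceCoeff V ξ k) ρ := by
  refine Eq.trans ?_ (integral_sum_const_smul (fun k : Fin 3 => ((m : ℂ) + z) ^ (k : ℕ))
    fun k => ((hT k).coarea hα m hz).1)
  refine integral_congr_ae ?_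
  filter_upwards [ae_restrict_of_ae (ae_regularLevel m)] with ρ hρ
  rw [levelInt_traceT hα hT hρ, Finset.smul_sum]
  exact Finset.sum_congr rfl fun k _ => smul_comm _ _ _

theorem conjU_K_eq_resolventIntegral (hα : 0 < α)
    (hT : ∀ k, BddHolder α fun ξ => traceCoeff V ξ k) (m : ℝ) {z : ℂ} (hz : z.im ≠ 0) :
    conjU (K V m z) = ((m : ℂ) + z)⁻¹ •
      (conjU V.op ∘L negEdgeProj + resolventIntegral V m z) := by
  have h := bddHolder_traceT hT m z
  rw [conjU_K V hz (h.continuous hα), resolventIntegral_eq_incl hα hT m hz, (h.coarea hα m hz).2]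

end Operators

/-! ### Self-adjointness, real and imaginary parts -/

section SelfAdjoint

/-- The adjoint is a continuous real-linear equivalence, so it commutes with the Bochner integral
even without integrability. -/
theorem isSelfAdjoint_integral {α H : Type*} [MeasurableSpace α] [NormedAddCommGroup H]
    [InnerProductSpace ℂ H] [CompleteSpace H] {ν : Measure α} {F : α → H →L[ℂ] H}
    (hF : ∀ x, IsSelfAdjoint (F x)) : IsSelfAdjoint (∫ x, F x ∂ν) := by
  have h := (starL' ℝ (A := H →L[ℂ] H)).integral_comp_comm (μ := ν) F
  rw [isSelfAdjoint_iff]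
  refine h.symm.trans (integral_congr_ae (Eventually.of_forall fun x => ?_))
  exact (hF x).star_eq

theorem isSelfAdjoint_of_tendsto {ι H : Type*} [NormedAddCommGroup H] [InnerProductSpace ℂ H]
    [CompleteSpace H] {l : Filter ι} [l.NeBot] {u : ι → H →L[ℂ] H} {S : H →L[ℂ] H}
    (h : Tendsto u l (𝓝 S)) (hu : ∀ᶠ i in l, IsSelfAdjoint (u i)) : IsSelfAdjoint S :=
  (isClosed_eq continuous_star continuous_id).mem_of_tendsto h hu

/-- For a real spectral parameter the left and right vectors coincide, so the operator is `v ↦ ⟪y,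
v⟫ y` for a single vector `y`. -/
theorem isSelfAdjoint_T (V : Potential) (m lam : ℝ) (ξ : Plane) :
    IsSelfAdjoint (T V m lam ξ) := by
  have h : rightVec V m lam ξ = leftVec V m lam ξ := by
    rw [rightVec_eq, leftVec_eq, map_add, Complex.conj_ofReal, Complex.conj_ofReal]
  rw [ContinuousLinearMap.isSelfAdjoint_iff_isSymmetric]
  intro x y
  change ⟪T V m lam ξ x, y⟫_ℂ = ⟪x, T V m lam ξ y⟫_ℂ
  rw [T_eq_incl, traceT, h, TraceClass.incl_rankOne_apply, TraceClass.incl_rankOne_apply,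
    inner_smul_left, inner_smul_right, inner_conj_symm, mul_comm]

theorem isSelfAdjoint_real_smul {H : Type*} [NormedAddCommGroup H]
    [InnerProductSpace ℂ H] [CompleteSpace H] (c : ℝ) {S : H →L[ℂ] H} (hS : IsSelfAdjoint S) :
    IsSelfAdjoint ((c : ℂ) • S) := by
  rw [isSelfAdjoint_iff, star_smul, hS.star_eq]
  simp

theorem isSelfAdjoint_levelIntegral (V : Potential) (m lam ρ : ℝ) :
    IsSelfAdjoint (levelIntegral V m lam ρ) :=
  isSelfAdjoint_integral fun ξ => isSelfAdjoint_real_smul _ (isSelfAdjoint_T V m lam ξ)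

theorem isSelfAdjoint_conjU_op_negEdgeProj (V : Potential) :
    IsSelfAdjoint (conjU V.op ∘L negEdgeProj) := by
  rw [ContinuousLinearMap.isSelfAdjoint_iff_isSymmetric]
  intro φ ψ
  change ⟪(conjU V.op ∘L negEdgeProj) φ, ψ⟫_ℂ = ⟪φ, (conjU V.op ∘L negEdgeProj) ψ⟫_ℂ
  rw [← inner_conj_symm, inner_conjU_op_negEdgeProj, inner_conjU_op_negEdgeProj, map_sub, map_neg,
    inner_conj_symm, inner_conj_symm]

/-- The operator `𝒰* S 𝒰` on `l²(X)`. -/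
def conjUSymm (S : L2T3 →L[ℂ] L2T3) : L2X →L[ℂ] L2X :=
  (𝒰.symm : L2T3 →L[ℂ] L2X) ∘L S ∘L (𝒰 : L2X →L[ℂ] L2T3)

theorem conjU_conjUSymm (S : L2T3 →L[ℂ] L2T3) : conjU (conjUSymm S) = S := by
  ext1 ψ
  change 𝒰 (𝒰.symm (S (𝒰 (𝒰.symm ψ)))) = S ψ
  rw [LinearIsometryEquiv.apply_symm_apply, LinearIsometryEquiv.apply_symm_apply]

theorem conjUSymm_conjU (S : L2X →L[ℂ] L2X) : conjUSymm (conjU S) = S := by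
  ext1 f
  change 𝒰.symm (𝒰 (S (𝒰.symm (𝒰 f)))) = S f
  rw [LinearIsometryEquiv.symm_apply_apply, LinearIsometryEquiv.symm_apply_apply]

theorem continuous_conjUSymm : Continuous conjUSymm :=
  continuous_const.clm_comp (continuous_id.clm_comp continuous_const)

theorem isSelfAdjoint_conjUSymm {S : L2T3 →L[ℂ] L2T3} (hS : IsSelfAdjoint S) :
    IsSelfAdjoint (conjUSymm S) := by
  rw [ContinuousLinearMap.isSelfAdjoint_iff_isSymmetric] at hS ⊢
  intro f g
  change ⟪𝒰.symm (S (𝒰 f)), g⟫_ℂ = ⟪f, 𝒰.symm (S (𝒰 g))⟫_ℂ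
  rw [← 𝒰.inner_map_map, ← 𝒰.inner_map_map f, LinearIsometryEquiv.apply_symm_apply,
    LinearIsometryEquiv.apply_symm_apply]
  exact hS _ _

theorem realPart_add_I_smul {H : Type*} [NormedAddCommGroup H] [InnerProductSpace ℂ H]
    [CompleteSpace H] {A B : H →L[ℂ] H} (hA : IsSelfAdjoint A) (hB : IsSelfAdjoint B) :
    (realPart (A + Complex.I • B) : H →L[ℂ] H) = A ∧
      (imaginaryPart (A + Complex.I • B) : H →L[ℂ] H) = B := by
  constructor
  · rw [map_add, realPart_I_smul, hB.imaginaryPart, neg_zero, add_zero, hA.coe_realPart]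
  · rw [map_add, imaginaryPart_I_smul, hA.imaginaryPart, zero_add, hB.coe_realPart]

end SelfAdjoint

/-! ### Boundary values on the real axis -/

section Limit

/-- Half of the least `β j` is strictly below all of them, as convergence of the dyadic sums
requires. -/
theorem exists_holder_exponent {β : Fin 3 → ℝ} (hβ : ∀ j, 0 < β j ∧ β j ≤ 1) :
    ∃ α, 0 < α ∧ α ≤ 1 ∧ ∀ j, α < β j := by
  obtain ⟨j₀, hj₀⟩ := Finite.exists_min β
  have h := hβ j₀
  exact ⟨β j₀ / 2, by linarith, by linarith, fun j => by linarith [hj₀ j]⟩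

variable {V : Potential} {α : ℝ}

theorem pvIntegrand_ae (hα : 0 < α) (hT : ∀ k, BddHolder α fun ξ => traceCoeff V ξ k)
    (m lam : ℝ) : ∀ᵐ u : ℝ, TraceClass.incl (∑ k : Fin 3, ((m : ℂ) + lam) ^ (k : ℕ) •
      ((2 * u / (u ^ 2 - lam ^ 2) : ℝ) : ℂ) • levelInt m (fun ξ => traceCoeff V ξ k) (u ^ 2)) =
        pvIntegrand V m lam u := by
  filter_upwards [ae_regularLevel_sq m] with u hu
  rw [pvIntegrand, levelIntegral_eq_incl hα hT hu, ← map_smul, levelInt_traceT hα hT hu,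
    Finset.smul_sum]
  congr 1
  exact Finset.sum_congr rfl fun k _ => smul_comm _ _ _

/-- The principal value and the boundary value of the resolvent integral. -/
theorem exists_principalValue (hα : 0 < α) (hα1 : α ≤ 1)
    (hT : ∀ k, BddHolder α fun ξ => traceCoeff V ξ k) {m lam : ℝ} (hm : 0 ≤ m)
    (hlam : lam ∉ thresholds m) :
    ∃ P : L2T3 →L[ℂ] L2T3, IsPrincipalValue V m lam P ∧ IsTraceClass P ∧ IsSelfAdjoint P ∧
      Tendsto (fun δ : ℝ => traceNorm (resolventIntegral V m (lam + δ * Complex.I) -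
        (P + (Complex.I * Real.pi * SignType.sign lam) • levelIntegral V m lam (lam ^ 2))))
        (𝓝[>] 0) (𝓝 0) ∧
      Tendsto (fun δ : ℝ => resolventIntegral V m (lam + δ * Complex.I)) (𝓝[>] 0)
        (𝓝 (P + (Complex.I * Real.pi * SignType.sign lam) •
          levelIntegral V m lam (lam ^ 2))) := by
  -- One principal value for each coefficient of the polynomial in `m + z`. They are recombined with
  -- the powers of `m + λ`, the limits of the powers of `m + z`.
  choose P hP1 hP2 hP3 using fun k => boundaryValue hα hα1 (hT k) hm hlam
  set S : TC := ∑ k : Fin 3, ((m : ℂ) + lam) ^ (k : ℕ) • P k with hS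
  have hae := fun ε => ae_restrict_of_ae (s := pvDomain m lam ε) (pvIntegrand_ae hα hT m lam)
  have hint : ∀ ε > 0, ∫ u in pvDomain m lam ε, pvIntegrand V m lam u = TraceClass.incl
      (∑ k : Fin 3, ((m : ℂ) + lam) ^ (k : ℕ) • ∫ u in pvDomain m lam ε,
        ((2 * u / (u ^ 2 - lam ^ 2) : ℝ) : ℂ) • levelInt m (fun ξ => traceCoeff V ξ k) (u ^ 2)) := by
    intro ε hε
    rw [← integral_sum_const_smul _ fun k => hP1 k ε hε]
    refine (integral_congr_ae ((hae ε).mono fun u hu => hu.symm)).trans (TraceClass.integral_incl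
      (integrable_finsetSum _ fun k _ => (hP1 k ε hε).smul (((m : ℂ) + lam) ^ (k : ℕ))))
  have hlim : Tendsto (fun ε : ℝ => ∑ k : Fin 3, ((m : ℂ) + lam) ^ (k : ℕ) •
      ∫ u in pvDomain m lam ε, ((2 * u / (u ^ 2 - lam ^ 2) : ℝ) : ℂ) •
        levelInt m (fun ξ => traceCoeff V ξ k) (u ^ 2)) (𝓝[>] 0) (𝓝 S) :=
    tendsto_finsetSum _ fun k _ => (hP2 k).const_smul _
  have hJ : TraceClass.incl (S + (Complex.I * Real.pi * SignType.sign lam) •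
      levelInt m (traceT V m lam) (lam ^ 2)) = TraceClass.incl S +
        (Complex.I * Real.pi * SignType.sign lam) • levelIntegral V m lam (lam ^ 2) := by
    rw [map_add, map_smul, levelIntegral_eq_incl hα hT (regularLevel_sq hlam)]
  have hres : Tendsto (fun δ : ℝ => ∑ k : Fin 3,
      ((m : ℂ) + (lam + δ * Complex.I)) ^ (k : ℕ) • ∫ ρ in Ioc (m ^ 2) (m ^ 2 + 8),
        ((ρ : ℂ) - ((lam : ℂ) + δ * Complex.I) ^ 2)⁻¹ • levelInt m (fun ξ => traceCoeff V ξ k) ρ)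
      (𝓝[>] 0) (𝓝 (S + (Complex.I * Real.pi * SignType.sign lam) •
        levelInt m (traceT V m lam) (lam ^ 2))) := by
    have e : S + (Complex.I * Real.pi * SignType.sign lam) •
        levelInt m (traceT V m lam) (lam ^ 2) = ∑ k : Fin 3, ((m : ℂ) + lam) ^ (k : ℕ) •
          (P k + (Complex.I * Real.pi * SignType.sign lam) •
            levelInt m (fun ξ => traceCoeff V ξ k) (lam ^ 2)) := by
      rw [levelInt_traceT hα hT (regularLevel_sq hlam), hS, Finset.smul_sum,
        ← Finset.sum_add_distrib]
      refine Finset.sum_congr rfl fun k _ => ?_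
      rw [smul_add, smul_comm (Complex.I * Real.pi * SignType.sign lam)]
    rw [e]
    refine tendsto_finsetSum _ fun k _ => Tendsto.smul ?_ (hP3 k)
    have hc : Continuous fun δ : ℝ => ((m : ℂ) + (lam + δ * Complex.I)) ^ (k : ℕ) := by fun_prop
    have := (hc.tendsto 0).mono_left (nhdsWithin_le_nhds (s := Ioi 0))
    simpa using this
  have hev : ∀ᶠ δ : ℝ in 𝓝[>] 0, TraceClass.incl (∑ k : Fin 3,
      ((m : ℂ) + (lam + δ * Complex.I)) ^ (k : ℕ) • ∫ ρ in Ioc (m ^ 2) (m ^ 2 + 8),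
        ((ρ : ℂ) - ((lam : ℂ) + δ * Complex.I) ^ 2)⁻¹ •
          levelInt m (fun ξ => traceCoeff V ξ k) ρ) =
      resolventIntegral V m (lam + δ * Complex.I) := by
    filter_upwards [self_mem_nhdsWithin] with δ hδ
    have hz : ((lam : ℂ) + δ * Complex.I).im ≠ 0 := by simpa using (ne_of_gt hδ : δ ≠ 0)
    rw [resolventIntegral_eq_incl hα hT m hz, integral_levelInt_traceT hα hT m hz]
  have hpv : IsPrincipalValue V m lam (TraceClass.incl S) := by
    refine ⟨fun ε hε => (traceIntegrable_incl (integrable_finsetSum _ fun k _ =>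
      (hP1 k ε hε).smul (((m : ℂ) + lam) ^ (k : ℕ)))).congr (hae ε), ?_⟩
    refine (TraceClass.tendsto_traceNorm_sub hlim).congr' ?_
    filter_upwards [self_mem_nhdsWithin] with ε hε
    rw [hint ε hε]
  refine ⟨TraceClass.incl S, hpv, TraceClass.isTraceClass_incl S, ?_, ?_, ?_⟩
  -- The principal value is an operator norm limit of truncated integrals, which are self-adjoint
  -- because their integrands are real multiples of level integrals at the real parameter `λ`.
  · have h1 := ((TraceClass.incl (H := L2T3)).continuous.tendsto S).comp hlim
    refine isSelfAdjoint_of_tendsto h1 ?_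
    filter_upwards [self_mem_nhdsWithin] with ε hε
    change IsSelfAdjoint (TraceClass.incl _)
    rw [← hint ε hε]
    exact isSelfAdjoint_integral fun u =>
      isSelfAdjoint_real_smul _ (isSelfAdjoint_levelIntegral V m lam _)
  · rw [← hJ]
    exact (TraceClass.tendsto_traceNorm_sub hres).congr' (hev.mono fun δ hδ => by rw [hδ])
  · rw [← hJ]
    exact (((TraceClass.incl (H := L2T3)).continuous.tendsto _).comp hres).congr' hev

/-- The boundary value of the sandwiched resolvent. -/
theorem exists_boundaryValue_K (hα : 0 < α)
    (hT : ∀ k, BddHolder α fun ξ => traceCoeff V ξ k) {m lam : ℝ} (hmlam : m + lam ≠ 0)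
    {P : L2T3 →L[ℂ] L2T3} (hP : IsSelfAdjoint P)
    (hlim : Tendsto (fun δ : ℝ => resolventIntegral V m (lam + δ * Complex.I)) (𝓝[>] 0)
      (𝓝 (P + (Complex.I * Real.pi * SignType.sign lam) • levelIntegral V m lam (lam ^ 2)))) :
    ∃ K₀ : L2X →L[ℂ] L2X,
      Tendsto (fun δ : ℝ => K V m (lam + δ * Complex.I)) (𝓝[>] 0) (𝓝 K₀) ∧
      conjU (imaginaryPart K₀ : L2X →L[ℂ] L2X) =
        ((Real.pi * SignType.sign lam / (m + lam) : ℝ) : ℂ) •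
          levelIntegral V m lam (lam ^ 2) ∧
      conjU (realPart K₀ : L2X →L[ℂ] L2X) =
        ((1 / (m + lam) : ℝ) : ℂ) • (conjU V.op ∘L negEdgeProj) +
          ((1 / (m + lam) : ℝ) : ℂ) • P := by
  -- `A` and `B` are the prescribed real and imaginary parts. Both are self-adjoint, so once the
  -- limit is shown to be `A + iB`, uniqueness of the decomposition gives the two formulas.
  set A := ((1 / (m + lam) : ℝ) : ℂ) • (conjU V.op ∘L negEdgeProj) +
    ((1 / (m + lam) : ℝ) : ℂ) • P with hA
  set B := ((Real.pi * SignType.sign lam / (m + lam) : ℝ) : ℂ) •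
    levelIntegral V m lam (lam ^ 2) with hB
  have hAs : IsSelfAdjoint A := (isSelfAdjoint_real_smul _
    (isSelfAdjoint_conjU_op_negEdgeProj V)).add (isSelfAdjoint_real_smul _ hP)
  have hBs : IsSelfAdjoint B := isSelfAdjoint_real_smul _ (isSelfAdjoint_levelIntegral V m lam _)
  have hAB := realPart_add_I_smul (isSelfAdjoint_conjUSymm hAs) (isSelfAdjoint_conjUSymm hBs)
  refine ⟨conjUSymm A + Complex.I • conjUSymm B, ?_, ?_, ?_⟩
  · have hsum : conjUSymm A + Complex.I • conjUSymm B = conjUSymm (((m : ℂ) + lam)⁻¹ •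
        (conjU V.op ∘L negEdgeProj + (P + (Complex.I * Real.pi * SignType.sign lam) •
          levelIntegral V m lam (lam ^ 2)))) := by
      have h1 : ((m : ℂ) + lam)⁻¹ • (conjU V.op ∘L negEdgeProj +
          (P + (Complex.I * Real.pi * SignType.sign lam) • levelIntegral V m lam (lam ^ 2))) =
          A + Complex.I • B := by
        have hsgn : (((SignType.sign lam : SignType) : ℝ) : ℂ) = (SignType.sign lam : SignType) := by
          cases SignType.sign lam <;> simp
        rw [hA, hB, smul_smul]
        push_cast
        rw [hsgn, smul_add, smul_add, smul_smul, one_div, add_assoc]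
        congr 3
        ring
      rw [h1]
      ext1 f
      change 𝒰.symm (A (𝒰 f)) + Complex.I • 𝒰.symm (B (𝒰 f)) =
        𝒰.symm (A (𝒰 f) + Complex.I • B (𝒰 f))
      rw [map_add, map_smul]
    rw [hsum]
    have hc : Tendsto (fun δ : ℝ => ((m : ℂ) + (lam + δ * Complex.I))⁻¹) (𝓝[>] 0)
        (𝓝 ((m : ℂ) + lam)⁻¹) := by
      have h0 : Continuous fun δ : ℝ => (m : ℂ) + (lam + δ * Complex.I) := by fun_prop
      have h1 := (h0.tendsto 0).mono_left (nhdsWithin_le_nhds (s := Ioi 0))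
      rw [Complex.ofReal_zero, zero_mul, add_zero] at h1
      exact h1.inv₀ (by exact_mod_cast hmlam)
    refine ((continuous_conjUSymm.tendsto _).comp
      (hc.smul (hlim.const_add (conjU V.op ∘L negEdgeProj)))).congr' ?_
    filter_upwards [self_mem_nhdsWithin] with δ hδ
    have hz : ((lam : ℂ) + δ * Complex.I).im ≠ 0 := by simpa using (ne_of_gt hδ : δ ≠ 0)
    rw [Function.comp_apply, ← conjU_K_eq_resolventIntegral hα hT m hz, conjUSymm_conjU]
  · rw [hAB.2, conjU_conjUSymm]
  · rw [hAB.1, conjU_conjUSymm]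

end Limit

end DiracZ2

end

/-! ### The proposition -/

theorem mainTheorem4 (m : ℝ) (hm : 0 ≤ m) (V : DiracZ2.Potential)
    (β : Fin 3 → ℝ) (hβ : ∀ j, 0 < β j ∧ β j ≤ 1) (hV : ∀ j, V.Decay j (β j))
    (lam : ℝ) (hlam : lam ∉ DiracZ2.thresholds m) :
    -- all the integrals converge absolutely in the trace norm
    (∀ δ : ℝ, 0 < δ →
      (∀ᵐ ρ ∂(volume.restrict (Ioc (m ^ 2) (m ^ 2 + 8))),
        DiracZ2.TraceIntegrable (DiracZ2.curveIntegrand V m (lam + δ * Complex.I))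
          (DiracZ2.curveMeasure m ρ)) ∧
      DiracZ2.TraceIntegrable (DiracZ2.resolventIntegrand V m (lam + δ * Complex.I))
        (volume.restrict (Ioc (m ^ 2) (m ^ 2 + 8)))) ∧
    (∀ᵐ u ∂(volume.restrict (Icc m (√(m ^ 2 + 8)))),
      DiracZ2.TraceIntegrable (DiracZ2.curveIntegrand V m lam) (DiracZ2.curveMeasure m (u ^ 2))) ∧
    DiracZ2.TraceIntegrable (DiracZ2.curveIntegrand V m lam) (DiracZ2.curveMeasure m (lam ^ 2)) ∧
    -- the limit in the trace norm
    ∃ P : DiracZ2.L2T3 →L[ℂ] DiracZ2.L2T3,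
      DiracZ2.IsPrincipalValue V m lam P ∧ DiracZ2.IsTraceClass P ∧
      Tendsto (fun δ : ℝ => DiracZ2.traceNorm
          (DiracZ2.resolventIntegral V m (lam + δ * Complex.I) -
            (P + (Complex.I * Real.pi * SignType.sign lam) •
              DiracZ2.levelIntegral V m lam (lam ^ 2))))
        (𝓝[>] 0) (𝓝 0) ∧
      -- the boundary value of the sandwiched resolvent, its real part and its imaginary part
      ∃ K₀ : DiracZ2.L2X →L[ℂ] DiracZ2.L2X,
        Tendsto (fun δ : ℝ => DiracZ2.K V m (lam + δ * Complex.I)) (𝓝[>] 0) (𝓝 K₀) ∧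
        DiracZ2.conjU (imaginaryPart K₀ : DiracZ2.L2X →L[ℂ] DiracZ2.L2X) =
          ((Real.pi * SignType.sign lam / (m + lam) : ℝ) : ℂ) •
            DiracZ2.levelIntegral V m lam (lam ^ 2) ∧
        DiracZ2.conjU (realPart K₀ : DiracZ2.L2X →L[ℂ] DiracZ2.L2X) =
          ((1 / (m + lam) : ℝ) : ℂ) • (DiracZ2.conjU V.op ∘L DiracZ2.negEdgeProj) +
            ((1 / (m + lam) : ℝ) : ℂ) • P := by
  obtain ⟨α, hα, hα1, hαβ⟩ := DiracZ2.exists_holder_exponent hβ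
  have hT := DiracZ2.bddHolder_traceCoeff hV hα hα1 hαβ
  have hmlam : m + lam ≠ 0 := by
    intro h
    have h1 : lam = -m := by linarith
    exact hlam (by simp [DiracZ2.thresholds, h1])
  obtain ⟨P, hpv, htr, hsa, hlim, hlim'⟩ := DiracZ2.exists_principalValue hα hα1 hT hm hlam
  refine ⟨fun δ hδ => ⟨?_, ?_⟩, ?_, ?_, P, hpv, htr, hlim,
    DiracZ2.exists_boundaryValue_K hα hT hmlam hsa hlim'⟩
  · filter_upwards [ae_restrict_of_ae (DiracZ2.ae_regularLevel m)] with ρ hρ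
    exact DiracZ2.traceIntegrable_curveIntegrand hα hT hρ _
  · exact DiracZ2.traceIntegrable_resolventIntegrand hα hT m (by simpa using hδ.ne')
  · filter_upwards [ae_restrict_of_ae (DiracZ2.ae_regularLevel_sq m)] with u hu
    exact DiracZ2.traceIntegrable_curveIntegrand hα hT hu _
  · exact DiracZ2.traceIntegrable_curveIntegrand hα hT (DiracZ2.regularLevel_sq hlam) _
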